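/- **Setting.** Let $m\in\{1,2\}$, $T>0$, and let $\Gamma(t)\subset\mathbb R^{m+1}$, $0\le t\le T$, be a smooth evolving compact hypersurface without boundary, given as the regular zero level set $\{\varphi(\cdot,t)=0\}$ of a smooth function $\varphi$ (with $\nabla\varphi\neq0$ on $\Gamma(t)$), which moves with a smooth velocity $v$: $\Gamma(t)=X(\Gamma(0),t)$ with a smooth $X$, $X(a,0)=a$, $\partial_tX(a,t)=v(X(a,t),t)$. Let $d(\cdot,t)$ be the oriented distance to $\Gamma(t)$ (with the sign of $\varphi$), $\nu=\nabla d$ the normal, extended off $\Gamma(t)$, $\mathcal H=(\partial_{x_j}\nu_i)_{ij}$ the extended Weingarten map, $p(x,t)=x-d(x,t)\,\nu(x,t)$ the normal projection onto $\Gamma(t)$, and $\mathrm{Pr}(x,t)=\mathrm{Id}-\nu\nu^{T}$ the orthogonal projection onto the tangent space of $\Gamma(t)$ at $p(x,t)$. Let $k\ge1$, $\sigma>0$. Take an admissible (conforming) triangulation by flat $m$-simplices with vertices on $\Gamma(0)$, whose union is mapped bijectively onto $\Gamma(0)$ by $p(\cdot,0)$, and which is shape regular with constant $\sigma$ (each simplex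 $E$ contains an $m$-ball of radius $\operatorname{diam}(E)/\sigma$). The Lagrange nodes of degree $k$ of the flat simplices are projected to $\Gamma(0)$ by $p(\cdot,0)$ and then moved with the velocity $v$ to nodes $a_{E,\alpha}(t)\in\Gamma(t)$. The elements of the interpolating surface $\Gamma_h(t)=\Gamma_h^k(t)$ are $E(t)=F_E(\,\cdot\,,t)(E_0)$, where $E_0$ is the unit simplex, $F_E(\xi,t)=\sum_\alpha\chi_\alpha(\xi)\,a_{E,\alpha}(t)$ and the $\chi_\alpha$ are the Lagrange basis polynomials of degree $k$. Let $h$ be (an upper bound of) the maximal diameter of the elements $E(t)$, $0\le t\le T$. Elementwise on $\Gamma_h(t)$, let $\nu_h$ be the unit normal, oriented by $\nu_h\cdot\nu\ge0$; let $\mathrm{Pr}_h$ be the orthogonal projection onto the tangent space of $\Gamma_h(t)$; let $\delta_h$ be the quotient of the surface measures, $\delta_h\,dA_h=dA$ (via $p$); and let $$Q_h=\tfrac1{\delta_h}(\mathrm{Id}-d\mathcal H)\,\mathrm{Pr}\,\mathrm{Pr}_h\,\mathrm{Pr}\,(\mathrm{Id}-d\mathcal H).$$ Let $V_h=\sum_j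 v(a_j(t),t)\chi_j$ be the interpolated velocity and $\partial_h^\bullet=\partial_t+V_h\cdot\nabla$ the discrete material derivative, that is, the time derivative along the trajectories $t\mapsto F_E(\xi,t)$ of $V_h$; $(\partial_h^\bullet)^{(\ell)}$ is its $\ell$-th iterate. Matrix norms are operator norms. **Claim.** There are $h_0>0$ and constants $c=c_0,c_1,c_2,\dots>0$, depending only on the evolving surface (with its velocity), on $k$ and on $\sigma$, but not on $h$, $t$ or the triangulation, such that for all such triangulations with $h\le h_0$ and all $t\in[0,T]$ $$\|d\|_{L^\infty(\Gamma_h(t))}\le ch^{k+1},\qquad \|1-\delta_h\|_{L^\infty(\Gamma_h(t))}\le ch^{k+1},\qquad \|\nu-\nu_h\|_{L^\infty(\Gamma_h(t))}\le ch^{k},$$ $$\|\mathrm{Pr}\,(\mathrm{Id}-\delta_hQ_h)\,\mathrm{Pr}\|_{L^\infty(\Gamma_h(t))}\le ch^{k+1};$$ moreover $d$, $\delta_h$, $\mathrm{Pr}$ and $Q_h$ are smooth in $t\in[0,T]$ along the trajectories of $V_h$, and for all $\ell\ge1$ $$\|(\partial_h^\bullet)^{(\ell)}d\|_{L^\infty(\Gamma_h(t))}\le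 c_\ell h^{k+1},\qquad \|(\partial_h^\bullet)^{(\ell)}\delta_h\|_{L^\infty(\Gamma_h(t))}\le c_\ell h^{k+1},$$ $$\|\mathrm{Pr}\,(\partial_h^\bullet Q_h)\,\mathrm{Pr}\|_{L^\infty(\Gamma_h(t))}\le c_1h^{k+1},\qquad \|\mathrm{Pr}\,\big((\partial_h^\bullet)^{(\ell)}(Q_h-\mathrm{Pr})\big)\,\mathrm{Pr}\|_{L^\infty(\Gamma_h(t))}\le c_\ell h^{k+1}.$$ (The bounds hold at every point of every element, understood elementwise.) -/

import Mathlib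

open scoped ContDiff RealInnerProductSpace

/-- The ambient space `ℝ^{m+1}`. -/
abbrev Amb (m : ℕ) : Type := EuclideanSpace ℝ (Fin (m + 1))

/-- A smooth evolving compact hypersurface `Γ(t) ⊂ ℝ^{m+1}`, `0 ≤ t ≤ T`, moving with a smooth
velocity `v`. The surface is the regular zero level set of a smooth function `φ` and is oriented
by the direction in which `φ` increases. `X` is the flow of `v` on the surface: it is prescribed
on `Γ(0) × [0,T]` only, its values elsewhere are an irrelevant smooth extension. -/
structure EvolvingSurface (m : ℕ) where
  T : ℝ
  T_pos : 0 < T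
  /-- level set function of `(x, t)` -/
  φ : Amb m × ℝ → ℝ
  φ_smooth : ContDiff ℝ ∞ φ
  compact : ∀ t ∈ Set.Icc 0 T, IsCompact {x | φ (x, t) = 0}
  nonempty : ∀ t ∈ Set.Icc 0 T, {x | φ (x, t) = 0}.Nonempty
  regular : ∀ t ∈ Set.Icc 0 T, ∀ x, φ (x, t) = 0 → fderiv ℝ (fun y => φ (y, t)) x ≠ 0
  /-- velocity as a function of `(x, t)` -/
  v : Amb m × ℝ → Amb m
  v_smooth : ContDiff ℝ ∞ v
  /-- flow map as a function of `(a, t)` -/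
  X : Amb m × ℝ → Amb m
  X_smooth : ContDiff ℝ ∞ X
  X_zero : ∀ a, φ (a, 0) = 0 → X (a, 0) = a
  X_deriv : ∀ a, φ (a, 0) = 0 → ∀ t ∈ Set.Icc 0 T,
    HasDerivWithinAt (fun s => X (a, s)) (v (X (a, t), t)) (Set.Icc 0 T) t
  X_image : ∀ t ∈ Set.Icc 0 T,
    (fun a => X (a, t)) '' {a | φ (a, 0) = 0} = {x | φ (x, t) = 0}

namespace EvolvingSurface

noncomputable section

variable {m : ℕ} (S : EvolvingSurface m)

/-- The surface `Γ(t)`. -/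
def Γ (t : ℝ) : Set (Amb m) := {x | S.φ (x, t) = 0}

/-- The oriented distance function `d(x,t)`. -/
def d (x : Amb m) (t : ℝ) : ℝ := Real.sign (S.φ (x, t)) * Metric.infDist x (S.Γ t)

/-- The unit normal `ν = ∇d` of `Γ(t)`, extended to a neighbourhood of `Γ(t)`
(constantly along the normals). -/
def ν (x : Amb m) (t : ℝ) : Amb m := gradient (fun y => S.d y t) x

/-- The extended Weingarten map `𝓗`, `𝓗_{ij} = ∂_j ν_i`. -/
def weingarten (x : Amb m) (t : ℝ) : Amb m →L[ℝ] Amb m := fderiv ℝ (fun y => S.ν y t) x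

/-- The normal projection `p = x - d(x,t) ν(x,t)` onto `Γ(t)`; note `ν(p,t) = ν(x,t)` near
`Γ(t)`. -/
def proj (x : Amb m) (t : ℝ) : Amb m := x - S.d x t • S.ν x t

/-- `Pr`: the orthogonal projection onto the tangent space `ν^⊥` of `Γ(t)` (at `p(x,t)`). -/
def Pr (x : Amb m) (t : ℝ) : Amb m →L[ℝ] Amb m := (Submodule.span ℝ {S.ν x t})ᗮ.starProjection

end

end EvolvingSurface

/-- The reference (unit) simplex of dimension `m`. -/
def refSimplex (m : ℕ) : Set (EuclideanSpace ℝ (Fin m)) :=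
  {ξ | (∀ i, 0 ≤ ξ i) ∧ ∑ i, ξ i ≤ 1}

/-- Barycentric coordinates of a point with respect to the reference simplex. -/
def bary {m : ℕ} (ξ : EuclideanSpace ℝ (Fin m)) : Fin (m + 1) → ℝ :=
  Fin.cons (1 - ∑ i, ξ i) (fun i => ξ i)

/-- The Lagrange basis polynomial of degree `k` (in barycentric coordinates `b`) of the lattice
node `α / k`, where `α` is a multi-index with `∑ i, α i = k`. -/
noncomputable def lagrange {m : ℕ} (k : ℕ) (α : Fin (m + 1) → ℕ) (b : Fin (m + 1) → ℝ) : ℝ :=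
  ∏ i, ∏ s ∈ Finset.range (α i), ((k : ℝ) * b i - s) / (s + 1)

theorem lagrange_node {m k : ℕ} (hk : 1 ≤ k) (α β : Fin (m + 1) → ℕ)
    (hα : ∑ i, α i = k) (hβ : ∑ i, β i = k) :
    lagrange k α (fun i => (β i : ℝ) / k) = if α = β then 1 else 0 := by
  have hk0 : (k : ℝ) ≠ 0 := by positivity
  unfold lagrange
  split_ifs with h
  · subst h
    refine Finset.prod_eq_one fun i _ => ?_
    rw [mul_div_cancel₀ _ hk0, Finset.prod_div_distrib]
    have h1 : ∏ s ∈ Finset.range (α i), ((α i : ℝ) - s)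
        = ∏ s ∈ Finset.range (α i), ((s : ℝ) + 1) := by
      rw [← Finset.prod_range_reflect]
      refine Finset.prod_congr rfl fun s hs => ?_
      have hs' : s + 1 ≤ α i := Finset.mem_range.1 hs
      rw [Nat.sub_sub, Nat.cast_sub (by omega)]
      push_cast
      ring
    rw [h1]
    exact div_self (Finset.prod_ne_zero_iff.2 fun s _ => by positivity)
  · obtain ⟨i, hi⟩ : ∃ i, β i < α i := by
      by_contra! hle
      apply h
      funext j
      by_contra hne
      have : ∑ i, α i < ∑ i, β i :=
        Finset.sum_lt_sum (fun i _ => hle i) ⟨j, Finset.mem_univ j, lt_of_le_of_ne (hle j) hne⟩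
      omega
    refine Finset.prod_eq_zero (Finset.mem_univ i) ?_
    refine Finset.prod_eq_zero (Finset.mem_range.2 hi) ?_
    rw [mul_div_cancel₀ _ hk0]
    simp

/-- An admissible triangulation of the initial surface `Γ(0)` by flat `m`-simplices with vertices
on `Γ(0)`: a conforming polyhedral surface that the normal projection maps bijectively onto
`Γ(0)`. -/
structure InitialTriangulation {m : ℕ} (S : EvolvingSurface m) where
  /-- number of elements -/
  N : ℕ
  vert : Fin N → Fin (m + 1) → Amb m
  indep : ∀ e, AffineIndependent ℝ (vert e)
  vert_mem : ∀ e i, vert e i ∈ S.Γ 0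
  conforming : ∀ e e', convexHull ℝ (Set.range (vert e)) ∩ convexHull ℝ (Set.range (vert e'))
    = convexHull ℝ (Set.range (vert e) ∩ Set.range (vert e'))
  distinct : ∀ e e', Set.range (vert e) = Set.range (vert e') → e = e'
  bijOn : Set.BijOn (fun x => S.proj x 0) (⋃ e, convexHull ℝ (Set.range (vert e))) (S.Γ 0)

namespace InitialTriangulation

noncomputable section

variable {m : ℕ} {S : EvolvingSurface m} (𝒯 : InitialTriangulation S) (k : ℕ)

/-- Shape regularity with constant `σ`: every flat simplex, of diameter `h_E`, contains an
`m`-dimensional ball of radius `h_E / σ`. -/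
def ShapeRegular (σ : ℝ) : Prop :=
  ∀ e, ∃ x₀ ∈ affineSpan ℝ (Set.range (𝒯.vert e)),
    ∀ x ∈ affineSpan ℝ (Set.range (𝒯.vert e)),
      dist x x₀ ≤ Metric.diam (convexHull ℝ (Set.range (𝒯.vert e))) / σ →
        x ∈ convexHull ℝ (Set.range (𝒯.vert e))

/-- The Lagrange node `a_{E,α}(t)`: the lattice point `∑ (α_i / k) · vertex_i` of the flat element
is projected to `Γ(0)` and then moved with the velocity `v`. -/
def node (e : Fin 𝒯.N) (α : Fin (m + 1) → ℕ) (t : ℝ) : Amb m :=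
  S.X (S.proj (∑ i, ((α i : ℝ) / k) • 𝒯.vert e i) 0, t)

/-- The degree `k` parametrization `ξ ↦ F_E(ξ,t)` of the curved element `E(t)`, interpolating
`Γ(t)` in the nodes. -/
def param (e : Fin 𝒯.N) (ξ : EuclideanSpace ℝ (Fin m)) (t : ℝ) : Amb m :=
  ∑ α ∈ Finset.piAntidiag Finset.univ k, lagrange k α (bary ξ) • 𝒯.node k e α t

/-- The curved element `E(t)`; the discrete surface `Γ_h^k(t)` is the union of these. -/
def element (e : Fin 𝒯.N) (t : ℝ) : Set (Amb m) :=
  (fun ξ => 𝒯.param k e ξ t) '' refSimplex m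

/-- All elements `E(t)`, `t ∈ [0,T]`, have diameter at most `h`. -/
def MeshSizeLE (h : ℝ) : Prop :=
  ∀ t ∈ Set.Icc 0 S.T, ∀ e, Metric.diam (𝒯.element k e t) ≤ h

/-- The discrete velocity `V_h = ∑ v(a_j(t),t) χ_j` at the point `F_E(ξ,t)` of `Γ_h^k(t)`. -/
def discreteVelocity (e : Fin 𝒯.N) (ξ : EuclideanSpace ℝ (Fin m)) (t : ℝ) : Amb m :=
  ∑ α ∈ Finset.piAntidiag Finset.univ k,
    lagrange k α (bary ξ) • S.v (𝒯.node k e α t, t)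

/-- The differential of the parametrization of `E(t)`. -/
def dparam (e : Fin 𝒯.N) (ξ : EuclideanSpace ℝ (Fin m)) (t : ℝ) :
    EuclideanSpace ℝ (Fin m) →L[ℝ] Amb m := fderiv ℝ (fun η => 𝒯.param k e η t) ξ

/-- The tangent space of `Γ_h^k(t)` at `F_E(ξ,t)`. -/
def tangentSpace (e : Fin 𝒯.N) (ξ : EuclideanSpace ℝ (Fin m)) (t : ℝ) : Submodule ℝ (Amb m) :=
  LinearMap.range (𝒯.dparam k e ξ t).toLinearMap

/-- `n` is the unit normal `ν_h` of `Γ_h^k(t)` at `F_E(ξ,t)`, oriented consistently with `ν`. -/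
def IsDiscreteNormal (e : Fin 𝒯.N) (ξ : EuclideanSpace ℝ (Fin m)) (t : ℝ) (n : Amb m) : Prop :=
  ‖n‖ = 1 ∧ n ∈ (𝒯.tangentSpace k e ξ t)ᗮ ∧ 0 ≤ ⟪n, S.ν (𝒯.param k e ξ t) t⟫

/-- The surface area element of the parametrization with differential `L`. -/
def areaElement (L : EuclideanSpace ℝ (Fin m) →L[ℝ] Amb m) : ℝ :=
  Real.sqrt (Matrix.of fun i j : Fin m =>
    ⟪L (EuclideanSpace.single i 1), L (EuclideanSpace.single j 1)⟫).det

/-- `δ_h` with `δ_h dA_h = dA`: the quotient at `F_E(ξ,t)` of the area elements of `Γ(t)`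
(parametrized by `ξ ↦ p(F_E(ξ,t),t)`) and of `Γ_h^k(t)` (parametrized by `F_E`). -/
def δ (e : Fin 𝒯.N) (ξ : EuclideanSpace ℝ (Fin m)) (t : ℝ) : ℝ :=
  areaElement (fderiv ℝ (fun η => S.proj (𝒯.param k e η t) t) ξ) /
    areaElement (𝒯.dparam k e ξ t)

/-- `d` on `Γ_h^k(t)`. -/
def distOn (e : Fin 𝒯.N) (ξ : EuclideanSpace ℝ (Fin m)) (t : ℝ) : ℝ := S.d (𝒯.param k e ξ t) t

/-- `Pr` on `Γ_h^k(t)`. -/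
def Pr (e : Fin 𝒯.N) (ξ : EuclideanSpace ℝ (Fin m)) (t : ℝ) : Amb m →L[ℝ] Amb m :=
  S.Pr (𝒯.param k e ξ t) t

/-- `Pr_h`: the orthogonal projection onto the tangent space of `Γ_h^k(t)`. -/
def Prh (e : Fin 𝒯.N) (ξ : EuclideanSpace ℝ (Fin m)) (t : ℝ) : Amb m →L[ℝ] Amb m :=
  (𝒯.tangentSpace k e ξ t).starProjection

/-- `Id - d 𝓗` on `Γ_h^k(t)`. -/
def idSubDH (e : Fin 𝒯.N) (ξ : EuclideanSpace ℝ (Fin m)) (t : ℝ) : Amb m →L[ℝ] Amb m :=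
  ContinuousLinearMap.id ℝ (Amb m) - 𝒯.distOn k e ξ t • S.weingarten (𝒯.param k e ξ t) t

/-- `Q_h = δ_h⁻¹ (Id - d 𝓗) Pr Pr_h Pr (Id - d 𝓗)`. -/
def Q (e : Fin 𝒯.N) (ξ : EuclideanSpace ℝ (Fin m)) (t : ℝ) : Amb m →L[ℝ] Amb m :=
  (1 / 𝒯.δ k e ξ t) • (𝒯.idSubDH k e ξ t ∘L 𝒯.Pr k e ξ t ∘L 𝒯.Prh k e ξ t ∘L
    𝒯.Pr k e ξ t ∘L 𝒯.idSubDH k e ξ t)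

end

end InitialTriangulation

/-- The `ℓ`-th discrete material derivative on `[0,T]` of a quantity `f(ξ,t)` given on the moving
points `F_E(ξ,t)`, that is, its time derivative along the trajectories `t ↦ F_E(ξ,t)` of `V_h`
(compare `InitialTriangulation.hasDerivWithinAt_param`). -/
noncomputable def matDeriv {m : ℕ} (S : EvolvingSurface m) {G : Type*} [NormedAddCommGroup G]
    [NormedSpace ℝ G] (ℓ : ℕ) (f : EuclideanSpace ℝ (Fin m) → ℝ → G)
    (ξ : EuclideanSpace ℝ (Fin m)) (t : ℝ) : G :=
  iteratedDerivWithin ℓ (f ξ) (Set.Icc 0 S.T) t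

/-- The trajectories `t ↦ F_E(ξ,t)` are the integral curves of the discrete velocity `V_h`. -/
theorem InitialTriangulation.hasDerivWithinAt_param {m : ℕ} {S : EvolvingSurface m}
    (𝒯 : InitialTriangulation S) {k : ℕ} (hk : 1 ≤ k) (e : Fin 𝒯.N)
    (ξ : EuclideanSpace ℝ (Fin m)) {t : ℝ} (ht : t ∈ Set.Icc 0 S.T) :
    HasDerivWithinAt (fun s => 𝒯.param k e ξ s) (𝒯.discreteVelocity k e ξ t)
      (Set.Icc 0 S.T) t := by
  have hk0 : (0 : ℝ) < k := by positivity
  unfold InitialTriangulation.param InitialTriangulation.discreteVelocity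
  refine HasDerivWithinAt.fun_sum fun α hα => HasDerivWithinAt.fun_const_smul _ ?_
  refine S.X_deriv _ (𝒯.bijOn.mapsTo ?_) t ht
  refine Set.mem_iUnion.2 ⟨e, ?_⟩
  refine (convex_convexHull ℝ _).sum_mem (fun i _ => by positivity) ?_
    (fun i _ => subset_convexHull ℝ _ ⟨i, rfl⟩)
  rw [← Finset.sum_div, ← Nat.cast_sum, (Finset.mem_piAntidiag.1 hα).1]
  exact div_self hk0.ne'

/-!
Every quantity on a curved element is compared with the smooth evolving surface through one smooth
model with finitely many parameters, in which the size of the element is a parameter that may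
become zero.

**The distance.** Near `Γ(t)` the oriented distance is the restriction of a function `D` that is
smooth on the whole space-time (`EvolvingSurface.exists_smooth_signedDistance`). It provides smooth
models of the normal, of the Weingarten map, of the projections `p` and `Pr`, and of the flow,
extended from `Γ(0)` constantly along the normals (`SmoothDistance.flow`).

**The element.** A flat simplex with vertices `a₀, …, a_m` and diameter `r` is given by its base
vertex `a = a₀`, its edges divided by `r`, that is a linear map `W`, and `r` itself. With
`Φ(ξ) = flow(a + W(rξ), t)`, the parametrization of the curved element is the degree `k`
interpolant of `Φ`. A Taylor expansion, together with the fact that the interpolation reproduces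
polynomials of degree `k`, gives `F = Φ - r^{k+1} R` with a remainder `R` that is smooth in
`(a, W, r, ξ, t)`, also at `r = 0` (`exists_interpolation_remainder`). As `D` vanishes at `Φ`, the
distance on the element is `r^{k+1}` times a smooth function (`ElementModel.dist_eq`), and by
differentiation the normal components of the tangent vectors `r⁻¹ ∂F` are `r^k` times smooth
functions (`ElementModel.inner_normal_A`). The latter enter the area element and the product
`Pr Pr_h Pr` only quadratically: the Gram operators of `A = r⁻¹ ∂F` and of `Pr A` differ by a term
of order `r^{2k}`, and `2k ≥ k + 1` (`ElementModel.Good.gramOp_A`). Since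

* `δ_h` is the quotient of the roots of the Gram determinants of `Pr A - d 𝓗 A` and of `A`,
* `Pr Pr_h Pr = P (AᵀA)⁻¹ Pᵀ` with `P = Pr A`, while `Pr = P (PᵀP)⁻¹ Pᵀ`,

all the quantities in question are congruent to their counterparts on the smooth surface modulo
`r^{k+1}`, in the sense that the difference is `r^{k+1}` times a function of `(a, W, r, ξ, t)` that
is smooth at the relevant points (`CongPow`). As `r` does not depend on time, time derivatives of
the difference have the same form, and they are `O(r^{k+1})` uniformly on compact sets of
parameters.

**Compactness.** Shape regularity bounds `W` from above and below, so the parameters of the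
admissible elements lie in a compact set (`ElementModel.paramSet`). At `r = 0` the map `W` takes its
values in the tangent space of `Γ(0)` at `a`, because the vertices lie on `Γ(0)`; as the flow is an
immersion (`SmoothDistance.eq_zero_of_fderiv_flow_eq_zero`, from Grönwall's inequality), the model
is nondegenerate there (`ElementModel.good_of_mem_paramSet`). Nondegeneracy being an open condition,
it persists for `r ≤ r₁` (`ElementModel.exists_forall_good`), and `r₁` serves as `h₀`: the vertices
belong to the curved element at time `0`, so `r ≤ h`.

For the derivative of `Q_h` itself, note that `Pr (∂ Pr) Pr = 0`, as for any smooth family of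
projections.
-/

/-! ### Smooth parameter integrals and Hadamard quotients -/

section ParametricIntegral

universe u

variable {Z : Type u} [NormedAddCommGroup Z] [NormedSpace ℝ Z] [FiniteDimensional ℝ Z]

theorem contDiff_nat_integral_zero_one (n : ℕ) : ∀ {G : Type u} [NormedAddCommGroup G]
    [NormedSpace ℝ G] [CompleteSpace G] {f : Z × ℝ → G}, ContDiff ℝ n f →
    ContDiff ℝ n (fun z => ∫ s in (0 : ℝ)..1, f (z, s)) := by
  induction n with
  | zero =>
    intro G _ _ _ f hf
    have hf' := hf.continuous
    refine contDiff_zero.2 ?_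
    exact intervalIntegral.continuous_parametric_intervalIntegral_of_continuous'
      (f := fun z s => f (z, s)) (by simpa [Function.uncurry_def] using hf') 0 1
  | succ n ih =>
    intro G _ _ _ f hf
    have : ProperSpace Z := FiniteDimensional.proper ℝ Z
    obtain ⟨f', hf'c, hf'⟩ := contDiff_succ_iff_hasFDerivAt.1 hf
    refine contDiff_succ_iff_hasFDerivAt.2
      ⟨fun z => ∫ s in (0 : ℝ)..1, (f' (z, s)).comp (ContinuousLinearMap.inl ℝ Z ℝ), ?_, ?_⟩
    · exact ih (f := fun p => (f' p).comp (ContinuousLinearMap.inl ℝ Z ℝ))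
        (hf'c.clm_comp contDiff_const)
    · intro z₀
      have hcf := hf.continuous
      have hcont : Continuous fun p : Z × ℝ => (f' p).comp (ContinuousLinearMap.inl ℝ Z ℝ) :=
        (hf'c.clm_comp contDiff_const).continuous
      obtain ⟨C, hC⟩ := ((isCompact_closedBall z₀ 1).prod
        (isCompact_Icc (a := (0 : ℝ)) (b := 1))).exists_bound_of_continuousOn hcont.continuousOn
      refine intervalIntegral.hasFDerivAt_integral_of_dominated_of_fderiv_le
        (s := Metric.closedBall z₀ 1) (bound := fun _ => C)
        (F := fun z s => f (z, s))
        (F' := fun z s => (f' (z, s)).comp (ContinuousLinearMap.inl ℝ Z ℝ))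
        (Metric.closedBall_mem_nhds _ one_pos) ?_ ?_ ?_ ?_ ?_ ?_
      · exact Filter.Eventually.of_forall fun z =>
          (hcf.comp (by fun_prop : Continuous fun s : ℝ => (z, s))).aestronglyMeasurable
      · exact (hcf.comp (by fun_prop : Continuous fun s : ℝ => (z₀, s))).intervalIntegrable _ _
      · exact (hcont.comp (by fun_prop : Continuous fun s : ℝ => (z₀, s))).aestronglyMeasurable
      · refine Filter.Eventually.of_forall fun s hs z hz => hC (z, s) ⟨hz, ?_⟩
        rw [Set.uIoc_of_le zero_le_one] at hs
        exact ⟨hs.1.le, hs.2⟩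
      · exact intervalIntegrable_const
      · exact Filter.Eventually.of_forall fun s _ z _ => (hf' (z, s)).comp z (hasFDerivAt_prodMk_left z s)

theorem contDiff_integral_zero_one {G : Type u} [NormedAddCommGroup G]
    [NormedSpace ℝ G] [CompleteSpace G] {f : Z × ℝ → G} (hf : ContDiff ℝ ∞ f) :
    ContDiff ℝ ∞ (fun z => ∫ s in (0 : ℝ)..1, f (z, s)) :=
  contDiff_infty.2 fun n => contDiff_nat_integral_zero_one n (contDiff_infty.1 hf n)

/-- The Hadamard quotient of a smooth function with respect to its second variable. -/
theorem exists_hadamard_quotient {Y G : Type u} [NormedAddCommGroup Y] [NormedSpace ℝ Y]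
    [FiniteDimensional ℝ Y] [NormedAddCommGroup G] [NormedSpace ℝ G] [CompleteSpace G]
    {Ψ : Z × Y → G} (hΨ : ContDiff ℝ ∞ Ψ) :
    ∃ A : Z × Y → Y →L[ℝ] G, ContDiff ℝ ∞ A ∧ (∀ z y, Ψ (z, y) = Ψ (z, 0) + A (z, y) y) ∧
      ∀ z, A (z, 0) = fderiv ℝ (fun y => Ψ (z, y)) 0 := by
  have hd : ContDiff ℝ ∞ (fderiv ℝ Ψ) := hΨ.fderiv_right (by simp)
  -- `Ψ(z, y) - Ψ(z, 0) = (∫₀¹ ∂Ψ(z, s y) ds) y`; the quotient is the integral.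
  set B : (Z × Y) × ℝ → Y →L[ℝ] G := fun p =>
    (fderiv ℝ Ψ (p.1.1, p.2 • p.1.2)).comp (ContinuousLinearMap.inr ℝ Z Y) with hB
  have hBs : ContDiff ℝ ∞ B := by
    refine ContDiff.clm_comp (hd.comp ?_) contDiff_const
    fun_prop
  have hder : ∀ z y, HasFDerivAt (fun y => Ψ (z, y))
      ((fderiv ℝ Ψ (z, y)).comp (ContinuousLinearMap.inr ℝ Z Y)) y := fun z y =>
    ((hΨ.differentiable (by simp)) (z, y)).hasFDerivAt.comp y (hasFDerivAt_prodMk_right z y)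
  refine ⟨fun p => ∫ s in (0 : ℝ)..1, B (p, s), contDiff_integral_zero_one hBs, ?_, ?_⟩
  · intro z y
    have hBc : Continuous fun s : ℝ => B ((z, y), s) :=
      hBs.continuous.comp (by fun_prop)
    have h1 : (∫ s in (0 : ℝ)..1, B ((z, y), s)) y = ∫ s in (0 : ℝ)..1, B ((z, y), s) y :=
      ContinuousLinearMap.intervalIntegral_apply (hBc.intervalIntegrable 0 1) y
    have h2 : ∫ s in (0 : ℝ)..1, B ((z, y), s) y = Ψ (z, (1 : ℝ) • y) - Ψ (z, (0 : ℝ) • y) := by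
      refine intervalIntegral.integral_eq_sub_of_hasDerivAt (f := fun s : ℝ => Ψ (z, s • y))
        (fun s _ => ?_) ?_
      · have := (hder z (s • y)).comp_hasDerivAt s ((hasDerivAt_id s).smul_const y)
        simpa [hB, Function.comp_def] using this
      · exact (hBc.clm_apply continuous_const).intervalIntegrable _ _
    rw [h1, h2]
    simp
  · intro z
    rw [(hder z 0).fderiv]
    simp [hB]

end ParametricIntegral

/-! ### Bounds for time derivatives on compact parameter sets -/

section TimeDerivatives

variable {B G : Type*} [NormedAddCommGroup B] [NormedSpace ℝ B] [NormedAddCommGroup G]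
  [NormedSpace ℝ G]

theorem ContDiffAt.contDiffWithinAt_slice {q : B × ℝ → G} {b : B} {t : ℝ} {s : Set ℝ}
    (h : ContDiffAt ℝ ∞ q (b, t)) : ContDiffWithinAt ℝ ∞ (fun τ => q (b, τ)) s t :=
  (ContDiffAt.comp t h (by fun_prop : ContDiffAt ℝ ∞ (fun τ : ℝ => (b, τ)) t)).contDiffWithinAt

/-- Along the time slices of a set `K₀ × [0,T]`, the iterated time derivatives of a function that
is smooth at the points of this set are again the slices of such a function. -/
theorem exists_iteratedDerivWithin_slice {T : ℝ} (hT : 0 < T) {K₀ : Set B} {q : B × ℝ → G}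
    (hq : ∀ z ∈ K₀ ×ˢ Set.Icc 0 T, ContDiffAt ℝ ∞ q z) (ℓ : ℕ) :
    ∃ q' : B × ℝ → G, (∀ z ∈ K₀ ×ˢ Set.Icc 0 T, ContDiffAt ℝ ∞ q' z) ∧
      ∀ b ∈ K₀, ∀ t ∈ Set.Icc 0 T,
        iteratedDerivWithin ℓ (fun s => q (b, s)) (Set.Icc 0 T) t = q' (b, t) := by
  induction ℓ with
  | zero => exact ⟨q, hq, fun b _ t _ => by simp⟩
  | succ ℓ ih =>
    obtain ⟨q', hq', h⟩ := ih
    -- Smoothness at points of the set means smoothness on neighbourhoods of them, so the time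
    -- derivative is smooth at the same points.
    refine ⟨fun z => fderiv ℝ q' z (0, 1), fun z hz => ?_, fun b hb t ht => ?_⟩
    · exact ((hq' z hz).fderiv_right (by simp)).clm_apply contDiffAt_const
    · rw [iteratedDerivWithin_succ,
        derivWithin_congr (fun s hs => h b hb s hs) (h b hb t ht)]
      have h1 : HasFDerivAt q' (fderiv ℝ q' (b, t)) (b, t) :=
        ((hq' (b, t) ⟨hb, ht⟩).differentiableAt (by simp)).hasFDerivAt
      have h2 : HasDerivAt (fun s : ℝ => (b, s)) ((0 : B), (1 : ℝ)) t :=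
        (hasDerivAt_const t b).prodMk (hasDerivAt_id t)
      exact (h1.comp_hasDerivAt t h2).hasDerivWithinAt.derivWithin
        (uniqueDiffOn_Icc hT t ht)

theorem exists_bound_iteratedDerivWithin_slice {T : ℝ} (hT : 0 < T) {K₀ : Set B}
    (hK₀ : IsCompact K₀) {q : B × ℝ → G}
    (hq : ∀ z ∈ K₀ ×ˢ Set.Icc 0 T, ContDiffAt ℝ ∞ q z) (ℓ : ℕ) :
    ∃ C : ℝ, ∀ b ∈ K₀, ∀ t ∈ Set.Icc 0 T,
      ‖iteratedDerivWithin ℓ (fun s => q (b, s)) (Set.Icc 0 T) t‖ ≤ C := by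
  obtain ⟨q', hq', h⟩ := exists_iteratedDerivWithin_slice hT hq ℓ
  obtain ⟨C, hC⟩ := (hK₀.prod isCompact_Icc).exists_bound_of_continuousOn
    fun z hz => (hq' z hz).continuousAt.continuousWithinAt
  exact ⟨C, fun b hb t ht => (h b hb t ht).symm ▸ hC (b, t) ⟨hb, ht⟩⟩

end TimeDerivatives

/-! ### Smooth inverses near compact sets -/

open Filter Topology in
/-- A smooth map that is injective on a compact set and has an invertible differential there has a
smooth inverse on a neighbourhood of the image of this set. -/
theorem exists_smooth_inverse_near_compact {X : Type*} [NormedAddCommGroup X] [NormedSpace ℝ X]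
    [FiniteDimensional ℝ X] {f : X → X} (hf : ContDiff ℝ ∞ f) {K : Set X} (hK : IsCompact K)
    (hinj : Set.InjOn f K) (hd : ∀ x ∈ K, Function.Injective (fderiv ℝ f x)) {O : Set X}
    (hO : IsOpen O) (hKO : K ⊆ O) :
    ∃ V ⊆ O, IsOpen V ∧ K ⊆ V ∧ IsOpen (f '' V) ∧ ∃ J : X → X,
      ∀ v ∈ V, J (f v) = v ∧ ContDiffAt ℝ ∞ J (f v) := by
  have : CompleteSpace X := FiniteDimensional.complete ℝ X
  have hunit : ∀ x, Function.Injective (fderiv ℝ f x) → IsUnit (fderiv ℝ f x) := fun x hx => by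
    rw [ContinuousLinearMap.isUnit_iff_bijective]
    exact ⟨hx, LinearMap.surjective_of_injective (f := (fderiv ℝ f x).toLinearMap) hx⟩
  have hequiv : ∀ x, IsUnit (fderiv ℝ f x) →
      ∃ e : X ≃L[ℝ] X, (e : X →L[ℝ] X) = fderiv ℝ f x := by
    rintro x ⟨u, hu⟩
    exact ⟨ContinuousLinearEquiv.unitsEquiv ℝ X u, by rw [← hu]; rfl⟩
  have hfc : Continuous f := hf.continuous
  have hstrict : ∀ x (e : X ≃L[ℝ] X), (e : X →L[ℝ] X) = fderiv ℝ f x →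
      HasFDerivAt f (e : X →L[ℝ] X) x := fun x e he => by
    rw [he]; exact (hf.differentiable (by simp) x).hasFDerivAt
  -- Local injectivity, from the inverse function theorem, and compactness extend the injectivity
  -- from `K` to a neighbourhood `t` of `K`.
  obtain ⟨t, ht, hKt, hinjt⟩ := hinj.exists_isOpen_superset hK (fun x _ => hfc.continuousAt)
    (fun x hx => by
      obtain ⟨e, he⟩ := hequiv x (hunit x (hd x hx))
      have hs := hf.contDiffAt.hasStrictFDerivAt' (hstrict x e he) (by simp)
      refine ⟨(hs.toOpenPartialHomeomorph f).source,
        (hs.toOpenPartialHomeomorph f).open_source.mem_nhds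
          (hs.mem_toOpenPartialHomeomorph_source), ?_⟩
      exact (hs.toOpenPartialHomeomorph f).injOn)
  have hW : IsOpen {x | IsUnit (fderiv ℝ f x)} :=
    Units.isOpen.preimage (hf.continuous_fderiv (by simp))
  refine ⟨O ∩ (t ∩ {x | IsUnit (fderiv ℝ f x)}), Set.inter_subset_left, hO.inter (ht.inter hW),
    fun x hx => ⟨hKO hx, hKt hx, hunit x (hd x hx)⟩, ?_, ?_⟩
  · rw [isOpen_iff_mem_nhds]
    rintro _ ⟨v, hv, rfl⟩
    obtain ⟨e, he⟩ := hequiv v hv.2.2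
    have hs := hf.contDiffAt.hasStrictFDerivAt' (hstrict v e he) (by simp)
    rw [← hs.map_nhds_eq_of_equiv]
    exact image_mem_map ((hO.inter (ht.inter hW)).mem_nhds hv)
  · set V := O ∩ (t ∩ {x | IsUnit (fderiv ℝ f x)}) with hV
    have hVo : IsOpen V := hO.inter (ht.inter hW)
    have hVi : Set.InjOn f V := hinjt.mono fun x hx => hx.2.1
    rcases isEmpty_or_nonempty X with hX | hX
    · exact ⟨id, fun v => (hX.false v).elim⟩
    have hJ : ∀ v ∈ V, Function.invFunOn f V (f v) = v := fun v hv => hVi.leftInvOn_invFunOn hv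
    refine ⟨Function.invFunOn f V, fun v hv => ⟨hJ v hv, ?_⟩⟩
    obtain ⟨e, he⟩ := hequiv v hv.2.2
    have hs := hf.contDiffAt.hasStrictFDerivAt' (hstrict v e he) (by simp)
    have hloc := (hf.contDiffAt (x := v)).to_localInverse (hstrict v e he) (by simp)
    -- Near `f v` the inverse on `V` coincides with the local inverse, as the latter takes values
    -- in `V` there.
    refine hloc.congr_of_eventuallyEq ?_
    have h1 : ∀ᶠ y in 𝓝 (f v), hs.localInverse f e v y ∈ V := by
      have := hs.localInverse_continuousAt
      refine this.eventually_mem (hVo.mem_nhds ?_)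
      rw [hs.localInverse_apply_image]; exact hv
    filter_upwards [h1, hs.eventually_right_inverse] with y hy1 hy2
    have := hJ _ hy1
    rw [hy2] at this
    exact this

/-! ### Tubular neighbourhoods and the signed distance -/

/-- The Riesz representation of linear functionals, as a real-linear map. -/
noncomputable def rieszVec (m : ℕ) : (Amb m →L[ℝ] ℝ) →L[ℝ] Amb m :=
  LinearMap.toContinuousLinearMap
    { toFun := fun f => (InnerProductSpace.toDual ℝ (Amb m)).symm f
      map_add' := fun _ _ => map_add _ _ _
      map_smul' := fun c f => by simp }

theorem inner_rieszVec {m : ℕ} (f : Amb m →L[ℝ] ℝ) (w : Amb m) : ⟪rieszVec m f, w⟫ = f w :=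
  InnerProductSpace.toDual_symm_apply

/-- The gradient of a function of `(x, t)` with respect to `x`. -/
noncomputable def spatialGrad {m : ℕ} (f : Amb m × ℝ → ℝ) (z : Amb m × ℝ) : Amb m :=
  rieszVec m ((fderiv ℝ f z).comp (ContinuousLinearMap.inl ℝ (Amb m) ℝ))

theorem inner_spatialGrad {m : ℕ} (f : Amb m × ℝ → ℝ) (z : Amb m × ℝ) (w : Amb m) :
    ⟪spatialGrad f z, w⟫ = fderiv ℝ f z (w, 0) := by
  rw [spatialGrad, inner_rieszVec]; simp

theorem contDiff_spatialGrad {m : ℕ} {f : Amb m × ℝ → ℝ} (hf : ContDiff ℝ ∞ f) :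
    ContDiff ℝ ∞ (spatialGrad f) :=
  (rieszVec m).contDiff.comp ((hf.fderiv_right (by simp)).clm_comp contDiff_const)

theorem Filter.EventuallyEq.spatialGrad_eq {m : ℕ} {f g : Amb m × ℝ → ℝ} {z : Amb m × ℝ}
    (h : f =ᶠ[nhds z] g) : spatialGrad f z = spatialGrad g z := by
  rw [spatialGrad, spatialGrad, h.fderiv_eq]

theorem hasFDerivAt_slice {m : ℕ} {G : Type*} [NormedAddCommGroup G] [NormedSpace ℝ G]
    {f : Amb m × ℝ → G} {x : Amb m} {t : ℝ}
    (hf : DifferentiableAt ℝ f (x, t)) : HasFDerivAt (fun y => f (y, t))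
      ((fderiv ℝ f (x, t)).comp (ContinuousLinearMap.inl ℝ (Amb m) ℝ)) x :=
  hf.hasFDerivAt.comp x (hasFDerivAt_prodMk_left x t)

theorem gradient_slice {m : ℕ} {f : Amb m × ℝ → ℝ} {x : Amb m} {t : ℝ}
    (hf : DifferentiableAt ℝ f (x, t)) :
    gradient (fun y => f (y, t)) x = spatialGrad f (x, t) := by
  rw [gradient, (hasFDerivAt_slice hf).fderiv]; rfl

namespace EvolvingSurface

variable {m : ℕ} (S : EvolvingSurface m)

/-- The space-time surface `⋃ₜ Γ(t) × {t}`, `0 ≤ t ≤ T`. -/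
def spaceTime : Set (Amb m × ℝ) := {z | z.2 ∈ Set.Icc 0 S.T ∧ S.φ z = 0}

theorem isCompact_spaceTime : IsCompact S.spaceTime := by
  have h0 : IsCompact ({a | S.φ (a, 0) = 0} ×ˢ Set.Icc 0 S.T) :=
    (S.compact 0 ⟨le_rfl, S.T_pos.le⟩).prod isCompact_Icc
  have hX := S.X_smooth.continuous
  convert h0.image (f := fun z : Amb m × ℝ => (S.X z, z.2)) (by fun_prop) using 1
  ext ⟨x, t⟩
  constructor
  · rintro ⟨ht, hx⟩
    have : x ∈ {x | S.φ (x, t) = 0} := hx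
    rw [← S.X_image t ht] at this
    obtain ⟨a, ha, rfl⟩ := this
    exact ⟨(a, t), ⟨ha, ht⟩, rfl⟩
  · rintro ⟨⟨a, s⟩, ⟨ha, hs⟩, h⟩
    simp only [Prod.mk.injEq] at h
    obtain ⟨rfl, rfl⟩ := h
    refine ⟨hs, ?_⟩
    have : S.X (a, s) ∈ {x | S.φ (x, s) = 0} := by
      rw [← S.X_image s hs]; exact ⟨a, ha, rfl⟩
    exact this

theorem spatialGrad_ne_zero {z : Amb m × ℝ} (hz : z ∈ S.spaceTime) :
    spatialGrad S.φ z ≠ 0 := by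
  obtain ⟨x, t⟩ := z
  intro h
  refine S.regular t hz.1 x hz.2 ?_
  rw [(hasFDerivAt_slice (S.φ_smooth.differentiable (by simp) _)).fderiv]
  ext w
  have := inner_spatialGrad S.φ (x, t) w
  rw [h, inner_zero_left] at this
  simpa using this.symm

/-- The normal coordinate map `(q, μ, t) ↦ (q + μ ∇φ(q,t), φ(q,t), t)`; its inverse at `(x, 0, t)`
is the base point `q` of `x` on `Γ(t)` with the multiplier `μ`. -/
noncomputable def normalMap (y : Amb m × ℝ × ℝ) : Amb m × ℝ × ℝ :=
  (y.1 + y.2.1 • spatialGrad S.φ (y.1, y.2.2), S.φ (y.1, y.2.2), y.2.2)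

theorem contDiff_normalMap : ContDiff ℝ ∞ S.normalMap := by
  have h1 := contDiff_spatialGrad S.φ_smooth
  have h2 := S.φ_smooth
  unfold normalMap
  fun_prop

/-- At `μ = 0` the differential maps `(u, μ, τ)` to `(u + μ ∇φ, ∂φ (u, τ), τ)`; if this vanishes,
`u` is both tangential and a multiple of `∇φ ≠ 0`. -/
theorem injective_fderiv_normalMap {p : Amb m} {t : ℝ} (h : (p, t) ∈ S.spaceTime) :
    Function.Injective (fderiv ℝ S.normalMap (p, 0, t)) := by
  set g := spatialGrad S.φ (p, t) with hg
  have hgd : Differentiable ℝ (spatialGrad S.φ) :=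
    (contDiff_spatialGrad S.φ_smooth).differentiable (by simp)
  have hφd : Differentiable ℝ S.φ := S.φ_smooth.differentiable (by simp)
  have e1 : HasFDerivAt (fun y : Amb m × ℝ × ℝ => y.1)
    (ContinuousLinearMap.fst ℝ (Amb m) (ℝ × ℝ)) (p, 0, t) := hasFDerivAt_fst
  have e2 : HasFDerivAt (fun y : Amb m × ℝ × ℝ => y.2.1)
    ((ContinuousLinearMap.fst ℝ ℝ ℝ).comp (ContinuousLinearMap.snd ℝ (Amb m) (ℝ × ℝ))) (p, 0, t) :=
    hasFDerivAt_snd.fst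
  have e3 : HasFDerivAt (fun y : Amb m × ℝ × ℝ => y.2.2)
    ((ContinuousLinearMap.snd ℝ ℝ ℝ).comp (ContinuousLinearMap.snd ℝ (Amb m) (ℝ × ℝ))) (p, 0, t) :=
    hasFDerivAt_snd.snd
  have e4 : HasFDerivAt (fun y : Amb m × ℝ × ℝ => spatialGrad S.φ (y.1, y.2.2)) _ (p, 0, t) :=
    HasFDerivAt.comp (g := spatialGrad S.φ) (p, (0 : ℝ), t) (hgd (p, t)).hasFDerivAt (e1.prodMk e3)
  have e5 : HasFDerivAt (fun y : Amb m × ℝ × ℝ => S.φ (y.1, y.2.2)) _ (p, 0, t) :=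
    HasFDerivAt.comp (g := S.φ) (p, (0 : ℝ), t) (hφd (p, t)).hasFDerivAt (e1.prodMk e3)
  have e : HasFDerivAt S.normalMap _ (p, 0, t) := (e1.add (e2.smul e4)).prodMk (e5.prodMk e3)
  rw [e.fderiv, injective_iff_map_eq_zero]
  rintro ⟨u, μ, τ⟩ hz
  simp only [ContinuousLinearMap.prod_apply, add_apply,
    ContinuousLinearMap.coe_fst', zero_smul, zero_add,
    ContinuousLinearMap.smulRight_apply, ContinuousLinearMap.comp_apply,
    ContinuousLinearMap.coe_snd', Prod.mk_eq_zero] at hz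
  obtain ⟨h1, h2, rfl⟩ := hz
  rw [← inner_spatialGrad, ← hg] at h2
  rw [← hg] at h1
  have h3 : ⟪g, u + μ • g⟫ = 0 := by rw [h1, inner_zero_right]
  rw [inner_add_right, h2, zero_add, inner_smul_right] at h3
  have hg0 : ⟪g, g⟫ ≠ 0 := inner_self_ne_zero.2 (S.spatialGrad_ne_zero h)
  have hμ : μ = 0 := (mul_eq_zero.1 h3).resolve_right hg0
  subst hμ
  simp only [zero_smul, add_zero] at h1
  simp [h1]

/-- The nearest point on a level set differs from `x` by a multiple of the gradient. -/
theorem exists_multiplier {t : ℝ} {x q : Amb m} (hq : (q, t) ∈ S.spaceTime)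
    (hmin : ∀ y, S.φ (y, t) = 0 → dist x q ≤ dist x y) :
    ∃ μ : ℝ, x = q + μ • spatialGrad S.φ (q, t) := by
  have hf : HasStrictFDerivAt (fun y => S.φ (y, t))
      ((fderiv ℝ S.φ (q, t)).comp (ContinuousLinearMap.inl ℝ (Amb m) ℝ)) q := by
    have : ContDiffAt ℝ ∞ (fun y => S.φ (y, t)) q :=
      (S.φ_smooth.comp (contDiff_prodMk_left t)).contDiffAt
    exact this.hasStrictFDerivAt' (hasFDerivAt_slice (S.φ_smooth.differentiable (by simp) _))
      (by simp)
  have hψ : HasStrictFDerivAt (fun y : Amb m => ‖y - x‖ ^ 2)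
      (2 • (innerSL ℝ (q - x)).comp (ContinuousLinearMap.id ℝ (Amb m))) q :=
    (hasStrictFDerivAt_norm_sq (q - x)).comp q ((hasStrictFDerivAt_id q).sub_const x)
  have hext : IsLocalExtrOn (fun y : Amb m => ‖y - x‖ ^ 2)
      {y | S.φ (y, t) = S.φ (q, t)} q := by
    left
    refine Filter.eventually_of_mem self_mem_nhdsWithin fun y hy => ?_
    have hy0 : S.φ (y, t) = 0 := by
      have h1 : S.φ (y, t) = S.φ (q, t) := hy
      rw [h1]; exact hq.2
    have := hmin y hy0
    rw [dist_comm x q, dist_comm x y, dist_eq_norm, dist_eq_norm] at this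
    exact pow_le_pow_left₀ (norm_nonneg _) this 2
  -- Lagrange multipliers; `b ≠ 0` because `∇φ ≠ 0` at `q`.
  obtain ⟨a, b, hab, h⟩ := hext.exists_multipliers_of_hasStrictFDerivAt_1d hf hψ
  set g := spatialGrad S.φ (q, t) with hg
  have hv : a • g + (2 * b) • (q - x) = 0 := by
    refine ext_inner_right ℝ fun w => ?_
    have hw := DFunLike.congr_fun h w
    simp only [add_apply, smul_apply,
      ContinuousLinearMap.comp_apply, ContinuousLinearMap.inl_apply, innerSL_apply_apply,
      ContinuousLinearMap.id_apply, zero_apply, smul_eq_mul, nsmul_eq_mul, Nat.cast_ofNat] at hw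
    rw [inner_add_left, inner_smul_left, inner_smul_left, inner_zero_left, hg,
      inner_spatialGrad]
    simp only [conj_trivial]
    linarith
  have hg0 : g ≠ 0 := S.spatialGrad_ne_zero hq
  have hb : b ≠ 0 := by
    rintro rfl
    simp only [mul_zero, zero_smul, add_zero, smul_eq_zero, hg0, or_false] at hv
    exact hab (by simp [hv])
  refine ⟨a / (2 * b), ?_⟩
  have h2b : (2 * b) ≠ 0 := mul_ne_zero two_ne_zero hb
  have hx : (2 * b) • (x - q) = a • g := by
    rw [← sub_eq_zero, ← neg_eq_zero, ← hv]; module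
  rw [div_eq_inv_mul, mul_smul, ← hx, smul_smul, inv_mul_cancel₀ h2b, one_smul]
  abel

end EvolvingSurface

namespace EvolvingSurface

variable {m : ℕ} (S : EvolvingSurface m)

theorem mem_spaceTime_X {a : Amb m} (ha : S.φ (a, 0) = 0) {t : ℝ} (ht : t ∈ Set.Icc 0 S.T) :
    (S.X (a, t), t) ∈ S.spaceTime := by
  refine ⟨ht, ?_⟩
  have : S.X (a, t) ∈ {x | S.φ (x, t) = 0} := by
    rw [← S.X_image t ht]; exact ⟨a, ha, rfl⟩
  exact this

/-- Along a short normal segment `φ` is increasing, so its sign is that of the normal coordinate. -/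
theorem sign_φ_normal {ε : ℝ} {q : Amb m} {t μ : ℝ} (hq : (q, t) ∈ S.spaceTime)
    (hε : ∀ s : ℝ, |s| < ε → 0 < ⟪spatialGrad S.φ (q + s • spatialGrad S.φ (q, t), t),
      spatialGrad S.φ (q, t)⟫) (hμ : |μ| < ε) :
    Real.sign (S.φ (q + μ • spatialGrad S.φ (q, t), t)) = Real.sign μ := by
  set g := spatialGrad S.φ (q, t) with hg
  have hder : ∀ s : ℝ, HasDerivAt (fun s : ℝ => S.φ (q + s • g, t))
      ⟪spatialGrad S.φ (q + s • g, t), g⟫ s := fun s => by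
    have h1 : HasDerivAt (fun s : ℝ => q + s • g) g s := by
      simpa using ((hasDerivAt_id s).smul_const g).const_add q
    have h2 := (hasFDerivAt_slice
      (S.φ_smooth.differentiable (by simp) (q + s • g, t))).comp_hasDerivAt s h1
    rw [inner_spatialGrad]
    simpa [Function.comp_def] using h2
  have hmono : StrictMonoOn (fun s : ℝ => S.φ (q + s • g, t)) (Set.Ioo (-ε) ε) := by
    refine strictMonoOn_of_deriv_pos (convex_Ioo _ _)
      (fun s _ => (hder s).continuousAt.continuousWithinAt) fun s hs => ?_
    rw [interior_Ioo] at hs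
    rw [(hder s).deriv]
    exact hε s (abs_lt.2 hs)
  have h0 : S.φ (q + (0 : ℝ) • g, t) = 0 := by simpa using hq.2
  have hε0 : 0 < ε := (abs_nonneg μ).trans_lt hμ
  have hμm : μ ∈ Set.Ioo (-ε) ε := abs_lt.1 hμ
  have h0m : (0 : ℝ) ∈ Set.Ioo (-ε) ε := ⟨by linarith, hε0⟩
  rcases lt_trichotomy μ 0 with h | h | h
  · have := hmono hμm h0m h
    simp only [h0] at this
    rw [Real.sign_of_neg this, Real.sign_of_neg h]
  · subst h
    rw [h0]
  · have := hmono h0m hμm h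
    simp only [h0] at this
    rw [Real.sign_of_pos this, Real.sign_of_pos h]

/-- Points near the space-time surface are the values of small normal coordinates, in which the
signed distance is the second coordinate up to the length of `∇φ`. -/
theorem eventually_normal_coordinates {ε : ℝ} (hε0 : 0 < ε)
    (hε : ∀ q t, (q, t) ∈ S.spaceTime → ∀ s : ℝ, |s| < ε →
      0 < ⟪spatialGrad S.φ (q + s • spatialGrad S.φ (q, t), t), spatialGrad S.φ (q, t)⟫)
    {z₀ : Amb m × ℝ} (hz₀ : z₀ ∈ S.spaceTime) :
    ∀ᶠ z in nhds z₀, z.2 ∈ Set.Icc 0 S.T → ∃ q μ, (q, z.2) ∈ S.spaceTime ∧ |μ| < ε ∧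
      z.1 = q + μ • spatialGrad S.φ (q, z.2) ∧ S.d z.1 z.2 = μ * ‖spatialGrad S.φ (q, z.2)‖ := by
  obtain ⟨x₀, t₀⟩ := z₀
  obtain ⟨c, hc0, hc⟩ := S.isCompact_spaceTime.exists_forall_le'
    (f := fun z => ‖spatialGrad S.φ z‖) (a := 0)
    (contDiff_spatialGrad S.φ_smooth).continuous.norm.continuousOn
    (fun z hz => norm_pos_iff.2 (S.spatialGrad_ne_zero hz))
  have hx₀ : x₀ ∈ {x | S.φ (x, t₀) = 0} := hz₀.2
  rw [← S.X_image t₀ hz₀.1] at hx₀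
  obtain ⟨a, ha, hax⟩ := hx₀
  simp only at hax
  have hXc := S.X_smooth.continuous
  -- The point of `Γ(t)` that moves with the flow through `x₀` at time `t₀` bounds the distance of
  -- `x` to `Γ(t)`, and hence the multiplier of the nearest point.
  have hlim : ∀ᶠ z : Amb m × ℝ in nhds (x₀, t₀), dist z.1 (S.X (a, z.2)) < c * ε := by
    have hcont : Continuous fun z : Amb m × ℝ => dist z.1 (S.X (a, z.2)) := by fun_prop
    refine hcont.continuousAt.eventually_lt continuousAt_const ?_
    simp only [hax, dist_self]
    positivity
  filter_upwards [hlim] with ⟨x, t⟩ hz ht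
  simp only at hz ht ⊢
  obtain ⟨q, hq, hdq⟩ := (S.compact t ht).exists_infDist_eq_dist (S.nonempty t ht) x
  have hqS : (q, t) ∈ S.spaceTime := ⟨ht, hq⟩
  obtain ⟨μ, hμ⟩ := S.exists_multiplier hqS (x := x) fun y hy => by
    rw [← hdq]; exact Metric.infDist_le_dist_of_mem hy
  set g := spatialGrad S.φ (q, t) with hg
  have hdist : dist x q = |μ| * ‖g‖ := by
    rw [hμ, dist_eq_norm, add_sub_cancel_left, norm_smul, Real.norm_eq_abs]
  have hle : dist x q ≤ dist x (S.X (a, t)) := by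
    rw [← hdq]; exact Metric.infDist_le_dist_of_mem (S.mem_spaceTime_X ha ht).2
  have hμε : |μ| < ε := by
    have h1 : |μ| * c ≤ |μ| * ‖g‖ := by gcongr; exact hc _ hqS
    nlinarith
  refine ⟨q, μ, hqS, hμε, hμ, ?_⟩
  have hs := S.sign_φ_normal hqS (hε q t hqS) hμε
  rw [← hg, ← hμ] at hs
  unfold d
  rw [hs]
  have : Metric.infDist x (S.Γ t) = |μ| * ‖g‖ := by rw [← hdist]; exact hdq
  rw [this, ← mul_assoc]
  congr 1
  rcases lt_trichotomy μ 0 with h | h | h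
  · rw [Real.sign_of_neg h, abs_of_neg h]; ring
  · simp [h]
  · rw [Real.sign_of_pos h, abs_of_pos h]; ring

/-- Wherever a point `x` is smoothly resolved as `q + μ ∇φ(q)` with `φ(q) = 0`, the function
`μ |∇φ(q)|` has the unit normal at `q` as its gradient. -/
theorem hasFDerivAt_normal_coordinate {t : ℝ} {x : Amb m} {q : Amb m → Amb m} {μ : Amb m → ℝ}
    (hq : DifferentiableAt ℝ q x)
    (h1 : ∀ᶠ y in nhds x, y = q y + μ y • spatialGrad S.φ (q y, t))
    (h2 : ∀ᶠ y in nhds x, S.φ (q y, t) = 0) (h3 : spatialGrad S.φ (q x, t) ≠ 0) :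
    HasFDerivAt (fun y => μ y * ‖spatialGrad S.φ (q y, t)‖)
      (innerSL ℝ (‖spatialGrad S.φ (q x, t)‖⁻¹ • spatialGrad S.φ (q x, t))) x := by
  have hgd : Differentiable ℝ (spatialGrad S.φ) :=
    (contDiff_spatialGrad S.φ_smooth).differentiable (by simp)
  have hg : DifferentiableAt ℝ (fun y => spatialGrad S.φ (q y, t)) x :=
    (hgd _).comp x (hq.prodMk (differentiableAt_const t))
  set g : Amb m → Amb m := fun y => spatialGrad S.φ (q y, t) with hgdef
  have hgx : g x ≠ 0 := h3
  have hev : ∀ᶠ y in nhds x, g y ≠ 0 := hg.continuousAt.eventually_ne hgx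
  have hn : DifferentiableAt ℝ (fun y => ‖g y‖⁻¹ • g y) x :=
    ((hg.norm ℝ hgx).inv (norm_ne_zero_iff.2 hgx)).smul hg
  set n : Amb m → Amb m := fun y => ‖g y‖⁻¹ • g y with hndef
  have hnn : ∀ᶠ y in nhds x, ⟪n y, n y⟫ = 1 := by
    filter_upwards [hev] with y hy
    rw [real_inner_self_eq_norm_sq, norm_smul, norm_inv, norm_norm,
      inv_mul_cancel₀ (norm_ne_zero_iff.2 hy), one_pow]
  have hnn' : ∀ w, ⟪n x, fderiv ℝ n x w⟫ = 0 := fun w => by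
    have e1 := hn.hasFDerivAt.inner ℝ hn.hasFDerivAt
    have e2 : HasFDerivAt (fun y => ⟪n y, n y⟫) (0 : Amb m →L[ℝ] ℝ) x :=
      (hasFDerivAt_const (1 : ℝ) x).congr_of_eventuallyEq hnn
    have := DFunLike.congr_fun (e1.unique e2) w
    simp only [ContinuousLinearMap.comp_apply, ContinuousLinearMap.prod_apply,
      fderivInnerCLM_apply, zero_apply] at this
    rw [real_inner_comm (n x) (fderiv ℝ n x w)] at this
    linarith
  have hφq : ∀ w, ⟪g x, fderiv ℝ q x w⟫ = 0 := fun w => by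
    have e1 := (hasFDerivAt_slice (S.φ_smooth.differentiable (by simp) (q x, t))).comp x
      hq.hasFDerivAt
    have e2 : HasFDerivAt (fun y => S.φ (q y, t)) (0 : Amb m →L[ℝ] ℝ) x :=
      (hasFDerivAt_const (0 : ℝ) x).congr_of_eventuallyEq h2
    have := DFunLike.congr_fun (e1.unique e2) w
    rw [hgdef, inner_spatialGrad]
    simpa using this
  -- The function is `⟪y - q y, n y⟫`. In its derivative only `⟪w, n⟫` survives: `y - q y` is normal
  -- and `∂n` tangential, and `∂q` is tangential while `n` is normal.
  have hrep : (fun y => μ y * ‖g y‖) =ᶠ[nhds x] fun y => ⟪y - q y, n y⟫ := by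
    filter_upwards [h1, hev] with y hy hy0
    have : y - q y = μ y • g y := by
      nth_rewrite 1 [hy]; simp [hgdef]
    rw [this, hndef, inner_smul_left, inner_smul_right, real_inner_self_eq_norm_sq]
    have := norm_ne_zero_iff.2 hy0
    simp only [conj_trivial]
    field_simp
  have hxq : x - q x = (μ x * ‖g x‖) • n x := by
    have : x - q x = μ x • g x := by
      nth_rewrite 1 [h1.self_of_nhds]; simp [hgdef]
    rw [this, hndef, smul_smul, mul_assoc, mul_inv_cancel₀ (norm_ne_zero_iff.2 hgx), mul_one]
  have e := ((hasFDerivAt_id x).sub hq.hasFDerivAt).inner ℝ hn.hasFDerivAt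
  refine (e.congr_of_eventuallyEq hrep).congr_fderiv ?_
  ext w
  simp only [ContinuousLinearMap.comp_apply, ContinuousLinearMap.prod_apply,
      fderivInnerCLM_apply, ContinuousLinearMap.id_apply,
      sub_apply, innerSL_apply_apply]
  change ⟪x - q x, _⟫ + _ = _
  rw [hxq, inner_smul_left, hnn', mul_zero, zero_add, inner_sub_left]
  have : ⟪fderiv ℝ q x w, n x⟫ = 0 := by
    rw [hndef, inner_smul_right, real_inner_comm, hφq, mul_zero]
  rw [this, sub_zero, real_inner_comm]

/-- The normal coordinates `(q, μ)` of a neighbourhood of the space-time surface. -/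
theorem exists_normal_coordinates : ∃ (q : Amb m × ℝ → Amb m) (μ : Amb m × ℝ → ℝ)
    (Ω : Set (Amb m × ℝ)), IsOpen Ω ∧ S.spaceTime ⊆ Ω ∧
      (∀ z ∈ Ω, z.1 = q z + μ z • spatialGrad S.φ (q z, z.2) ∧ S.φ (q z, z.2) = 0 ∧
        spatialGrad S.φ (q z, z.2) ≠ 0 ∧ ContDiffAt ℝ ∞ q z ∧ ContDiffAt ℝ ∞ μ z) ∧
      ∀ z₀ ∈ S.spaceTime, ∀ᶠ z in nhds z₀, z.2 ∈ Set.Icc 0 S.T →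
        S.d z.1 z.2 = μ z * ‖spatialGrad S.φ (q z, z.2)‖ := by
  have hgc : Continuous (spatialGrad S.φ) := (contDiff_spatialGrad S.φ_smooth).continuous
  have hKc : IsCompact ((fun z : Amb m × ℝ => (z.1, (0 : ℝ), z.2)) '' S.spaceTime) :=
    S.isCompact_spaceTime.image (by fun_prop)
  have hΘK : ∀ z ∈ S.spaceTime, S.normalMap (z.1, 0, z.2) = (z.1, 0, z.2) := fun z hz => by
    simp [normalMap, hz.2]
  have hOo : IsOpen {y : Amb m × ℝ × ℝ | 0 < ⟪spatialGrad S.φ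
    (y.1 + y.2.1 • spatialGrad S.φ (y.1, y.2.2), y.2.2), spatialGrad S.φ (y.1, y.2.2)⟫} :=
    isOpen_lt continuous_const (by fun_prop)
  obtain ⟨V, hVO, hVo, hKV, hΘV, J, hJ⟩ := exists_smooth_inverse_near_compact
    S.contDiff_normalMap hKc (by
      rintro _ ⟨z, hz, rfl⟩ _ ⟨z', hz', rfl⟩ h
      rwa [hΘK z hz, hΘK z' hz'] at h)
    (by rintro _ ⟨z, hz, rfl⟩; exact S.injective_fderiv_normalMap hz) hOo (by
    rintro _ ⟨z, hz, rfl⟩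
    have : 0 < ⟪spatialGrad S.φ z, spatialGrad S.φ z⟫ :=
      real_inner_self_pos.2 (S.spatialGrad_ne_zero hz)
    simpa using this)
  obtain ⟨ε, hε0, hεV⟩ := hKc.exists_thickening_subset_open hVo hKV
  have htube : ∀ q t, (q, t) ∈ S.spaceTime → ∀ s : ℝ, |s| < ε → (q, s, t) ∈ V := by
    intro q t hq s hs
    refine hεV (Metric.mem_thickening_iff.2 ⟨(q, 0, t), ⟨(q, t), hq, rfl⟩, ?_⟩)
    simpa [Prod.dist_eq, Real.dist_eq] using hs
  have hpos : ∀ q t, (q, t) ∈ S.spaceTime → ∀ s : ℝ, |s| < ε →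
      0 < ⟪spatialGrad S.φ (q + s • spatialGrad S.φ (q, t), t), spatialGrad S.φ (q, t)⟫ := by
    intro q t hq s hs
    have h := hVO (htube q t hq s hs)
    rw [Set.mem_ofPred_eq] at h
    exact h
  refine ⟨fun z => (J (z.1, 0, z.2)).1, fun z => (J (z.1, 0, z.2)).2.1,
    {z | (z.1, (0 : ℝ), z.2) ∈ S.normalMap '' V}, hΘV.preimage (by fun_prop),
    fun z hz => ⟨_, hKV ⟨z, hz, rfl⟩, hΘK z hz⟩, ?_, ?_⟩
  · rintro ⟨x, t⟩ ⟨⟨p, s, τ⟩, hy, hyz⟩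
    have hJy := hJ _ hy
    rw [hyz] at hJy
    have hyO := hVO hy
    simp only [normalMap, Prod.mk.injEq] at hyz
    obtain ⟨e1, e2, rfl⟩ := hyz
    have hJs : ContDiffAt ℝ ∞ (fun z : Amb m × ℝ => J (z.1, (0 : ℝ), z.2)) (x, τ) :=
      ContDiffAt.comp (g := J) (f := fun z : Amb m × ℝ => (z.1, (0 : ℝ), z.2)) (x, τ) hJy.2
        (by fun_prop : ContDiffAt ℝ ∞ (fun z : Amb m × ℝ => (z.1, (0 : ℝ), z.2)) (x, τ))
    simp only [hJy.1]
    refine ⟨e1.symm, e2, fun h0 => ?_, hJs.fst, hJs.snd.fst⟩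
    simp [h0] at hyO
  · intro z₀ hz₀
    filter_upwards [S.eventually_normal_coordinates hε0 hpos hz₀] with z hz ht
    obtain ⟨p, s, hp, hs, h1, h2⟩ := hz ht
    have hΘ : S.normalMap (p, s, z.2) = (z.1, 0, z.2) := by
      simp [normalMap, ← h1, hp.2]
    have hJz := (hJ _ (htube p z.2 hp s hs)).1
    rw [hΘ] at hJz
    simp only [hJz, h2]

/-- A smooth signed distance near the space-time surface, not yet extended to the whole space. -/
theorem exists_signedDistance_near : ∃ (D : Amb m × ℝ → ℝ) (Ω : Set (Amb m × ℝ)), IsOpen Ω ∧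
    S.spaceTime ⊆ Ω ∧ (∀ z ∈ Ω, ContDiffAt ℝ ∞ D z ∧ ‖spatialGrad D z‖ = 1 ∧
        S.φ (z.1 - D z • spatialGrad D z, z.2) = 0) ∧
      ∀ z₀ ∈ S.spaceTime, ∀ᶠ z in nhds z₀, z.2 ∈ Set.Icc 0 S.T → S.d z.1 z.2 = D z := by
  obtain ⟨q, μ, Ω, hΩo, hSΩ, hΩ, hd⟩ := S.exists_normal_coordinates
  have hgs := contDiff_spatialGrad S.φ_smooth
  have hDs : ∀ z ∈ Ω, ContDiffAt ℝ ∞ (fun z => μ z * ‖spatialGrad S.φ (q z, z.2)‖) z :=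
    fun z hz => by
      obtain ⟨-, -, h3, h4, h5⟩ := hΩ z hz
      exact h5.mul ((hgs.contDiffAt.comp z (h4.prodMk contDiffAt_snd)).norm ℝ h3)
  have hDg : ∀ z ∈ Ω, spatialGrad (fun z => μ z * ‖spatialGrad S.φ (q z, z.2)‖) z =
      ‖spatialGrad S.φ (q z, z.2)‖⁻¹ • spatialGrad S.φ (q z, z.2) := by
    rintro ⟨x, t⟩ hz
    obtain ⟨-, -, h3, h4, -⟩ := hΩ _ hz
    have hcont : Continuous fun y : Amb m => (y, t) := by fun_prop
    have hev : ∀ᶠ y in nhds x, (y, t) ∈ Ω := hcont.continuousAt.eventually_mem (hΩo.mem_nhds hz)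
    have hd : DifferentiableAt ℝ (fun y => q (y, t)) x :=
      DifferentiableAt.comp x (h4.differentiableAt (by simp))
        (by fun_prop : DifferentiableAt ℝ (fun y => (y, t)) x)
    have key := S.hasFDerivAt_normal_coordinate (t := t) (μ := fun y => μ (y, t)) hd
      (hev.mono fun y hy => (hΩ _ hy).1) (hev.mono fun y hy => (hΩ _ hy).2.1) h3
    have key2 := hasFDerivAt_slice ((hDs _ hz).differentiableAt (by simp))
    refine ext_inner_right ℝ fun w => ?_
    rw [inner_spatialGrad]
    have := DFunLike.congr_fun (key2.unique key) w
    simpa [inner_smul_left] using this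
  refine ⟨_, Ω, hΩo, hSΩ, fun z hz => ⟨hDs z hz, ?_, ?_⟩, hd⟩
  · obtain ⟨-, -, h3, -, -⟩ := hΩ z hz
    rw [hDg z hz, norm_smul, norm_inv, norm_norm, inv_mul_cancel₀ (norm_ne_zero_iff.2 h3)]
  · obtain ⟨h1, h2, h3, -, -⟩ := hΩ z hz
    rw [hDg z hz, smul_smul, mul_assoc, mul_inv_cancel₀ (norm_ne_zero_iff.2 h3), mul_one,
      sub_eq_of_eq_add h1, h2]

/-- The signed distance function of an evolving surface is, near the space-time surface and for
times in `[0,T]`, the restriction of a globally smooth function whose gradient has unit length, and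
the normal projection maps into the surface. -/
theorem exists_smooth_signedDistance : ∃ D : Amb m × ℝ → ℝ, ContDiff ℝ ∞ D ∧
    ∃ U : Set (Amb m × ℝ), IsOpen U ∧ S.spaceTime ⊆ U ∧ ∀ z ∈ U,
      (z.2 ∈ Set.Icc 0 S.T → S.d z.1 z.2 = D z) ∧ ‖spatialGrad D z‖ = 1 ∧
        S.φ (z.1 - D z • spatialGrad D z, z.2) = 0 := by
  obtain ⟨D₀, Ω, hΩo, hSΩ, hD₀, hd⟩ := S.exists_signedDistance_near
  obtain ⟨t, htc, hSt, htΩ⟩ := exists_compact_between S.isCompact_spaceTime hΩo hSΩ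
  -- A cutoff function makes the local signed distance globally smooth.
  obtain ⟨χ, hχ1, hχ0, -⟩ := exists_contMDiffMap_one_nhds_of_subset_interior
    (modelWithCornersSelf ℝ (Amb m × ℝ)) (n := ⊤) S.isCompact_spaceTime.isClosed hSt
  have hχs : ContDiff ℝ ∞ χ := χ.contMDiff.contDiff
  have hDs : ContDiff ℝ ∞ fun z => χ z * D₀ z := by
    refine contDiff_iff_contDiffAt.2 fun z => ?_
    by_cases hz : z ∈ t
    · exact hχs.contDiffAt.mul (hD₀ z (htΩ hz)).1
    · refine (contDiffAt_const (c := (0 : ℝ))).congr_of_eventuallyEq ?_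
      filter_upwards [htc.isClosed.isOpen_compl.mem_nhds hz] with y hy
      rw [hχ0 y hy, zero_mul]
  have hdS : ∀ᶠ z in nhdsSet S.spaceTime, z.2 ∈ Set.Icc 0 S.T → S.d z.1 z.2 = D₀ z :=
    eventually_nhdsSet_iff_forall.2 hd
  obtain ⟨U, hUo, hSU, hU⟩ := eventually_nhdsSet_iff_exists.1 (hχ1.and hdS)
  refine ⟨_, hDs, U ∩ Ω, hUo.inter hΩo, Set.subset_inter hSU hSΩ, fun z hz => ?_⟩
  have heq : (fun z => χ z * D₀ z) =ᶠ[nhds z] D₀ := by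
    filter_upwards [hUo.mem_nhds hz.1] with y hy
    rw [(hU y hy).1, one_mul]
  have hz' : χ z * D₀ z = D₀ z := heq.self_of_nhds
  rw [heq.spatialGrad_eq, hz']
  exact ⟨(hU z hz.1).2, (hD₀ z hz.2).2⟩

end EvolvingSurface

/-! ### The smooth model of the distance function -/

/-- A globally smooth function `D` that agrees with the oriented distance on a neighbourhood `U` of
the space-time surface (for times in `[0,T]`), together with the facts about its gradient that are
needed. The globally defined `D` makes all derived quantities total smooth functions. -/
structure SmoothDistance {m : ℕ} (S : EvolvingSurface m) where
  D : Amb m × ℝ → ℝ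
  smooth : ContDiff ℝ ∞ D
  U : Set (Amb m × ℝ)
  isOpen : IsOpen U
  subset : S.spaceTime ⊆ U
  eq_d : ∀ x t, (x, t) ∈ U → t ∈ Set.Icc 0 S.T → S.d x t = D (x, t)
  norm_grad : ∀ z ∈ U, ‖spatialGrad D z‖ = 1
  φ_foot : ∀ z ∈ U, S.φ (z.1 - D z • spatialGrad D z, z.2) = 0

theorem EvolvingSurface.nonempty_smoothDistance {m : ℕ} (S : EvolvingSurface m) :
    Nonempty (SmoothDistance S) := by
  obtain ⟨D, hD, U, hU, hSU, h⟩ := S.exists_smooth_signedDistance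
  exact ⟨⟨D, hD, U, hU, hSU, fun x t hz => (h (x, t) hz).1, fun z hz => (h z hz).2.1,
    fun z hz => (h z hz).2.2⟩⟩

namespace SmoothDistance

noncomputable section

variable {m : ℕ} {S : EvolvingSurface m} (𝒟 : SmoothDistance S)

/-- The smooth model of the normal. -/
def N (z : Amb m × ℝ) : Amb m := spatialGrad 𝒟.D z

/-- The smooth model of the extended Weingarten map. -/
def H (z : Amb m × ℝ) : Amb m →L[ℝ] Amb m :=
  (fderiv ℝ 𝒟.N z).comp (ContinuousLinearMap.inl ℝ (Amb m) ℝ)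

/-- The smooth model of the normal projection. -/
def foot (z : Amb m × ℝ) : Amb m := z.1 - 𝒟.D z • 𝒟.N z

/-- The smooth model `Id - N Nᵀ` of the tangential projection. -/
def tang (z : Amb m × ℝ) : Amb m →L[ℝ] Amb m :=
  ContinuousLinearMap.id ℝ (Amb m) - (innerSL ℝ (𝒟.N z)).smulRight (𝒟.N z)

/-- The smooth model of the flow, extended from `Γ(0)` constantly along the normals. -/
def flow (z : Amb m × ℝ) : Amb m := S.X (𝒟.foot (z.1, 0), z.2)

theorem contDiff_N : ContDiff ℝ ∞ 𝒟.N := contDiff_spatialGrad 𝒟.smooth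

theorem contDiff_H : ContDiff ℝ ∞ 𝒟.H :=
  (𝒟.contDiff_N.fderiv_right (by simp)).clm_comp contDiff_const

theorem contDiff_foot : ContDiff ℝ ∞ 𝒟.foot :=
  contDiff_fst.sub (𝒟.smooth.smul 𝒟.contDiff_N)

theorem contDiff_tang : ContDiff ℝ ∞ 𝒟.tang :=
  contDiff_const.sub
    (((innerSL ℝ (E := Amb m)).contDiff.comp 𝒟.contDiff_N).smulRight 𝒟.contDiff_N)

theorem contDiff_flow : ContDiff ℝ ∞ 𝒟.flow := by
  have h1 := 𝒟.contDiff_foot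
  have h2 := S.X_smooth
  unfold flow
  fun_prop

theorem tang_apply (z : Amb m × ℝ) (w : Amb m) : 𝒟.tang z w = w - ⟪𝒟.N z, w⟫ • 𝒟.N z := by
  simp [tang]

theorem inner_N (z : Amb m × ℝ) (w : Amb m) : ⟪𝒟.N z, w⟫ = fderiv ℝ 𝒟.D z (w, 0) :=
  inner_spatialGrad _ _ _

theorem D_eq_zero {z : Amb m × ℝ} (hz : z ∈ S.spaceTime) : 𝒟.D z = 0 := by
  rw [← 𝒟.eq_d z.1 z.2 (𝒟.subset hz) hz.1, EvolvingSurface.d, hz.2, Real.sign_zero, zero_mul]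

theorem hasFDerivAt_foot (x : Amb m) (t : ℝ) : HasFDerivAt (fun y => 𝒟.foot (y, t))
    (𝒟.tang (x, t) - 𝒟.D (x, t) • 𝒟.H (x, t)) x := by
  have h1 := hasFDerivAt_slice (𝒟.smooth.differentiable (by simp) (x, t))
  have h2 := hasFDerivAt_slice (𝒟.contDiff_N.differentiable (by simp) (x, t))
  refine ((hasFDerivAt_id x).sub (h1.smul h2)).congr_fderiv ?_
  ext1 w
  have := 𝒟.inner_N (x, t) w
  simp [tang_apply, H, this]
  abel

theorem eventually_eq_d {x : Amb m} {t : ℝ} (hU : (x, t) ∈ 𝒟.U) (ht : t ∈ Set.Icc 0 S.T) :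
    (fun y => S.d y t) =ᶠ[nhds x] fun y => 𝒟.D (y, t) := by
  have hcont : Continuous fun y : Amb m => (y, t) := by fun_prop
  filter_upwards [hcont.continuousAt.eventually_mem (𝒟.isOpen.mem_nhds hU)] with y hy
  exact 𝒟.eq_d y t hy ht

theorem ν_eq {x : Amb m} {t : ℝ} (hU : (x, t) ∈ 𝒟.U) (ht : t ∈ Set.Icc 0 S.T) :
    S.ν x t = 𝒟.N (x, t) := by
  rw [EvolvingSurface.ν, (𝒟.eventually_eq_d hU ht).gradient.eq_of_nhds,
    gradient_slice (𝒟.smooth.differentiable (by simp) _)]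
  rfl

theorem eventually_eq_ν {x : Amb m} {t : ℝ} (hU : (x, t) ∈ 𝒟.U) (ht : t ∈ Set.Icc 0 S.T) :
    (fun y => S.ν y t) =ᶠ[nhds x] fun y => 𝒟.N (y, t) := by
  have hcont : Continuous fun y : Amb m => (y, t) := by fun_prop
  filter_upwards [hcont.continuousAt.eventually_mem (𝒟.isOpen.mem_nhds hU)] with y hy
  exact 𝒟.ν_eq hy ht

theorem weingarten_eq {x : Amb m} {t : ℝ} (hU : (x, t) ∈ 𝒟.U) (ht : t ∈ Set.Icc 0 S.T) :
    S.weingarten x t = 𝒟.H (x, t) := by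
  rw [EvolvingSurface.weingarten, (𝒟.eventually_eq_ν hU ht).fderiv_eq,
    (hasFDerivAt_slice (𝒟.contDiff_N.differentiable (by simp) _)).fderiv, H]

theorem proj_eq {x : Amb m} {t : ℝ} (hU : (x, t) ∈ 𝒟.U) (ht : t ∈ Set.Icc 0 S.T) :
    S.proj x t = 𝒟.foot (x, t) := by
  rw [EvolvingSurface.proj, 𝒟.ν_eq hU ht, 𝒟.eq_d x t hU ht, foot]

theorem eventually_eq_proj {x : Amb m} {t : ℝ} (hU : (x, t) ∈ 𝒟.U) (ht : t ∈ Set.Icc 0 S.T) :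
    (fun y => S.proj y t) =ᶠ[nhds x] fun y => 𝒟.foot (y, t) := by
  have hcont : Continuous fun y : Amb m => (y, t) := by fun_prop
  filter_upwards [hcont.continuousAt.eventually_mem (𝒟.isOpen.mem_nhds hU)] with y hy
  exact 𝒟.proj_eq hy ht

theorem Pr_eq {x : Amb m} {t : ℝ} (hU : (x, t) ∈ 𝒟.U) (ht : t ∈ Set.Icc 0 S.T) :
    S.Pr x t = 𝒟.tang (x, t) := by
  have h : S.Pr x t = (Submodule.span ℝ {𝒟.N (x, t)})ᗮ.starProjection := by
    simp only [EvolvingSurface.Pr, 𝒟.ν_eq hU ht]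
  rw [h]
  ext1 w
  rw [Submodule.starProjection_orthogonal, 𝒟.tang_apply]
  simp only [sub_apply, ContinuousLinearMap.id_apply]
  rw [Submodule.starProjection_unit_singleton ℝ
    (show ‖𝒟.N (x, t)‖ = 1 from 𝒟.norm_grad _ hU)]

end

end SmoothDistance

/-! ### Nondegeneracy of the flow -/

namespace EvolvingSurface

variable {m : ℕ} (S : EvolvingSurface m)

theorem hasDerivAt_X {a : Amb m} (ha : S.φ (a, 0) = 0) {t : ℝ} (ht : t ∈ Set.Icc 0 S.T) :
    HasDerivAt (fun s => S.X (a, s)) (S.v (S.X (a, t), t)) t := by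
  have hd : DifferentiableAt ℝ (fun s => S.X (a, s)) t :=
    (S.X_smooth.comp (contDiff_prodMk_right a)).differentiable (by simp) t
  have := (uniqueDiffOn_Icc S.T_pos t ht).eq_deriv _ hd.hasDerivAt.hasDerivWithinAt
    (S.X_deriv a ha t ht)
  rw [← this]
  exact hd.hasDerivAt

theorem exists_lipschitz_v : ∃ (L : NNReal) (R : ℝ),
    (∀ z ∈ S.spaceTime, z.1 ∈ Metric.closedBall (0 : Amb m) R) ∧
    ∀ t ∈ Set.Icc 0 S.T, LipschitzOnWith L (fun x => S.v (x, t)) (Metric.closedBall 0 R) := by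
  obtain ⟨R, hR⟩ := S.isCompact_spaceTime.exists_bound_of_continuousOn
    (f := fun z : Amb m × ℝ => z.1) continuous_fst.continuousOn
  have hc : IsCompact (Metric.closedBall (0 : Amb m) R ×ˢ Set.Icc 0 S.T) :=
    (isCompact_closedBall _ _).prod isCompact_Icc
  obtain ⟨C, hC⟩ := hc.exists_bound_of_continuousOn
    (S.v_smooth.continuous_fderiv (by simp)).continuousOn
  refine ⟨C.toNNReal, R, fun z hz => by simpa using hR z hz, fun t ht => ?_⟩
  have hconv : Convex ℝ (Metric.closedBall (0 : Amb m) R ×ˢ Set.Icc 0 S.T) :=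
    (convex_closedBall _ _).prod (convex_Icc _ _)
  refine LipschitzOnWith.of_dist_le_mul fun x hx y hy => ?_
  have := hconv.norm_image_sub_le_of_norm_fderiv_le (𝕜 := ℝ) (f := S.v) (C := C.toNNReal)
    (fun z _ => S.v_smooth.differentiable (by simp) z)
    (fun z hz => (hC z hz).trans (Real.le_coe_toNNReal C)) (x := (y, t)) (y := (x, t))
    ⟨hy, ht⟩ ⟨hx, ht⟩
  rw [dist_eq_norm, dist_eq_norm]
  simpa [Prod.norm_def] using this

/-- The flow contracts distances on `Γ(0)` at most by a fixed factor: Grönwall's inequality for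
the flow run backwards. -/
theorem exists_dist_le_dist_X : ∃ C : ℝ, ∀ a b, S.φ (a, 0) = 0 → S.φ (b, 0) = 0 →
    ∀ t ∈ Set.Icc 0 S.T, dist a b ≤ C * dist (S.X (a, t)) (S.X (b, t)) := by
  obtain ⟨L, R, hR, hL⟩ := S.exists_lipschitz_v
  refine ⟨Real.exp (L * S.T), fun a b ha hb t ht => ?_⟩
  have hmem : ∀ s ∈ Set.Ico 0 t, t - s ∈ Set.Icc 0 S.T := fun s hs =>
    ⟨by linarith [hs.2], by linarith [hs.1, ht.2]⟩
  have hder : ∀ c, S.φ (c, 0) = 0 → ∀ s ∈ Set.Ico 0 t, HasDerivWithinAt (fun s => S.X (c, t - s))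
      (-S.v (S.X (c, t - s), t - s)) (Set.Ici s) s := fun c hc s hs => by
    have h1 := (S.hasDerivAt_X hc (hmem s hs)).scomp s ((hasDerivAt_id s).const_sub t)
    simpa [Function.comp_def] using h1.hasDerivWithinAt
  have hcont : ∀ c, ContinuousOn (fun s => S.X (c, t - s)) (Set.Icc 0 t) := fun c => by
    have := S.X_smooth.continuous
    exact Continuous.continuousOn (by fun_prop)
  have hball : ∀ c, S.φ (c, 0) = 0 → ∀ s ∈ Set.Ico 0 t,
      S.X (c, t - s) ∈ Metric.closedBall (0 : Amb m) R := fun c hc s hs =>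
    hR (S.X (c, t - s), t - s) (S.mem_spaceTime_X hc (hmem s hs))
  have key := dist_le_of_trajectories_ODE_of_mem (v := fun s x => -S.v (x, t - s))
    (s := fun _ => Metric.closedBall 0 R) (K := L) (a := 0) (b := t)
    (f := fun s => S.X (a, t - s)) (g := fun s => S.X (b, t - s))
    (δ := dist (S.X (a, t)) (S.X (b, t)))
    (fun s hs => (hL _ (hmem s hs)).neg) (hcont a) (hder a ha)
    (hball a ha) (hcont b) (hder b hb)
    (hball b hb) (by simp) t ⟨ht.1, le_rfl⟩
  simp only [sub_self, sub_zero, S.X_zero a ha, S.X_zero b hb] at key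
  rw [mul_comm]
  refine key.trans ?_
  gcongr
  exact ht.2

end EvolvingSurface

namespace SmoothDistance

variable {m : ℕ} {S : EvolvingSurface m} (𝒟 : SmoothDistance S)

theorem flow_mem {y : Amb m} (hy : (y, 0) ∈ 𝒟.U) {t : ℝ} (ht : t ∈ Set.Icc 0 S.T) :
    (𝒟.flow (y, t), t) ∈ S.spaceTime :=
  S.mem_spaceTime_X (𝒟.φ_foot _ hy) ht

/-- The differential of the flow is injective on the tangent spaces of `Γ(0)`. -/
theorem eq_zero_of_fderiv_flow_eq_zero {a w : Amb m} (ha : S.φ (a, 0) = 0) {t : ℝ}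
    (ht : t ∈ Set.Icc 0 S.T) (hw : ⟪𝒟.N (a, 0), w⟫ = 0)
    (h : fderiv ℝ 𝒟.flow (a, t) (w, 0) = 0) : w = 0 := by
  obtain ⟨C, hC⟩ := S.exists_dist_le_dist_X
  have haS : (a, (0 : ℝ)) ∈ S.spaceTime := ⟨⟨le_rfl, S.T_pos.le⟩, ha⟩
  have hline : HasDerivAt (fun s : ℝ => a + s • w) w 0 := by
    simpa using ((hasDerivAt_id (0 : ℝ)).smul_const w).const_add a
  have hfoot : HasDerivAt (fun s : ℝ => 𝒟.foot (a + s • w, 0)) w 0 := by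
    have h1 : HasFDerivAt (fun y => 𝒟.foot (y, 0)) _ (a + (0 : ℝ) • w) := 𝒟.hasFDerivAt_foot _ 0
    have h2 := h1.comp_hasDerivAt (0 : ℝ) hline
    simp only [zero_smul, add_zero, 𝒟.D_eq_zero haS] at h2
    rw [sub_apply, smul_apply, zero_smul, sub_zero, tang_apply, hw, zero_smul, sub_zero] at h2
    exact h2
  have hflow : HasDerivAt (fun s : ℝ => 𝒟.flow (a + s • w, t)) 0 0 := by
    have h1 := hasFDerivAt_slice (𝒟.contDiff_flow.differentiable (by simp) (a + (0 : ℝ) • w, t))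
    have h2 := h1.comp_hasDerivAt (0 : ℝ) hline
    simp only [zero_smul, add_zero] at h2
    simpa [Function.comp_def, h] using h2
  have hU : ∀ᶠ s : ℝ in nhds 0, (a + s • w, (0 : ℝ)) ∈ 𝒟.U := by
    have hc : Continuous fun s : ℝ => (a + s • w, (0 : ℝ)) := by fun_prop
    refine hc.continuousAt.eventually_mem (𝒟.isOpen.mem_nhds ?_)
    simpa using 𝒟.subset haS
  have hO : (fun s : ℝ => 𝒟.foot (a + s • w, 0) - 𝒟.foot (a, 0)) =O[nhds 0]
      fun s : ℝ => 𝒟.flow (a + s • w, t) - 𝒟.flow (a, t) := by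
    refine Asymptotics.IsBigO.of_bound C ?_
    filter_upwards [hU] with s hs
    rw [← dist_eq_norm, ← dist_eq_norm]
    exact hC _ _ (𝒟.φ_foot _ hs) (𝒟.φ_foot _ (𝒟.subset haS)) t ht
  have h0 : HasDerivAt (fun s : ℝ => 𝒟.foot (a + s • w, 0)) 0 0 := by
    rw [hasDerivAt_iff_isLittleO] at hflow ⊢
    simp only [zero_smul, add_zero, sub_zero, smul_zero] at hflow ⊢
    exact hO.trans_isLittleO hflow
  exact hfoot.unique h0

end SmoothDistance

/-! ### Lagrange interpolation on the principal lattice -/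

section Lattice

variable {ι : Type*} [Fintype ι] [DecidableEq ι]

/-- The generalized binomial coefficient `x (x - 1) ⋯ (x - n + 1) / n!`. -/
noncomputable def binomFactor (x : ℝ) (n : ℕ) : ℝ := ∏ s ∈ Finset.range n, (x - s) / (s + 1)

theorem binomFactor_succ (x : ℝ) (n : ℕ) :
    ((n : ℝ) + 1) * binomFactor x (n + 1) = x * binomFactor (x - 1) n := by
  induction n with
  | zero => simp [binomFactor]
  | succ n ih =>
    have h1 : binomFactor x (n + 1 + 1) =
        binomFactor x (n + 1) * ((x - (n + 1 : ℕ)) / ((n + 1 : ℕ) + 1)) :=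
      Finset.prod_range_succ _ _
    have h2 : binomFactor (x - 1) (n + 1) = binomFactor (x - 1) n * ((x - 1 - n) / (n + 1)) :=
      Finset.prod_range_succ _ _
    have h3 : ((n : ℝ) + 1) ≠ 0 := by positivity
    have h4 : ((n : ℝ) + 1 + 1) ≠ 0 := by positivity
    rw [h1, h2, ← mul_assoc x, ← ih]
    push_cast
    field_simp
    ring

/-- The factor `αᵢ` lowers the degree of the lattice sum by one, because
`n binom(x, n) = x binom(x - 1, n - 1)`. -/
theorem sum_binomFactor_mul (n : ℕ) (i : ι) (x : ι → ℝ) (q : (ι → ℕ) → ℝ) :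
    ∑ α ∈ Finset.piAntidiag Finset.univ (n + 1), (∏ j, binomFactor (x j) (α j)) * (α i * q α) =
      x i * ∑ β ∈ Finset.piAntidiag Finset.univ n,
        (∏ j, binomFactor (Function.update x i (x i - 1) j) (β j)) *
          q (Function.update β i (β i + 1)) := by
  rw [Finset.mul_sum, ← Finset.sum_filter_of_ne (p := fun α : ι → ℕ => α i ≠ 0)]
  swap
  · intro α _ h h0
    simp [h0] at h
  refine Finset.sum_nbij' (fun α => Function.update α i (α i - 1))
    (fun β => Function.update β i (β i + 1)) ?_ ?_ ?_ ?_ ?_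
  · intro α hα
    simp only [Finset.mem_filter, Finset.mem_piAntidiag, Finset.mem_univ, implies_true,
      and_true] at hα ⊢
    rw [Finset.sum_update_of_mem (Finset.mem_univ i)]
    rw [← Finset.sum_erase_add _ _ (Finset.mem_univ i), Finset.erase_eq] at hα
    have := hα.2
    omega
  · intro β hβ
    simp only [Finset.mem_filter, Finset.mem_piAntidiag, Finset.mem_univ, implies_true,
      and_true] at hβ ⊢
    rw [Finset.sum_update_of_mem (Finset.mem_univ i)]
    rw [← Finset.sum_erase_add _ _ (Finset.mem_univ i), Finset.erase_eq] at hβ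
    refine ⟨by omega, by simp⟩
  · intro α hα
    simp only [Finset.mem_filter] at hα
    have : α i - 1 + 1 = α i := Nat.succ_pred_eq_of_ne_zero hα.2
    simp [this]
  · intro β _
    simp
  · intro α hα
    simp only [Finset.mem_filter] at hα
    obtain ⟨a, ha⟩ := Nat.exists_eq_succ_of_ne_zero hα.2
    rw [← Finset.mul_prod_erase _ _ (Finset.mem_univ i),
      ← Finset.mul_prod_erase _ (fun j => binomFactor (Function.update x i (x i - 1) j) _)
        (Finset.mem_univ i)]
    have h1 : ∏ j ∈ Finset.univ.erase i, binomFactor (Function.update x i (x i - 1) j)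
        (Function.update α i (α i - 1) j) = ∏ j ∈ Finset.univ.erase i, binomFactor (x j) (α j) := by
      refine Finset.prod_congr rfl fun j hj => ?_
      rw [Function.update_of_ne (Finset.ne_of_mem_erase hj),
        Function.update_of_ne (Finset.ne_of_mem_erase hj)]
    have h2 := binomFactor_succ (x i) a
    have h3 : Function.update (Function.update α i (α i - 1)) i
        (Function.update α i (α i - 1) i + 1) = α := by
      simp [ha]
    rw [h1, h3]
    simp only [Function.update_self, ha, Nat.succ_eq_add_one, Nat.add_sub_cancel]
    push_cast
    linear_combination (∏ j ∈ Finset.univ.erase i, binomFactor (x j) (α j)) * q α * h2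

/-- The Vandermonde identity on the simplex `∑ xᵢ = n`. -/
theorem sum_prod_binomFactor (n : ℕ) : ∀ x : ι → ℝ, ∑ i, x i = n →
    ∑ α ∈ Finset.piAntidiag Finset.univ n, ∏ j, binomFactor (x j) (α j) = 1 := by
  induction n with
  | zero => intro x _; simp [binomFactor]
  | succ n ih =>
    intro x hx
    -- As `∑ αᵢ = n + 1`, the sum times `n + 1` splits into the sums weighted with `αᵢ`.
    have h1 : ((n : ℝ) + 1) * ∑ α ∈ Finset.piAntidiag Finset.univ (n + 1),
        ∏ j, binomFactor (x j) (α j) = ∑ i, x i := by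
      have h2 : ∀ i, x i = ∑ α ∈ Finset.piAntidiag Finset.univ (n + 1),
          (∏ j, binomFactor (x j) (α j)) * (α i * 1) := fun i => by
        rw [sum_binomFactor_mul n i x fun _ => 1]
        simp only [mul_one]
        rw [ih, mul_one]
        rw [Finset.sum_update_of_mem (Finset.mem_univ i)]
        rw [← Finset.sum_erase_add _ _ (Finset.mem_univ i), Finset.erase_eq] at hx
        push_cast at hx
        linarith
      conv_rhs => rw [Finset.sum_congr rfl fun i _ => h2 i]
      rw [Finset.sum_comm, Finset.mul_sum]
      refine Finset.sum_congr rfl fun α hα => ?_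
      have := (Finset.mem_piAntidiag.1 hα).1
      rw [← Finset.mul_sum]
      simp only [mul_one]
      rw [← Nat.cast_sum, this]
      push_cast
      ring
    rw [hx] at h1
    push_cast at h1
    exact mul_left_cancel₀ (by positivity : ((n : ℝ) + 1) ≠ 0) (by rw [h1, mul_one])

/-- Lattice interpolation reproduces products of at most `n` affine coordinate functions. -/
theorem sum_binomFactor_affine (N : ℕ) : ∀ (l : List (ι × ℝ)), l.length = N → ∀ (n : ℕ)
    (x : ι → ℝ), N ≤ n → ∑ i, x i = n →
    ∑ α ∈ Finset.piAntidiag Finset.univ n, (∏ j, binomFactor (x j) (α j)) *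
      (l.map fun p => (α p.1 : ℝ) + p.2).prod = (l.map fun p => x p.1 + p.2).prod := by
  induction N with
  | zero =>
    intro l hl n x _ hx
    rw [List.length_eq_zero_iff.1 hl]
    simpa using sum_prod_binomFactor n x hx
  | succ N ih =>
    intro l hl n x hn hx
    obtain ⟨⟨i, c⟩, l, rfl⟩ := List.exists_cons_of_length_eq_add_one hl
    simp only [List.length_cons, Nat.add_right_cancel_iff] at hl
    obtain ⟨n, rfl⟩ : ∃ n', n = n' + 1 := ⟨n - 1, by omega⟩
    -- The factor `αᵢ + c` is split into `c`, handled on the same lattice, and `αᵢ`, which leads to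
    -- the lattice of the next lower degree with shifted constants.
    have h1 := ih l hl (n + 1) x (by omega) hx
    have h2 := ih (l.map fun p => (p.1, p.2 + if p.1 = i then 1 else 0)) (by simpa using hl) n
      (Function.update x i (x i - 1)) (by omega) (by
        rw [Finset.sum_update_of_mem (Finset.mem_univ i)]
        rw [← Finset.sum_erase_add _ _ (Finset.mem_univ i), Finset.erase_eq] at hx
        push_cast at hx
        linarith)
    have h3 := sum_binomFactor_mul n i x fun α => (l.map fun p => (α p.1 : ℝ) + p.2).prod
    have h4 : ∀ β : ι → ℕ,
        (l.map fun p => ((Function.update β i (β i + 1) p.1 : ℕ) : ℝ) + p.2).prod =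
        ((l.map fun p => (p.1, p.2 + if p.1 = i then 1 else 0)).map
          fun p => (β p.1 : ℝ) + p.2).prod := fun β => by
      rw [List.map_map]
      congr 1
      refine List.map_congr_left fun p _ => ?_
      by_cases hp : p.1 = i
      · simp [hp]; ring
      · simp [hp]
    have h5 : ((l.map fun p => (p.1, p.2 + if p.1 = i then 1 else 0)).map
          fun p => Function.update x i (x i - 1) p.1 + p.2).prod =
        (l.map fun p => x p.1 + p.2).prod := by
      rw [List.map_map]
      congr 1
      refine List.map_congr_left fun p _ => ?_
      by_cases hp : p.1 = i
      · simp [hp]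
      · simp [hp]
    simp only [h4] at h3
    rw [h2, h5] at h3
    simp only [List.map_cons, List.prod_cons]
    rw [add_mul (x i), ← h3, ← h1, Finset.mul_sum, ← Finset.sum_add_distrib]
    exact Finset.sum_congr rfl fun α _ => by ring

end Lattice

section Interpolation

variable {m : ℕ}

/-- The reference coordinates of the lattice node `α / k`. -/
noncomputable def latticePoint (m k : ℕ) (α : Fin (m + 1) → ℕ) : EuclideanSpace ℝ (Fin m) :=
  WithLp.toLp 2 fun i => (α i.succ : ℝ) / k

/-- The product of the coordinates in the list `l`. -/
noncomputable def coordMonomial (l : List (Fin m)) (ξ : EuclideanSpace ℝ (Fin m)) : ℝ :=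
  (l.map fun i => ξ i).prod

theorem sum_bary (ξ : EuclideanSpace ℝ (Fin m)) : ∑ i, bary ξ i = 1 := by
  rw [Fin.sum_univ_succ]; simp [bary]

theorem lagrange_eq_prod_binomFactor (k : ℕ) (α : Fin (m + 1) → ℕ) (b : Fin (m + 1) → ℝ) :
    lagrange k α b = ∏ i, binomFactor (k * b i) (α i) := rfl

theorem contDiff_lagrange (k : ℕ) (α : Fin (m + 1) → ℕ) :
    ContDiff ℝ ∞ fun ξ : EuclideanSpace ℝ (Fin m) => lagrange k α (bary ξ) := by
  have hb : ∀ i, ContDiff ℝ ∞ fun ξ : EuclideanSpace ℝ (Fin m) => bary ξ i := by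
    refine Fin.cases ?_ fun i => ?_
    · simp only [bary, Fin.cons_zero]
      fun_prop
    · simp only [bary, Fin.cons_succ]
      fun_prop
  unfold lagrange
  refine contDiff_prod fun i _ => contDiff_prod fun s _ => ?_
  exact ((contDiff_const.mul (hb i)).sub contDiff_const).div_const _

/-- Interpolation of degree `k` reproduces monomials of degree at most `k`. -/
theorem sum_lagrange_coordMonomial {k : ℕ} (hk : 1 ≤ k) (l : List (Fin m)) (hl : l.length ≤ k)
    (ξ : EuclideanSpace ℝ (Fin m)) :
    ∑ α ∈ Finset.piAntidiag Finset.univ k,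
      lagrange k α (bary ξ) * coordMonomial l (latticePoint m k α) = coordMonomial l ξ := by
  have hk0 : (k : ℝ) ≠ 0 := by positivity
  have h := sum_binomFactor_affine l.length (l.map fun i => (i.succ, (0 : ℝ))) (by simp) k
    (fun i => k * bary ξ i) hl (by rw [← Finset.mul_sum, sum_bary, mul_one])
  have h1 : ∀ (c : ℝ) (f : Fin m → ℝ) (l : List (Fin m)),
      (l.map fun i => c * f i).prod = c ^ l.length * (l.map f).prod := fun c f l => by
    induction l with
    | nil => simp
    | cons a l ih => simp only [List.map_cons, List.prod_cons, ih, List.length_cons]; ring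
  have h2 : ((l.map fun i => (i.succ, (0 : ℝ))).map fun p => k * bary ξ p.1 + p.2).prod =
      k ^ l.length * coordMonomial l ξ := by
    rw [coordMonomial, ← h1, List.map_map]
    congr 1
    refine List.map_congr_left fun i _ => by simp [bary]
  have h3 : ∀ α : Fin (m + 1) → ℕ,
      ((l.map fun i => (i.succ, (0 : ℝ))).map fun p => (α p.1 : ℝ) + p.2).prod =
      k ^ l.length * coordMonomial l (latticePoint m k α) := fun α => by
    rw [coordMonomial, ← h1, List.map_map]
    congr 1
    refine List.map_congr_left fun i _ => ?_
    simp [latticePoint, mul_div_cancel₀ _ hk0]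
  rw [h2] at h
  simp only [h3] at h
  refine mul_left_cancel₀ (pow_ne_zero l.length hk0) ?_
  rw [← h, Finset.mul_sum]
  refine Finset.sum_congr rfl fun α _ => ?_
  rw [lagrange_eq_prod_binomFactor]
  ring

/-- The interpolation error of `mono(ξ) Ψ(z, r ξ)`: each degree of the monomial, up to the degree
of interpolation, accounts for one power of `r` less. -/
theorem exists_interpolation_remainder_aux {k : ℕ} (hk : 1 ≤ k) {Z G : Type}
    [NormedAddCommGroup Z] [NormedSpace ℝ Z] [FiniteDimensional ℝ Z] [NormedAddCommGroup G]
    [NormedSpace ℝ G] [CompleteSpace G] (j : ℕ) : ∀ (l : List (Fin m)), l.length + j = k + 1 →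
    ∀ Ψ : Z × EuclideanSpace ℝ (Fin m) → G, ContDiff ℝ ∞ Ψ →
    ∃ R : Z × ℝ × EuclideanSpace ℝ (Fin m) → G, ContDiff ℝ ∞ R ∧ ∀ z r ξ,
      coordMonomial l ξ • Ψ (z, r • ξ) - ∑ α ∈ Finset.piAntidiag Finset.univ k,
        lagrange k α (bary ξ) • coordMonomial l (latticePoint m k α) •
          Ψ (z, r • latticePoint m k α) = r ^ j • R (z, r, ξ) := by
  have hmono : ∀ l : List (Fin m), ContDiff ℝ ∞ (coordMonomial l) := fun l => by
    unfold coordMonomial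
    induction l with
    | nil => simpa using contDiff_const
    | cons i l ih =>
      simp only [List.map_cons, List.prod_cons]
      exact ContDiff.mul (by fun_prop) ih
  induction j with
  | zero =>
    intro l _ Ψ hΨ
    refine ⟨fun y => coordMonomial l y.2.2 • Ψ (y.1, y.2.1 • y.2.2) -
      ∑ α ∈ Finset.piAntidiag Finset.univ k, lagrange k α (bary y.2.2) •
        coordMonomial l (latticePoint m k α) • Ψ (y.1, y.2.1 • latticePoint m k α), ?_,
      fun z r ξ => by simp⟩
    refine ContDiff.sub (((hmono l).comp (by fun_prop)).smul (hΨ.comp (by fun_prop)))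
      (ContDiff.sum fun α _ => ?_)
    exact ((contDiff_lagrange k α).comp (by fun_prop)).smul
      (contDiff_const.smul (hΨ.comp (by fun_prop)))
  | succ j ih =>
    intro l hl Ψ hΨ
    -- Write `Ψ(z, rξ) = Ψ(z, 0) + r ∑ᵢ ξᵢ Aᵢ(z, rξ)`. The first term is reproduced by the
    -- interpolation, and the others have one more coordinate factor.
    obtain ⟨A, hA, hΨA, -⟩ := exists_hadamard_quotient hΨ
    have hex := fun i : Fin m => ih (i :: l) (by simp only [List.length_cons]; omega)
      (fun y => A y (EuclideanSpace.single i 1)) (hA.clm_apply contDiff_const)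
    choose R hR hRe using hex
    refine ⟨fun y => ∑ i, R i y, ContDiff.sum fun i _ => hR i, fun z r ξ => ?_⟩
    have hbasis : ∀ η : EuclideanSpace ℝ (Fin m),
        ∑ i, η i • EuclideanSpace.single i (1 : ℝ) = η := fun η => by
      simpa using (EuclideanSpace.basisFun (Fin m) ℝ).sum_repr η
    have hexp : ∀ η : EuclideanSpace ℝ (Fin m), Ψ (z, r • η) =
        Ψ (z, 0) + r • ∑ i, η i • A (z, r • η) (EuclideanSpace.single i 1) := fun η => by
      rw [hΨA z (r • η), map_smul]
      congr 2
      calc A (z, r • η) η = A (z, r • η) (∑ i, η i • EuclideanSpace.single i (1 : ℝ)) := by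
            rw [hbasis]
        _ = _ := by simp only [map_sum, map_smul]
    have hcons : ∀ (i : Fin m) (η : EuclideanSpace ℝ (Fin m)),
        coordMonomial (i :: l) η = coordMonomial l η * η i := fun i η => by
      simp [coordMonomial, mul_comm]
    have e0 : coordMonomial l ξ • Ψ (z, 0) = ∑ α ∈ Finset.piAntidiag Finset.univ k,
        lagrange k α (bary ξ) • coordMonomial l (latticePoint m k α) • Ψ (z, 0) := by
      simp_rw [smul_smul]
      rw [← Finset.sum_smul, sum_lagrange_coordMonomial hk l (by omega)]
    have e1 : r ^ j • ∑ i, R i (z, r, ξ) =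
        coordMonomial l ξ • ∑ i, ξ i • A (z, r • ξ) (EuclideanSpace.single i 1) -
        ∑ α ∈ Finset.piAntidiag Finset.univ k, lagrange k α (bary ξ) •
          coordMonomial l (latticePoint m k α) • ∑ i, latticePoint m k α i •
            A (z, r • latticePoint m k α) (EuclideanSpace.single i 1) := by
      simp_rw [Finset.smul_sum, ← hRe, hcons, mul_smul, Finset.sum_sub_distrib]
      rw [Finset.sum_comm]
    rw [pow_succ', mul_smul, e1]
    simp_rw [hexp, smul_add, Finset.sum_add_distrib]
    rw [e0, add_sub_add_left_eq_sub, smul_sub, smul_comm r (coordMonomial l ξ)]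
    congr 1
    rw [Finset.smul_sum]
    exact Finset.sum_congr rfl fun α _ => by
      rw [smul_comm r (lagrange k α (bary ξ)), smul_comm r (coordMonomial l (latticePoint m k α))]

/-- The error of Lagrange interpolation of degree `k` on a simplex of size `r` is `r ^ (k + 1)`
times a smooth function of all parameters, including `r`. -/
theorem exists_interpolation_remainder {k : ℕ} (hk : 1 ≤ k) {Z G : Type}
    [NormedAddCommGroup Z] [NormedSpace ℝ Z] [FiniteDimensional ℝ Z] [NormedAddCommGroup G]
    [NormedSpace ℝ G] [CompleteSpace G] {Ψ : Z × EuclideanSpace ℝ (Fin m) → G}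
    (hΨ : ContDiff ℝ ∞ Ψ) :
    ∃ R : Z × ℝ × EuclideanSpace ℝ (Fin m) → G, ContDiff ℝ ∞ R ∧ ∀ z r ξ,
      Ψ (z, r • ξ) - ∑ α ∈ Finset.piAntidiag Finset.univ k,
        lagrange k α (bary ξ) • Ψ (z, r • latticePoint m k α) = r ^ (k + 1) • R (z, r, ξ) := by
  obtain ⟨R, hR, h⟩ := exists_interpolation_remainder_aux hk (k + 1) [] (by simp) Ψ hΨ
  exact ⟨R, hR, fun z r ξ => by simpa [coordMonomial] using h z r ξ⟩

end Interpolation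

/-! ### Flat simplices in scaled coordinates -/

/-- The linear map sending the reference simplex to the simplex `v`, translated to the origin and
scaled by `r⁻¹`. -/
noncomputable def edgeMap {m : ℕ} (v : Fin (m + 1) → Amb m) (r : ℝ) :
    EuclideanSpace ℝ (Fin m) →L[ℝ] Amb m :=
  ∑ i : Fin m, (EuclideanSpace.proj i : EuclideanSpace ℝ (Fin m) →L[ℝ] ℝ).smulRight
    (r⁻¹ • (v i.succ - v 0))

theorem edgeMap_apply {m : ℕ} (v : Fin (m + 1) → Amb m) (r : ℝ) (ξ : EuclideanSpace ℝ (Fin m)) :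
    edgeMap v r ξ = ∑ i : Fin m, ξ i • r⁻¹ • (v i.succ - v 0) := by
  simp [edgeMap]

theorem edgeMap_single {m : ℕ} (v : Fin (m + 1) → Amb m) (r : ℝ) (i : Fin m) :
    edgeMap v r (EuclideanSpace.single i 1) = r⁻¹ • (v i.succ - v 0) := by
  rw [edgeMap_apply, Finset.sum_eq_single i] <;> simp +contextual

theorem sum_smul_eq_edgeMap {m : ℕ} (v : Fin (m + 1) → Amb m) {r : ℝ} (hr : r ≠ 0)
    (w : Fin (m + 1) → ℝ) (hw : ∑ i, w i = 1) :
    ∑ i, w i • v i = v 0 + edgeMap v r (r • WithLp.toLp 2 fun i : Fin m => w i.succ) := by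
  rw [map_smul, edgeMap_apply, Fin.sum_univ_succ]
  have h0 : w 0 = 1 - ∑ i : Fin m, w i.succ := by
    rw [← hw, Fin.sum_univ_succ]; ring
  rw [h0, sub_smul, one_smul, Finset.smul_sum, Finset.sum_smul, sub_add, ← Finset.sum_sub_distrib,
    sub_eq_add_neg, ← Finset.sum_neg_distrib]
  congr 1
  refine Finset.sum_congr rfl fun i _ => ?_
  rw [smul_comm r, smul_smul r, mul_inv_cancel₀ hr]
  simp only [one_smul]
  module

theorem edgeMap_eq_zero {m : ℕ} {v : Fin (m + 1) → Amb m} (hv : AffineIndependent ℝ v) {r : ℝ}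
    (hr : r ≠ 0) {ξ : EuclideanSpace ℝ (Fin m)} (h : edgeMap v r ξ = 0) : ξ = 0 := by
  rw [affineIndependent_iff_linearIndependent_vsub ℝ v 0] at hv
  have hli : LinearIndependent ℝ fun i : Fin m => v i.succ - v 0 :=
    hv.comp (fun i : Fin m => (⟨i.succ, Fin.succ_ne_zero i⟩ : {x // x ≠ (0 : Fin (m + 1))}))
      fun i j hij => by simpa using hij
  rw [Fintype.linearIndependent_iff] at hli
  ext i
  refine hli (fun i => ξ i) ?_ i
  have h2 : r • edgeMap v r ξ = 0 := by rw [h, smul_zero]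
  rw [edgeMap_apply, Finset.smul_sum] at h2
  rw [← h2]
  refine Finset.sum_congr rfl fun i _ => ?_
  rw [smul_comm r, smul_smul r, mul_inv_cancel₀ hr, one_smul]

theorem exists_edgeMap_of_mem_convexHull {m : ℕ} {v : Fin (m + 1) → Amb m} {r : ℝ} (hr : r ≠ 0)
    {x : Amb m} (hx : x ∈ convexHull ℝ (Set.range v)) :
    ∃ β : EuclideanSpace ℝ (Fin m), x = v 0 + edgeMap v r (r • β) ∧ ∀ i, β i ∈ Set.Icc (0 : ℝ) 1 := by
  rw [convexHull_range_eq_exists_affineCombination] at hx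
  obtain ⟨s, w, hw0, hw1, rfl⟩ := hx
  set w' : Fin (m + 1) → ℝ := fun i => if i ∈ s then w i else 0 with hw'
  have hsum : ∑ i, w' i = 1 := by
    rw [← hw1]; simp [hw']
  have hnn : ∀ i, 0 ≤ w' i := fun i => by
    simp only [hw']; split_ifs with hi
    · exact hw0 i hi
    · exact le_rfl
  refine ⟨WithLp.toLp 2 fun i => w' i.succ, ?_, fun i => ⟨hnn _, ?_⟩⟩
  · rw [← sum_smul_eq_edgeMap v hr w' hsum, s.affineCombination_eq_linear_combination v w hw1]
    simp [hw']
  · rw [← hsum]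
    exact Finset.single_le_sum (fun j _ => hnn j) (Finset.mem_univ i.succ)

/-- A simplex that contains a ball of radius `r / σ` has, after scaling by `r⁻¹`, barycentric
coordinates that are Lipschitz with constant `σ / 2`. -/
theorem le_norm_edgeMap {m : ℕ} {v : Fin (m + 1) → Amb m} (hv : AffineIndependent ℝ v) {r σ : ℝ}
    (hr : 0 < r) (hσ : 0 < σ) {x₀ : Amb m} (hx₀ : x₀ ∈ affineSpan ℝ (Set.range v))
    (hball : ∀ x ∈ affineSpan ℝ (Set.range v), dist x x₀ ≤ r / σ → x ∈ convexHull ℝ (Set.range v))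
    (ξ : EuclideanSpace ℝ (Fin m)) (i : Fin m) : 2 / σ * |ξ i| ≤ ‖edgeMap v r ξ‖ := by
  by_cases hw0 : edgeMap v r ξ = 0
  · rw [edgeMap_eq_zero hv hr.ne' hw0]; simp
  have hn : 0 < ‖edgeMap v r ξ‖ := norm_pos_iff.2 hw0
  -- The segment through the centre of the ball in the direction of `W ξ`, of length `2 r / σ`, lies
  -- in the simplex, on which every barycentric coordinate varies by at most `1`.
  have hdir : ∀ s : ℝ, x₀ + s • edgeMap v r ξ ∈ affineSpan ℝ (Set.range v) := fun s => by
    have h1 : edgeMap v r ξ ∈ (affineSpan ℝ (Set.range v)).direction := by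
      rw [direction_affineSpan, edgeMap_apply]
      refine Submodule.sum_mem _ fun i _ => Submodule.smul_mem _ _ (Submodule.smul_mem _ _ ?_)
      exact vsub_mem_vectorSpan ℝ ⟨_, rfl⟩ ⟨_, rfl⟩
    rw [add_comm x₀]
    exact AffineSubspace.vadd_mem_of_mem_direction (Submodule.smul_mem _ s h1) hx₀
  have hmem : ∀ s : ℝ, |s| ≤ r / σ / ‖edgeMap v r ξ‖ →
      x₀ + s • edgeMap v r ξ ∈ convexHull ℝ (Set.range v) := fun s hs => by
    refine hball _ (hdir s) ?_
    rw [dist_eq_norm, add_sub_cancel_left, norm_smul, Real.norm_eq_abs]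
    rwa [le_div_iff₀ hn] at hs
  set s : ℝ := r / σ / ‖edgeMap v r ξ‖ with hs
  have hs0 : 0 ≤ s := by positivity
  obtain ⟨β, hβ, hβ1⟩ := exists_edgeMap_of_mem_convexHull hr.ne' (hmem s (abs_of_nonneg hs0).le)
  obtain ⟨γ, hγ, hγ1⟩ := exists_edgeMap_of_mem_convexHull hr.ne'
    (hmem (-s) (by rw [abs_neg, abs_of_nonneg hs0]))
  have h1 : edgeMap v r (r • β - r • γ - (2 * s) • ξ) = 0 := by
    rw [map_sub, map_sub, map_smul _ (2 * s)]
    have h2 : edgeMap v r (r • β) = x₀ + s • edgeMap v r ξ - v 0 := by rw [hβ]; abel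
    have h3 : edgeMap v r (r • γ) = x₀ + (-s) • edgeMap v r ξ - v 0 := by rw [hγ]; abel
    rw [h2, h3]
    module
  have h4 := congrArg (fun η : EuclideanSpace ℝ (Fin m) => η i) (edgeMap_eq_zero hv hr.ne' h1)
  simp only [PiLp.sub_apply, PiLp.smul_apply, smul_eq_mul, PiLp.zero_apply] at h4
  have h5 : 2 * s * |ξ i| ≤ r := by
    have h6 : 2 * s * ξ i = r * (β i - γ i) := by linarith
    have h7 : 2 * s * |ξ i| = |2 * s * ξ i| := by
      rw [abs_mul, abs_of_nonneg (by positivity : 0 ≤ 2 * s)]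
    rw [h7, h6, abs_mul, abs_of_pos hr]
    have h8 : |β i - γ i| ≤ 1 := by
      rw [abs_le]; constructor <;> linarith [(hβ1 i).1, (hβ1 i).2, (hγ1 i).1, (hγ1 i).2]
    nlinarith
  have h9 : 2 * s * |ξ i| = r * (2 / σ * |ξ i| / ‖edgeMap v r ξ‖) := by
    rw [hs]; field_simp
  rw [h9] at h5
  have h10 : 2 / σ * |ξ i| / ‖edgeMap v r ξ‖ ≤ 1 := by
    by_contra hcon
    push Not at hcon
    nlinarith
  rwa [div_le_one hn] at h10

theorem norm_edgeMap_le {m : ℕ} {v : Fin (m + 1) → Amb m} {r : ℝ} (hr : 0 < r)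
    (hd : ∀ i j, dist (v i) (v j) ≤ r) : ‖edgeMap v r‖ ≤ m := by
  refine ContinuousLinearMap.opNorm_le_bound _ (by positivity) fun ξ => ?_
  rw [edgeMap_apply]
  refine (norm_sum_le _ _).trans ?_
  have : ∀ i ∈ (Finset.univ : Finset (Fin m)), ‖ξ i • r⁻¹ • (v i.succ - v 0)‖ ≤ ‖ξ‖ := fun i _ => by
    have h1 : ‖v i.succ - v 0‖ ≤ r := by rw [← dist_eq_norm]; exact hd _ _
    rw [norm_smul, norm_smul, norm_inv, Real.norm_of_nonneg hr.le]
    have h2 : r⁻¹ * ‖v i.succ - v 0‖ ≤ 1 := by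
      rw [inv_mul_le_iff₀ hr]; linarith
    have h3 : ‖ξ i‖ ≤ ‖ξ‖ := PiLp.norm_apply_le ξ i
    calc ‖ξ i‖ * (r⁻¹ * ‖v i.succ - v 0‖) ≤ ‖ξ i‖ * 1 := by gcongr
      _ ≤ ‖ξ‖ := by linarith
  refine (Finset.sum_le_card_nsmul _ _ _ this).trans ?_
  simp

theorem isCompact_refSimplex (m : ℕ) : IsCompact (refSimplex m) := by
  refine Metric.isCompact_of_isClosed_isBounded ?_ ?_
  · have h1 : IsClosed {ξ : EuclideanSpace ℝ (Fin m) | ∀ i, 0 ≤ ξ i} := by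
      simp only [Set.ofPred_forall]
      exact isClosed_iInter fun i => isClosed_le continuous_const (by fun_prop)
    have h2 : IsClosed {ξ : EuclideanSpace ℝ (Fin m) | ∑ i, ξ i ≤ 1} :=
      isClosed_le (by fun_prop) continuous_const
    exact h1.inter h2
  · refine (Metric.isBounded_closedBall (x := (0 : EuclideanSpace ℝ (Fin m)))
      (r := Real.sqrt m)).subset fun ξ hξ => ?_
    rw [mem_closedBall_zero_iff, EuclideanSpace.norm_eq]
    refine Real.sqrt_le_sqrt ?_
    have : ∀ i ∈ (Finset.univ : Finset (Fin m)), ‖ξ i‖ ^ 2 ≤ 1 := fun i _ => by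
      have h1 : ξ i ≤ ∑ j, ξ j := Finset.single_le_sum (fun j _ => hξ.1 j) (Finset.mem_univ i)
      have h2 := hξ.1 i
      rw [Real.norm_of_nonneg h2]
      nlinarith [hξ.2]
    simpa using Finset.sum_le_card_nsmul _ _ _ this

namespace InitialTriangulation

variable {m : ℕ} {S : EvolvingSurface m} (𝒯 : InitialTriangulation S)

theorem continuous_param (k : ℕ) (e : Fin 𝒯.N) (t : ℝ) :
    Continuous fun ξ => 𝒯.param k e ξ t := by
  unfold param
  exact continuous_finsetSum _ fun α _ =>
    (contDiff_lagrange k α).continuous.smul continuous_const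

/-- The reference coordinates of the `i`-th vertex. -/
theorem exists_bary_eq_single (i : Fin (m + 1)) :
    ∃ ξ ∈ refSimplex m, bary ξ = Pi.single i 1 := by
  refine Fin.cases ?_ (fun j => ?_) i
  · refine ⟨0, ⟨fun i => by simp, by simp⟩, ?_⟩
    funext l
    refine Fin.cases ?_ (fun l => ?_) l <;> simp [bary]
  · refine ⟨EuclideanSpace.single j 1, ⟨fun i => ?_, by simp⟩, ?_⟩
    · by_cases h : i = j <;> simp [h]
    · funext l
      refine Fin.cases ?_ (fun l => ?_) l
      · simp [bary]
      · by_cases h : l = j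
        · subst h; simp [bary]
        · simp [bary, h]

theorem vert_mem_element {k : ℕ} (hk : 1 ≤ k) (e : Fin 𝒯.N) (i : Fin (m + 1)) :
    𝒯.vert e i ∈ 𝒯.element k e 0 := by
  have hk0 : (k : ℝ) ≠ 0 := by positivity
  obtain ⟨ξ, hξ, hb⟩ := exists_bary_eq_single i
  refine ⟨ξ, hξ, ?_⟩
  have hb' : bary ξ = fun j => ((Pi.single i k : Fin (m + 1) → ℕ) j : ℝ) / k := by
    rw [hb]
    funext j
    by_cases h : j = i
    · subst h; simp [hk0]
    · simp [h]
  have hsum : ∑ j, (Pi.single i k : Fin (m + 1) → ℕ) j = k := by simp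
  simp only [param]
  rw [hb', Finset.sum_eq_single (Pi.single i k)]
  · rw [lagrange_node hk _ _ hsum hsum, if_pos rfl, one_smul]
    have hv : S.φ (𝒯.vert e i, 0) = 0 := 𝒯.vert_mem e i
    have h1 : ∑ j, (((Pi.single i k : Fin (m + 1) → ℕ) j : ℝ) / k) • 𝒯.vert e j
        = 𝒯.vert e i := by
      rw [Finset.sum_eq_single i]
      · simp [hk0]
      · intro j _ hj; simp [hj]
      · simp
    have h2 : S.proj (𝒯.vert e i) 0 = 𝒯.vert e i := by
      simp [EvolvingSurface.proj, EvolvingSurface.d, hv]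
    rw [node, h1, h2, S.X_zero _ hv]
  · intro α hα hne
    rw [lagrange_node hk _ _ (Finset.mem_piAntidiag.1 hα).1 hsum, if_neg hne, zero_smul]
  · intro h
    exact absurd (Finset.mem_piAntidiag.2 ⟨hsum, fun _ _ => Finset.mem_univ _⟩) h

/-- The diameter of the flat element, which is the scale of all constructions. -/
noncomputable def flatDiam (e : Fin 𝒯.N) : ℝ := Metric.diam (convexHull ℝ (Set.range (𝒯.vert e)))

theorem dist_vert_le_flatDiam (e : Fin 𝒯.N) (i j : Fin (m + 1)) :
    dist (𝒯.vert e i) (𝒯.vert e j) ≤ 𝒯.flatDiam e := by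
  rw [flatDiam, convexHull_diam]
  exact Metric.dist_le_diam_of_mem (Set.finite_range _).isBounded ⟨i, rfl⟩ ⟨j, rfl⟩

theorem flatDiam_pos (hm : 1 ≤ m) (e : Fin 𝒯.N) : 0 < 𝒯.flatDiam e := by
  obtain ⟨n, rfl⟩ : ∃ n, m = n + 1 := ⟨m - 1, by omega⟩
  refine (dist_pos.2 fun h => ?_).trans_le (𝒯.dist_vert_le_flatDiam e 0 1)
  exact absurd ((𝒯.indep e).injective h) (by simp)

/-- The flat diameter is at most the mesh size, since the curved element at time `0` contains the
vertices. -/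
theorem flatDiam_le {k : ℕ} (hk : 1 ≤ k) {h : ℝ} (hh : 𝒯.MeshSizeLE k h) (e : Fin 𝒯.N) :
    𝒯.flatDiam e ≤ h := by
  have hd := hh 0 ⟨le_rfl, S.T_pos.le⟩ e
  have hb : Bornology.IsBounded (𝒯.element k e 0) :=
    ((isCompact_refSimplex m).image (𝒯.continuous_param k e 0)).isBounded
  rw [flatDiam, convexHull_diam]
  refine Metric.diam_le_of_forall_dist_le (Metric.diam_nonneg.trans hd) ?_
  rintro _ ⟨i, rfl⟩ _ ⟨j, rfl⟩
  exact (Metric.dist_le_diam_of_mem hb (𝒯.vert_mem_element hk e i)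
    (𝒯.vert_mem_element hk e j)).trans hd

end InitialTriangulation

/-! ### Gram operators and orthogonal projections -/

theorem span_singleton_orthogonal_eq_range {E V : Type*} [NormedAddCommGroup E]
    [InnerProductSpace ℝ E] [NormedAddCommGroup V] [InnerProductSpace ℝ V] [FiniteDimensional ℝ V]
    {n : V} (hn : n ≠ 0) {L : E →L[ℝ] V}
    (hL : Function.Injective L) (hLn : ∀ x, ⟪n, L x⟫ = 0)
    (hdim : Module.finrank ℝ V = Module.finrank ℝ E + 1) :
    (Submodule.span ℝ {n})ᗮ = LinearMap.range L.toLinearMap := by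
  symm
  refine Submodule.eq_of_le_of_finrank_eq ?_ ?_
  · rintro _ ⟨x, rfl⟩
    rw [Submodule.mem_orthogonal_singleton_iff_inner_right]
    exact hLn x
  · have h1 := (Submodule.span ℝ {n}).finrank_add_finrank_orthogonal
    rw [finrank_span_singleton hn] at h1
    rw [LinearMap.finrank_range_of_inj (f := L.toLinearMap) hL]
    omega

section Gram

variable {E V : Type*} [NormedAddCommGroup E] [InnerProductSpace ℝ E] [FiniteDimensional ℝ E]
  [NormedAddCommGroup V] [InnerProductSpace ℝ V] [FiniteDimensional ℝ V]

/-- The adjoint as a real-linear map. -/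
noncomputable def adjMap (E V : Type*) [NormedAddCommGroup E] [InnerProductSpace ℝ E]
    [FiniteDimensional ℝ E] [NormedAddCommGroup V] [InnerProductSpace ℝ V]
    [FiniteDimensional ℝ V] [CompleteSpace E] [CompleteSpace V] : (E →L[ℝ] V) →L[ℝ] (V →L[ℝ] E) :=
  LinearMap.toContinuousLinearMap
    { toFun := fun L => ContinuousLinearMap.adjoint L
      map_add' := fun _ _ => map_add _ _ _
      map_smul' := fun c L => by simp }

variable [CompleteSpace E] [CompleteSpace V]

theorem inner_adjMap_left (L : E →L[ℝ] V) (x : E) (y : V) : ⟪adjMap E V L y, x⟫ = ⟪y, L x⟫ :=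
  ContinuousLinearMap.adjoint_inner_left L x y

theorem adjMap_comp (T : V →L[ℝ] V) (hT : ∀ x y, ⟪T x, y⟫ = ⟪x, T y⟫) (L : E →L[ℝ] V) :
    adjMap E V (T ∘L L) = adjMap E V L ∘L T := by
  ext1 y
  refine ext_inner_right ℝ fun x => ?_
  rw [inner_adjMap_left, ContinuousLinearMap.comp_apply, ContinuousLinearMap.comp_apply,
    inner_adjMap_left, hT]

/-- The Gram operator `Lᵀ L`. -/
noncomputable def gramOp (L : E →L[ℝ] V) : E →L[ℝ] E := adjMap E V L ∘L L

theorem isUnit_gramOp {L : E →L[ℝ] V} (hL : Function.Injective L) : IsUnit (gramOp L) := by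
  have hinj : Function.Injective (gramOp L) := by
    rw [injective_iff_map_eq_zero]
    intro x hx
    have h : ⟪gramOp L x, x⟫ = 0 := by rw [hx, inner_zero_left]
    rw [gramOp, ContinuousLinearMap.comp_apply, inner_adjMap_left, inner_self_eq_zero] at h
    exact hL (by rw [h, map_zero])
  rw [ContinuousLinearMap.isUnit_iff_bijective]
  exact ⟨hinj, LinearMap.surjective_of_injective (f := (gramOp L).toLinearMap) hinj⟩

/-- `L (Lᵀ L)⁻¹ Lᵀ`, the orthogonal projection onto the range of an injective `L`. -/
noncomputable def rangeProj (L : E →L[ℝ] V) : V →L[ℝ] V :=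
  L ∘L Ring.inverse (gramOp L) ∘L adjMap E V L

theorem rangeProj_eq_starProjection {L : E →L[ℝ] V} (hL : Function.Injective L)
    {W : Submodule ℝ V} (hW : W = LinearMap.range L.toLinearMap) [W.HasOrthogonalProjection] :
    rangeProj L = W.starProjection := by
  ext1 y
  refine (Submodule.eq_starProjection_of_mem_of_inner_eq_zero (K := W) ?_ fun w hw => ?_).symm
  · rw [hW]
    exact ⟨_, rfl⟩
  · rw [hW] at hw
    obtain ⟨x, rfl⟩ := hw
    have h1 : gramOp L (Ring.inverse (gramOp L) (adjMap E V L y)) = adjMap E V L y := by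
      have := DFunLike.congr_fun (Ring.mul_inverse_cancel _ (isUnit_gramOp hL)) (adjMap E V L y)
      simpa using this
    have h2 : ⟪rangeProj L y, L x⟫ = ⟪y, L x⟫ := by
      rw [← inner_adjMap_left, ← inner_adjMap_left]
      congr 1
    rw [inner_sub_left]
    change ⟪y, L x⟫ - ⟪rangeProj L y, L x⟫ = 0
    rw [h2, sub_self]

end Gram

section GramDet

variable {m : ℕ}

/-- The Gram determinant, the square of the area element. -/
noncomputable def gramDet (L : EuclideanSpace ℝ (Fin m) →L[ℝ] Amb m) : ℝ :=
  (Matrix.of fun i j : Fin m =>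
    ⟪L (EuclideanSpace.single i 1), L (EuclideanSpace.single j 1)⟫).det

theorem areaElement_eq_sqrt_gramDet (L : EuclideanSpace ℝ (Fin m) →L[ℝ] Amb m) :
    InitialTriangulation.areaElement L = Real.sqrt (gramDet L) := rfl

theorem gramDet_eq_det_gram (L : EuclideanSpace ℝ (Fin m) →L[ℝ] Amb m) :
    gramDet L = (Matrix.gram ℝ fun i : Fin m => L (EuclideanSpace.single i 1)).det := rfl

theorem map_eq_sum_single (L : EuclideanSpace ℝ (Fin m) →L[ℝ] Amb m)
    (ξ : EuclideanSpace ℝ (Fin m)) : L ξ = ∑ i, ξ i • L (EuclideanSpace.single i 1) := by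
  have : ∑ i, ξ i • EuclideanSpace.single i (1 : ℝ) = ξ := by
    simpa using (EuclideanSpace.basisFun (Fin m) ℝ).sum_repr ξ
  conv_lhs => rw [← this]
  simp only [map_sum, map_smul]

theorem gramDet_pos_iff {L : EuclideanSpace ℝ (Fin m) →L[ℝ] Amb m} :
    0 < gramDet L ↔ Function.Injective L := by
  have hinj : Function.Injective L ↔
      LinearIndependent ℝ fun i : Fin m => L (EuclideanSpace.single i 1) := by
    rw [Fintype.linearIndependent_iff, injective_iff_map_eq_zero]
    constructor
    · intro h g hg i
      have := h (WithLp.toLp 2 g) (by rw [map_eq_sum_single]; exact hg)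
      simpa using congrArg (fun η : EuclideanSpace ℝ (Fin m) => η i) this
    · intro h ξ hξ
      ext i
      exact h (fun i => ξ i) (by rw [← map_eq_sum_single]; exact hξ) i
  rw [hinj, gramDet_eq_det_gram]
  exact ⟨fun h => Matrix.linearIndependent_of_det_gram_ne_zero h.ne',
    fun h => (Matrix.posDef_gram_of_linearIndependent h).det_pos⟩

theorem gramDet_smul (r : ℝ) (L : EuclideanSpace ℝ (Fin m) →L[ℝ] Amb m) :
    gramDet (r • L) = (r ^ 2) ^ m * gramDet L := by
  have : (Matrix.of fun i j : Fin m => ⟪(r • L) (EuclideanSpace.single i 1),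
      (r • L) (EuclideanSpace.single j 1)⟫) = (r ^ 2) • Matrix.of fun i j : Fin m =>
      ⟪L (EuclideanSpace.single i 1), L (EuclideanSpace.single j 1)⟫ := by
    ext i j
    simp only [Matrix.of_apply, smul_apply, inner_smul_left, inner_smul_right, Matrix.smul_apply,
      conj_trivial, smul_eq_mul]
    ring
  rw [gramDet, this, Matrix.det_smul, Fintype.card_fin, gramDet]

theorem areaElement_smul_div {r : ℝ} (hr : 0 < r) (L L' : EuclideanSpace ℝ (Fin m) →L[ℝ] Amb m) :
    InitialTriangulation.areaElement (r • L) / InitialTriangulation.areaElement (r • L') =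
      Real.sqrt (gramDet L) / Real.sqrt (gramDet L') := by
  have h : 0 < Real.sqrt ((r ^ 2) ^ m) := Real.sqrt_pos.2 (by positivity)
  rw [areaElement_eq_sqrt_gramDet, areaElement_eq_sqrt_gramDet, gramDet_smul, gramDet_smul,
    Real.sqrt_mul (by positivity), Real.sqrt_mul (by positivity), mul_div_mul_left _ _ h.ne']

theorem contDiff_gramDet : ContDiff ℝ ∞ (gramDet (m := m)) := by
  unfold gramDet
  simp only [Matrix.det_apply, Matrix.of_apply]
  refine ContDiff.sum fun s _ => ContDiff.const_smul _ (contDiff_prod fun i _ => ?_)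
  exact (contDiff_id.clm_apply contDiff_const).inner ℝ (contDiff_id.clm_apply contDiff_const)

end GramDet

/-! ### Congruence modulo powers of the mesh parameter -/

section CongPow

variable {X : Type*} [NormedAddCommGroup X] [NormedSpace ℝ X] {ρ : X → ℝ} {K : Set X}
  {G G' G'' : Type*} [NormedAddCommGroup G] [NormedSpace ℝ G] [NormedAddCommGroup G']
  [NormedSpace ℝ G'] [NormedAddCommGroup G''] [NormedSpace ℝ G'']

/-- `f` is smooth at every point of `K`. -/
def SmoothAtPts (K : Set X) (f : X → G) : Prop := ∀ z ∈ K, ContDiffAt ℝ ∞ f z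

/-- `f - g` is `ρ ^ n` times a function that is smooth at all points of `K`; the equality is only
required where `ρ` is positive, whereas the quotient is smooth up to `ρ = 0`. -/
def CongPow (ρ : X → ℝ) (K : Set X) (n : ℕ) (f g : X → G) : Prop :=
  ∃ q : X → G, SmoothAtPts K q ∧ ∀ z ∈ K, 0 < ρ z → f z = g z + ρ z ^ n • q z

theorem ContDiff.smoothAtPts {f : X → G} (hf : ContDiff ℝ ∞ f) : SmoothAtPts K f :=
  fun _ _ => hf.contDiffAt

theorem SmoothAtPts.bilin (B : G →L[ℝ] G' →L[ℝ] G'') {f : X → G} {g : X → G'}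
    (hf : SmoothAtPts K f) (hg : SmoothAtPts K g) : SmoothAtPts K fun z => B (f z) (g z) :=
  fun z hz => (B.contDiff.contDiffAt.comp z (hf z hz)).clm_apply (hg z hz)

theorem SmoothAtPts.ringInverse {R : Type*} [NormedRing R] [NormedAlgebra ℝ R]
    [HasSummableGeomSeries R] {f : X → R} (hf : SmoothAtPts K f) (hu : ∀ z ∈ K, IsUnit (f z)) :
    SmoothAtPts K fun z => Ring.inverse (f z) := fun z hz => by
  obtain ⟨u, hu⟩ := hu z hz
  have h := contDiffAt_ringInverse ℝ (n := ∞) u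
  rw [hu] at h
  exact h.comp z (hf z hz)

namespace CongPow

variable {n n' : ℕ} {f g h : X → G}

theorem of_eqOn (hfg : ∀ z ∈ K, 0 < ρ z → f z = g z) : CongPow ρ K n f g :=
  ⟨fun _ => 0, contDiff_const.smoothAtPts, fun z hz hr => by simp [hfg z hz hr]⟩

theorem symm (hfg : CongPow ρ K n f g) : CongPow ρ K n g f := by
  obtain ⟨q, hq, h⟩ := hfg
  exact ⟨fun z => -q z, fun z hz => (hq z hz).neg, fun z hz hr => by rw [h z hz hr]; simp⟩

theorem trans (hfg : CongPow ρ K n f g) (hgh : CongPow ρ K n g h) : CongPow ρ K n f h := by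
  obtain ⟨q, hq, e⟩ := hfg
  obtain ⟨q', hq', e'⟩ := hgh
  exact ⟨fun z => q' z + q z, fun z hz => (hq' z hz).add (hq z hz), fun z hz hr => by
    rw [e z hz hr, e' z hz hr, smul_add, add_assoc]⟩

theorem add {f' g' : X → G} (hfg : CongPow ρ K n f g) (hfg' : CongPow ρ K n f' g') :
    CongPow ρ K n (fun z => f z + f' z) fun z => g z + g' z := by
  obtain ⟨q, hq, e⟩ := hfg
  obtain ⟨q', hq', e'⟩ := hfg'
  exact ⟨fun z => q z + q' z, fun z hz => (hq z hz).add (hq' z hz), fun z hz hr => by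
    beta_reduce
    rw [e z hz hr, e' z hz hr, smul_add]; abel⟩

theorem sub {f' g' : X → G} (hfg : CongPow ρ K n f g) (hfg' : CongPow ρ K n f' g') :
    CongPow ρ K n (fun z => f z - f' z) fun z => g z - g' z := by
  obtain ⟨q, hq, e⟩ := hfg
  obtain ⟨q', hq', e'⟩ := hfg'
  exact ⟨fun z => q z - q' z, fun z hz => (hq z hz).sub (hq' z hz), fun z hz hr => by
    beta_reduce
    rw [e z hz hr, e' z hz hr, smul_sub]; abel⟩

theorem sum {ι : Type*} (s : Finset ι) {f g : ι → X → G}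
    (hfg : ∀ i ∈ s, CongPow ρ K n (f i) (g i)) :
    CongPow ρ K n (fun z => ∑ i ∈ s, f i z) fun z => ∑ i ∈ s, g i z := by
  classical
  induction s using Finset.induction_on with
  | empty => exact of_eqOn fun z _ _ => by simp
  | insert i s hi ih =>
    simp only [Finset.sum_insert hi]
    exact (hfg i (Finset.mem_insert_self i s)).add
      (ih fun j hj => hfg j (Finset.mem_insert_of_mem hj))

theorem mono (hρ : SmoothAtPts K ρ) (hn : n ≤ n') (hfg : CongPow ρ K n' f g) :
    CongPow ρ K n f g := by
  obtain ⟨q, hq, e⟩ := hfg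
  refine ⟨fun z => ρ z ^ (n' - n) • q z, fun z hz => ((hρ z hz).pow _).smul (hq z hz),
    fun z hz hr => ?_⟩
  rw [e z hz hr, smul_smul, ← pow_add, Nat.add_sub_cancel' hn]

/-- Congruences may be inserted into a bilinear map; the right-hand sides have to be smooth, as
`B (g + ρ ^ n q) (g' + ρ ^ n q')` contains products of them with the quotients. -/
theorem bilin (hρ : SmoothAtPts K ρ) (B : G →L[ℝ] G' →L[ℝ] G'') {f' g' : X → G'}
    (hg : SmoothAtPts K g) (hg' : SmoothAtPts K g') (hfg : CongPow ρ K n f g)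
    (hfg' : CongPow ρ K n f' g') :
    CongPow ρ K n (fun z => B (f z) (f' z)) fun z => B (g z) (g' z) := by
  obtain ⟨q, hq, e⟩ := hfg
  obtain ⟨q', hq', e'⟩ := hfg'
  refine ⟨fun z => B (q z) (g' z) + B (g z) (q' z) + ρ z ^ n • B (q z) (q' z), fun z hz => ?_,
    fun z hz hr => ?_⟩
  · exact ((hq.bilin B hg' z hz).add (hg.bilin B hq' z hz)).add
      (((hρ z hz).pow _).smul (hq.bilin B hq' z hz))
  · beta_reduce
    rw [e z hz hr, e' z hz hr]
    simp only [map_add, map_smul, add_apply, smul_apply, smul_add]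
    abel

theorem mul {f f' g g' : X → ℝ} (hρ : SmoothAtPts K ρ) (hg : SmoothAtPts K g)
    (hg' : SmoothAtPts K g') (hfg : CongPow ρ K n f g) (hfg' : CongPow ρ K n f' g') :
    CongPow ρ K n (fun z => f z * f' z) fun z => g z * g' z :=
  hfg.bilin hρ (ContinuousLinearMap.mul ℝ ℝ) hg hg' hfg'

theorem prod {ι : Type*} (s : Finset ι) {f g : ι → X → ℝ} (hρ : SmoothAtPts K ρ)
    (hg : ∀ i, SmoothAtPts K (g i)) (hfg : ∀ i, CongPow ρ K n (f i) (g i)) :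
    CongPow ρ K n (fun z => ∏ i ∈ s, f i z) fun z => ∏ i ∈ s, g i z := by
  classical
  induction s using Finset.induction_on with
  | empty => exact of_eqOn fun z _ _ => by simp
  | insert i s hi ih =>
    simp only [Finset.prod_insert hi]
    exact (hfg i).mul hρ (hg i) (fun z hz => contDiffAt_prod fun j _ => hg j z hz) ih

theorem comp {E V W : Type*} [NormedAddCommGroup E] [NormedSpace ℝ E] [NormedAddCommGroup V]
    [NormedSpace ℝ V] [NormedAddCommGroup W] [NormedSpace ℝ W] {f g : X → V →L[ℝ] W}
    {f' g' : X → E →L[ℝ] V} (hρ : SmoothAtPts K ρ) (hg : SmoothAtPts K g)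
    (hg' : SmoothAtPts K g') (hfg : CongPow ρ K n f g) (hfg' : CongPow ρ K n f' g') :
    CongPow ρ K n (fun z => f z ∘L f' z) fun z => g z ∘L g' z :=
  hfg.bilin hρ (ContinuousLinearMap.compL ℝ E V W) hg hg' hfg'

/-- A product of two small factors is small of the added order. -/
theorem mul_zero_zero {f f' : X → ℝ} (hf : CongPow ρ K n f fun _ => 0)
    (hf' : CongPow ρ K n' f' fun _ => 0) : CongPow ρ K (n + n') (fun z => f z * f' z) fun _ => 0 := by
  obtain ⟨q, hq, e⟩ := hf
  obtain ⟨q', hq', e'⟩ := hf'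
  refine ⟨fun z => q z * q' z, fun z hz => (hq z hz).mul (hq' z hz), fun z hz hr => ?_⟩
  beta_reduce
  rw [e z hz hr, e' z hz hr]
  simp only [smul_eq_mul, pow_add]
  ring

theorem gramDet {m : ℕ} {L L' : X → EuclideanSpace ℝ (Fin m) →L[ℝ] Amb m}
    (hρ : SmoothAtPts K ρ) (hL' : SmoothAtPts K L')
    (h : ∀ i j : Fin m, CongPow ρ K n
      (fun z => ⟪L z (EuclideanSpace.single i 1), L z (EuclideanSpace.single j 1)⟫)
      fun z => ⟪L' z (EuclideanSpace.single i 1), L' z (EuclideanSpace.single j 1)⟫) :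
    CongPow ρ K n (fun z => gramDet (L z)) fun z => gramDet (L' z) := by
  unfold _root_.gramDet
  simp only [Matrix.det_apply, Matrix.of_apply]
  have hs : ∀ i j : Fin m, SmoothAtPts K
      fun z => ⟪L' z (EuclideanSpace.single i 1), L' z (EuclideanSpace.single j 1)⟫ :=
    fun i j z hz => ((hL' z hz).clm_apply contDiffAt_const).inner ℝ
      ((hL' z hz).clm_apply contDiffAt_const)
  refine sum _ fun s _ => ?_
  have h1 := prod Finset.univ hρ (fun i => hs (s i) i) fun i => h (s i) i
  obtain ⟨q, hq, e⟩ := h1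
  refine ⟨fun z => Equiv.Perm.sign s • q z, fun z hz => (hq z hz).const_smul _,
    fun z hz hr => ?_⟩
  have ez := e z hz hr
  beta_reduce at ez ⊢
  rw [ez, smul_add, smul_comm]

/-- From `√f / √g - 1 = (f - g) / (√g (√f + √g))`. -/
theorem sqrt_div {f g : X → ℝ} (hf : SmoothAtPts K f) (hg : SmoothAtPts K g)
    (hf0 : ∀ z ∈ K, 0 < f z) (hg0 : ∀ z ∈ K, 0 < g z) (hfg : CongPow ρ K n f g) :
    CongPow ρ K n (fun z => Real.sqrt (f z) / Real.sqrt (g z)) fun _ => 1 := by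
  obtain ⟨q, hq, e⟩ := hfg
  refine ⟨fun z => q z / (Real.sqrt (g z) * (Real.sqrt (f z) + Real.sqrt (g z))), fun z hz => ?_,
    fun z hz hr => ?_⟩
  · have h1 := Real.sqrt_pos.2 (hf0 z hz)
    have h2 := Real.sqrt_pos.2 (hg0 z hz)
    exact (hq z hz).div (((hg z hz).sqrt (hg0 z hz).ne').mul
      (((hf z hz).sqrt (hf0 z hz).ne').add ((hg z hz).sqrt (hg0 z hz).ne'))) (by positivity)
  · have h1 := Real.sqrt_pos.2 (hf0 z hz)
    have h2 := Real.sqrt_pos.2 (hg0 z hz)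
    have h3 := Real.sq_sqrt (hf0 z hz).le
    have h4 := Real.sq_sqrt (hg0 z hz).le
    have h5 : ρ z ^ n * q z = Real.sqrt (f z) ^ 2 - Real.sqrt (g z) ^ 2 := by
      rw [h3, h4, e z hz hr, smul_eq_mul]; ring
    rw [smul_eq_mul, ← mul_div_assoc, h5]
    field_simp
    ring

/-- From `f⁻¹ - g⁻¹ = -f⁻¹ (f - g) g⁻¹`. -/
theorem ringInverse {R : Type*} [NormedRing R] [NormedAlgebra ℝ R] [HasSummableGeomSeries R]
    {f g : X → R} (hf : SmoothAtPts K f) (hg : SmoothAtPts K g) (hfu : ∀ z ∈ K, IsUnit (f z))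
    (hgu : ∀ z ∈ K, IsUnit (g z)) (hfg : CongPow ρ K n f g) :
    CongPow ρ K n (fun z => Ring.inverse (f z)) fun z => Ring.inverse (g z) := by
  obtain ⟨q, hq, e⟩ := hfg
  refine ⟨fun z => -(Ring.inverse (f z) * q z * Ring.inverse (g z)), fun z hz => ?_,
    fun z hz hr => ?_⟩
  · exact (((hf.ringInverse hfu z hz).mul (hq z hz)).mul (hg.ringInverse hgu z hz)).neg
  · have h1 : Ring.inverse (f z) * (f z - g z) * Ring.inverse (g z) =
        Ring.inverse (g z) - Ring.inverse (f z) := by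
      rw [mul_sub, sub_mul, Ring.inverse_mul_cancel _ (hfu z hz), one_mul, mul_assoc,
        Ring.mul_inverse_cancel _ (hgu z hz), mul_one]
    have h2 : f z - g z = ρ z ^ n • q z := by rw [e z hz hr]; abel
    rw [h2, mul_smul_comm, smul_mul_assoc] at h1
    rw [smul_neg, h1]
    abel

end CongPow

end CongPow

/-! ### The smooth model of a curved element -/

/-- Parameters of a point of a flat element: base vertex `a`, scaled edge map `W`, size `r` and
reference coordinate `ξ`, in this order. -/
abbrev ElementParam (m : ℕ) : Type :=
  Amb m × (EuclideanSpace ℝ (Fin m) →L[ℝ] Amb m) × ℝ × EuclideanSpace ℝ (Fin m)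

noncomputable section

/-- The derivative with respect to the reference coordinate. -/
def refDeriv {m : ℕ} {G : Type*} [NormedAddCommGroup G] [NormedSpace ℝ G]
    (f : ElementParam m × ℝ → G) (z : ElementParam m × ℝ) : EuclideanSpace ℝ (Fin m) →L[ℝ] G :=
  (fderiv ℝ f z).comp ((ContinuousLinearMap.inl ℝ (ElementParam m) ℝ).comp
    ((ContinuousLinearMap.inr ℝ _ _).comp ((ContinuousLinearMap.inr ℝ _ _).comp
      (ContinuousLinearMap.inr ℝ ℝ (EuclideanSpace ℝ (Fin m))))))

theorem contDiff_refDeriv {m : ℕ} {G : Type*} [NormedAddCommGroup G] [NormedSpace ℝ G]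
    {f : ElementParam m × ℝ → G} (hf : ContDiff ℝ ∞ f) : ContDiff ℝ ∞ (refDeriv f) :=
  (hf.fderiv_right (by simp)).clm_comp contDiff_const

theorem hasFDerivAt_refDeriv {m : ℕ} {G : Type*} [NormedAddCommGroup G] [NormedSpace ℝ G]
    {f : ElementParam m × ℝ → G} (hf : ContDiff ℝ ∞ f) (a : Amb m)
    (W : EuclideanSpace ℝ (Fin m) →L[ℝ] Amb m) (r t : ℝ) (ξ : EuclideanSpace ℝ (Fin m)) :
    HasFDerivAt (fun η => f ((a, W, r, η), t)) (refDeriv f ((a, W, r, ξ), t)) ξ := by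
  have h1 : HasFDerivAt f (fderiv ℝ f ((a, W, r, ξ), t)) ((a, W, r, ξ), t) :=
    (hf.differentiable (by simp) _).hasFDerivAt
  have e1 : HasFDerivAt (fun η : EuclideanSpace ℝ (Fin m) => (r, η)) _ ξ :=
    hasFDerivAt_prodMk_right (𝕜 := ℝ) r ξ
  have e2 : HasFDerivAt (fun η : EuclideanSpace ℝ (Fin m) => (W, r, η)) _ ξ :=
    (hasFDerivAt_prodMk_right (𝕜 := ℝ) W (r, ξ)).comp ξ e1
  have e3 : HasFDerivAt (fun η : EuclideanSpace ℝ (Fin m) => (a, W, r, η)) _ ξ :=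
    (hasFDerivAt_prodMk_right (𝕜 := ℝ) a (W, r, ξ)).comp ξ e2
  have h2 : HasFDerivAt (fun η : EuclideanSpace ℝ (Fin m) => ((a, W, r, η), t))
      ((ContinuousLinearMap.inl ℝ (ElementParam m) ℝ).comp
        ((ContinuousLinearMap.inr ℝ _ _).comp ((ContinuousLinearMap.inr ℝ _ _).comp
          (ContinuousLinearMap.inr ℝ ℝ (EuclideanSpace ℝ (Fin m)))))) ξ :=
    (hasFDerivAt_prodMk_left (𝕜 := ℝ) (a, W, r, ξ) t).comp ξ e3
  exact h1.comp ξ h2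

/-- The data from which all quantities on the curved elements are built: the remainder `R` of
interpolating the flow and the Hadamard quotient `AD` of the distance function. -/
structure ElementModel {m : ℕ} {S : EvolvingSurface m} (𝒟 : SmoothDistance S) (k : ℕ) where
  R : (Amb m × (EuclideanSpace ℝ (Fin m) →L[ℝ] Amb m) × ℝ) × ℝ × EuclideanSpace ℝ (Fin m) → Amb m
  R_smooth : ContDiff ℝ ∞ R
  R_spec : ∀ a (W : EuclideanSpace ℝ (Fin m) →L[ℝ] Amb m) t r ξ,
    𝒟.flow (a + W (r • ξ), t) - ∑ α ∈ Finset.piAntidiag Finset.univ k,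
      lagrange k α (bary ξ) • 𝒟.flow (a + W (r • latticePoint m k α), t) =
        r ^ (k + 1) • R ((a, W, t), r, ξ)
  AD : (Amb m × ℝ) × Amb m → Amb m →L[ℝ] ℝ
  AD_smooth : ContDiff ℝ ∞ AD
  AD_spec : ∀ x t y, 𝒟.D (x + y, t) = 𝒟.D (x, t) + AD ((x, t), y) y
  AD_zero : ∀ x t w, AD ((x, t), 0) w = ⟪𝒟.N (x, t), w⟫

theorem SmoothDistance.nonempty_elementModel {m : ℕ} {S : EvolvingSurface m}
    (𝒟 : SmoothDistance S) {k : ℕ} (hk : 1 ≤ k) : Nonempty (ElementModel 𝒟 k) := by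
  have hflow := 𝒟.contDiff_flow
  have hD := 𝒟.smooth
  obtain ⟨R, hR, hRs⟩ := exists_interpolation_remainder (m := m) hk
    (Z := Amb m × (EuclideanSpace ℝ (Fin m) →L[ℝ] Amb m) × ℝ)
    (Ψ := fun y => 𝒟.flow (y.1.1 + y.1.2.1 y.2, y.1.2.2)) (by
      refine hflow.comp (ContDiff.prodMk (ContDiff.add (by fun_prop) ?_) (by fun_prop))
      exact ContDiff.clm_apply (by fun_prop) (by fun_prop))
  obtain ⟨A, hA, hAs, hA0⟩ := exists_hadamard_quotient
    (Z := Amb m × ℝ) (Y := Amb m) (Ψ := fun y => 𝒟.D (y.1.1 + y.2, y.1.2))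
    (hD.comp (by fun_prop))
  refine ⟨⟨R, hR, fun a W t r ξ => hRs (a, W, t) r ξ, A, hA, fun x t y => ?_, fun x t w => ?_⟩⟩
  · simpa using hAs (x, t) y
  · rw [hA0, 𝒟.inner_N]
    have h1 : HasFDerivAt (fun y : Amb m => 𝒟.D (x + y, t))
        ((fderiv ℝ 𝒟.D (x, t)).comp (ContinuousLinearMap.inl ℝ (Amb m) ℝ)) 0 := by
      have := hasFDerivAt_slice (𝒟.smooth.differentiable (by simp) (x + 0, t))
      have h2 := this.comp (0 : Amb m) ((hasFDerivAt_id (0 : Amb m)).const_add x)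
      simpa [Function.comp_def] using h2
    simp [h1.fderiv]

namespace ElementModel

variable {m : ℕ} {S : EvolvingSurface m} {𝒟 : SmoothDistance S} {k : ℕ} (M : ElementModel 𝒟 k)

/-- The point of the flat element. -/
def flatPoint (z : ElementParam m × ℝ) : Amb m := z.1.1 + z.1.2.1 (z.1.2.2.1 • z.1.2.2.2)

/-- The point of the smooth surface that the curved element interpolates. -/
def base (𝒟 : SmoothDistance S) (z : ElementParam m × ℝ) : Amb m := 𝒟.flow (flatPoint z, z.2)

/-- The scaled interpolation error. -/
def rem (z : ElementParam m × ℝ) : Amb m := M.R ((z.1.1, z.1.2.1, z.2), z.1.2.2.1, z.1.2.2.2)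

/-- The point of the curved element. -/
def F (z : ElementParam m × ℝ) : Amb m := base 𝒟 z - z.1.2.2.1 ^ (k + 1) • M.rem z

/-- The differential of the parametrization of the curved element, divided by `r`. -/
def A (z : ElementParam m × ℝ) : EuclideanSpace ℝ (Fin m) →L[ℝ] Amb m :=
  ((fderiv ℝ 𝒟.flow (flatPoint z, z.2)).comp (ContinuousLinearMap.inl ℝ (Amb m) ℝ)).comp z.1.2.1 -
    z.1.2.2.1 ^ k • refDeriv M.rem z

/-- The distance of the curved element to the surface, divided by `r ^ (k + 1)`. -/
def distCoeff (z : ElementParam m × ℝ) : ℝ :=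
  -M.AD ((base 𝒟 z, z.2), -(z.1.2.2.1 ^ (k + 1) • M.rem z)) (M.rem z)

/-- The distance on the curved element. -/
def dist (z : ElementParam m × ℝ) : ℝ := 𝒟.D (M.F z, z.2)

/-- The normal of the surface on the curved element. -/
def normal (z : ElementParam m × ℝ) : Amb m := 𝒟.N (M.F z, z.2)

/-- The tangential projection on the curved element. -/
def tang (z : ElementParam m × ℝ) : Amb m →L[ℝ] Amb m := 𝒟.tang (M.F z, z.2)

/-- The Weingarten map on the curved element. -/
def weing (z : ElementParam m × ℝ) : Amb m →L[ℝ] Amb m := 𝒟.H (M.F z, z.2)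

/-- The tangential part of `A`. -/
def P (z : ElementParam m × ℝ) : EuclideanSpace ℝ (Fin m) →L[ℝ] Amb m := M.tang z ∘L M.A z

/-- The differential of the projected parametrization, divided by `r`. -/
def projA (z : ElementParam m × ℝ) : EuclideanSpace ℝ (Fin m) →L[ℝ] Amb m :=
  M.P z - M.dist z • (M.weing z ∘L M.A z)

theorem contDiff_flatPoint : ContDiff ℝ ∞ (flatPoint (m := m)) := by
  unfold flatPoint
  exact ContDiff.add (by fun_prop) (ContDiff.clm_apply (by fun_prop) (by fun_prop))

theorem contDiff_size_pow (n : ℕ) :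
    ContDiff ℝ ∞ fun z : ElementParam m × ℝ => z.1.2.2.1 ^ n := by
  fun_prop

theorem contDiff_base : ContDiff ℝ ∞ (base 𝒟) :=
  𝒟.contDiff_flow.comp (contDiff_flatPoint.prodMk contDiff_snd)

theorem contDiff_rem : ContDiff ℝ ∞ M.rem := M.R_smooth.comp (by fun_prop)

theorem contDiff_F : ContDiff ℝ ∞ M.F :=
  contDiff_base.sub ((contDiff_size_pow _).smul M.contDiff_rem)

theorem contDiff_F_prod : ContDiff ℝ ∞ fun z => (M.F z, z.2) := M.contDiff_F.prodMk contDiff_snd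

theorem contDiff_A : ContDiff ℝ ∞ M.A := by
  refine ContDiff.sub (ContDiff.clm_comp (ContDiff.clm_comp ?_ contDiff_const) (by fun_prop))
    ((contDiff_size_pow k).smul (contDiff_refDeriv M.contDiff_rem))
  exact (𝒟.contDiff_flow.fderiv_right (m := ∞) (by simp)).comp
    (contDiff_flatPoint.prodMk contDiff_snd)

theorem contDiff_distCoeff : ContDiff ℝ ∞ M.distCoeff := by
  refine ContDiff.neg (ContDiff.clm_apply (M.AD_smooth.comp ?_) M.contDiff_rem)
  exact (contDiff_base.prodMk contDiff_snd).prodMk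
    ((contDiff_size_pow _).smul M.contDiff_rem).neg

theorem contDiff_dist : ContDiff ℝ ∞ M.dist := 𝒟.smooth.comp M.contDiff_F_prod

theorem contDiff_tang : ContDiff ℝ ∞ M.tang := 𝒟.contDiff_tang.comp M.contDiff_F_prod

theorem contDiff_weing : ContDiff ℝ ∞ M.weing := 𝒟.contDiff_H.comp M.contDiff_F_prod

theorem contDiff_P : ContDiff ℝ ∞ M.P := M.contDiff_tang.clm_comp M.contDiff_A

theorem contDiff_projA : ContDiff ℝ ∞ M.projA :=
  M.contDiff_P.sub (M.contDiff_dist.smul (M.contDiff_weing.clm_comp M.contDiff_A))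

theorem F_eq_sum (a : Amb m) (W : EuclideanSpace ℝ (Fin m) →L[ℝ] Amb m) (r t : ℝ)
    (ξ : EuclideanSpace ℝ (Fin m)) : M.F ((a, W, r, ξ), t) =
      ∑ α ∈ Finset.piAntidiag Finset.univ k,
        lagrange k α (bary ξ) • 𝒟.flow (a + W (r • latticePoint m k α), t) := by
  have := M.R_spec a W t r ξ
  rw [F, base, flatPoint, rem, ← this]
  simp

theorem hasFDerivAt_F (a : Amb m) (W : EuclideanSpace ℝ (Fin m) →L[ℝ] Amb m) (r t : ℝ)
    (ξ : EuclideanSpace ℝ (Fin m)) :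
    HasFDerivAt (fun η => M.F ((a, W, r, η), t)) (r • M.A ((a, W, r, ξ), t)) ξ := by
  have h1 := hasFDerivAt_slice
    (𝒟.contDiff_flow.differentiable (by simp) (a + W (r • ξ), t))
  have h2 : HasFDerivAt (fun η : EuclideanSpace ℝ (Fin m) => a + W (r • η)) (r • W) ξ := by
    have := (W.hasFDerivAt (x := ξ)).const_smul r
    refine (this.const_add a).congr_of_eventuallyEq ?_
    exact Filter.Eventually.of_forall fun η => by simp
  have h3 := (hasFDerivAt_refDeriv M.contDiff_rem a W r t ξ).const_smul (r ^ (k + 1))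
  refine ((h1.comp ξ h2).sub h3).congr_fderiv ?_
  rw [A, smul_sub, smul_smul, ← pow_succ', flatPoint]
  congr 1
  ext1 w
  simp

/-- The distance on the curved element is of order `r ^ (k + 1)`: the interpolation error is, and
the distance vanishes at the interpolated point. -/
theorem dist_eq {z : ElementParam m × ℝ} (hz : (flatPoint z, (0 : ℝ)) ∈ 𝒟.U)
    (ht : z.2 ∈ Set.Icc 0 S.T) : M.dist z = z.1.2.2.1 ^ (k + 1) * M.distCoeff z := by
  have h0 : 𝒟.D (base 𝒟 z, z.2) = 0 := 𝒟.D_eq_zero (𝒟.flow_mem hz ht)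
  rw [dist, F, sub_eq_add_neg, M.AD_spec, h0, zero_add, distCoeff, map_neg, map_smul, smul_eq_mul]
  ring

/-- The normal component of the tangent vectors of the curved element is of order `r ^ k`: it is
the derivative of the distance. -/
theorem inner_normal_A {z : ElementParam m × ℝ} (hz : (flatPoint z, (0 : ℝ)) ∈ 𝒟.U)
    (ht : z.2 ∈ Set.Icc 0 S.T) (hr : 0 < z.1.2.2.1) (w : EuclideanSpace ℝ (Fin m)) :
    ⟪M.normal z, M.A z w⟫ = z.1.2.2.1 ^ k * refDeriv M.distCoeff z w := by
  obtain ⟨⟨a, W, r, ξ⟩, t⟩ := z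
  simp only at ht hr ⊢
  have h1 : HasFDerivAt (fun η => M.dist ((a, W, r, η), t))
      (r ^ (k + 1) • refDeriv M.distCoeff ((a, W, r, ξ), t)) ξ := by
    refine ((hasFDerivAt_refDeriv M.contDiff_distCoeff a W r t ξ).const_smul
      (r ^ (k + 1))).congr_of_eventuallyEq ?_
    have hc : Continuous fun η : EuclideanSpace ℝ (Fin m) =>
        (flatPoint ((a, W, r, η), t), (0 : ℝ)) := by
      have := (contDiff_flatPoint (m := m)).continuous
      fun_prop
    filter_upwards [hc.continuousAt.eventually_mem (𝒟.isOpen.mem_nhds hz)] with η hη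
    exact M.dist_eq hη ht
  have h2 := (hasFDerivAt_slice
    (𝒟.smooth.differentiable (by simp) (M.F ((a, W, r, ξ), t), t))).comp ξ (M.hasFDerivAt_F a W r t ξ)
  have h3 := DFunLike.congr_fun (h2.unique h1) w
  have h4 : r * ⟪M.normal ((a, W, r, ξ), t), M.A ((a, W, r, ξ), t) w⟫ =
      r ^ (k + 1) * refDeriv M.distCoeff ((a, W, r, ξ), t) w := by
    rw [normal, 𝒟.inner_N]
    simpa using h3
  rw [pow_succ', mul_assoc] at h4
  exact mul_left_cancel₀ hr.ne' h4

end ElementModel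

end

/-! ### Geometric quantities of the curved element modulo powers of its size -/

noncomputable section

/-- The size `r` of the flat element, as a function of the parameters. -/
def elementSize {m : ℕ} (z : ElementParam m × ℝ) : ℝ := z.1.2.2.1

theorem contDiff_elementSize {m : ℕ} : ContDiff ℝ ∞ (elementSize (m := m)) := by
  unfold elementSize
  fun_prop

namespace ElementModel

variable {m : ℕ} {S : EvolvingSurface m} {𝒟 : SmoothDistance S} {k : ℕ} (M : ElementModel 𝒟 k)

/-- The open conditions on the parameters under which the model describes a curved element: all
points lie where the distance function is smooth, and the parametrizations are immersions. -/
structure Good (z : ElementParam m × ℝ) : Prop where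
  F_mem : (M.F z, z.2) ∈ 𝒟.U
  flatPoint_mem : (flatPoint z, (0 : ℝ)) ∈ 𝒟.U
  lattice_mem : ∀ α ∈ Finset.piAntidiag Finset.univ k,
    (z.1.1 + z.1.2.1 (z.1.2.2.1 • latticePoint m k α), (0 : ℝ)) ∈ 𝒟.U
  A_pos : 0 < gramDet (M.A z)
  P_pos : 0 < gramDet (M.P z)
  projA_pos : 0 < gramDet (M.projA z)

/-- The quotient of the surface measures. -/
def area (z : ElementParam m × ℝ) : ℝ :=
  Real.sqrt (gramDet (M.projA z)) / Real.sqrt (gramDet (M.A z))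

/-- `Id - d 𝓗`. -/
def idSubDH (z : ElementParam m × ℝ) : Amb m →L[ℝ] Amb m :=
  ContinuousLinearMap.id ℝ (Amb m) - M.dist z • M.weing z

/-- `Pr Pr_h Pr`. -/
def tangTang (z : ElementParam m × ℝ) : Amb m →L[ℝ] Amb m :=
  M.tang z ∘L rangeProj (M.A z) ∘L M.tang z

/-- `Q_h`. -/
def Q (z : ElementParam m × ℝ) : Amb m →L[ℝ] Amb m :=
  (1 / M.area z) • (M.idSubDH z ∘L M.tangTang z ∘L M.idSubDH z)

variable {M} in
theorem Good.norm_normal {z : ElementParam m × ℝ} (hz : M.Good z) : ‖M.normal z‖ = 1 :=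
  𝒟.norm_grad _ hz.F_mem

theorem tang_apply (z : ElementParam m × ℝ) (w : Amb m) :
    M.tang z w = w - ⟪M.normal z, w⟫ • M.normal z := 𝒟.tang_apply _ w

theorem inner_tang_left (z : ElementParam m × ℝ) (v w : Amb m) :
    ⟪M.tang z v, w⟫ = ⟪v, M.tang z w⟫ := by
  rw [tang_apply, tang_apply, inner_sub_left, inner_sub_right, inner_smul_left, inner_smul_right,
    real_inner_comm v (M.normal z)]
  simp only [conj_trivial]
  ring

variable {M} in
theorem Good.inner_normal_tang {z : ElementParam m × ℝ} (hz : M.Good z) (w : Amb m) :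
    ⟪M.normal z, M.tang z w⟫ = 0 := by
  rw [tang_apply, inner_sub_right, inner_smul_right, real_inner_self_eq_norm_sq, hz.norm_normal]
  ring

variable {M} in
theorem Good.tang_tang {z : ElementParam m × ℝ} (hz : M.Good z) :
    M.tang z ∘L M.tang z = M.tang z := by
  ext1 w
  rw [ContinuousLinearMap.comp_apply, M.tang_apply z (M.tang z w), hz.inner_normal_tang, zero_smul,
    sub_zero]

variable {M} in
theorem Good.norm_tang_apply_sq {z : ElementParam m × ℝ} (hz : M.Good z) (w : Amb m) :
    ‖M.tang z w‖ ^ 2 = ‖w‖ ^ 2 - ⟪M.normal z, w⟫ ^ 2 := by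
  have h1 : M.tang z (M.tang z w) = M.tang z w := DFunLike.congr_fun hz.tang_tang w
  rw [← real_inner_self_eq_norm_sq, inner_tang_left, h1, tang_apply, inner_sub_right,
    inner_smul_right, real_inner_self_eq_norm_sq, real_inner_comm]
  ring

variable {M} in
theorem Good.norm_tang_le {z : ElementParam m × ℝ} (hz : M.Good z) : ‖M.tang z‖ ≤ 1 := by
  refine ContinuousLinearMap.opNorm_le_bound _ zero_le_one fun w => ?_
  rw [one_mul]
  refine le_of_sq_le_sq ?_ (norm_nonneg _)
  rw [hz.norm_tang_apply_sq]
  nlinarith [sq_nonneg ⟪M.normal z, w⟫]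

variable {M} in
theorem Good.inner_P {z : ElementParam m × ℝ} (hz : M.Good z) (v w : EuclideanSpace ℝ (Fin m)) :
    ⟪M.P z v, M.P z w⟫ =
      ⟪M.A z v, M.A z w⟫ - ⟪M.normal z, M.A z v⟫ * ⟪M.normal z, M.A z w⟫ := by
  have h1 : M.tang z (M.tang z (M.A z w)) = M.tang z (M.A z w) :=
    DFunLike.congr_fun hz.tang_tang _
  rw [P, ContinuousLinearMap.comp_apply, ContinuousLinearMap.comp_apply, inner_tang_left, h1,
    tang_apply, inner_sub_right, inner_smul_right, real_inner_comm (M.normal z) (M.A z v)]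
  ring

variable {M} in
/-- The tangential projection is the projection onto the range of `P`. -/
theorem Good.tang_eq_rangeProj {z : ElementParam m × ℝ} (hz : M.Good z) :
    M.tang z = rangeProj (M.P z) := by
  have hn : M.normal z ≠ 0 := by
    rw [← norm_ne_zero_iff, hz.norm_normal]; exact one_ne_zero
  have hinj := gramDet_pos_iff.1 hz.P_pos
  rw [rangeProj_eq_starProjection hinj (span_singleton_orthogonal_eq_range hn hinj
    (fun x => hz.inner_normal_tang _) (by simp))]
  ext1 w
  rw [Submodule.starProjection_orthogonal, tang_apply]
  simp only [sub_apply, ContinuousLinearMap.id_apply]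
  rw [Submodule.starProjection_unit_singleton ℝ hz.norm_normal]

variable {M} in
/-- The Gram operators of `A` and of its tangential part differ by a rank one operator of order
`r ^ (2 k)`. -/
theorem Good.gramOp_A {z : ElementParam m × ℝ} (hz : M.Good z) (ht : z.2 ∈ Set.Icc 0 S.T)
    (hr : 0 < elementSize z) : gramOp (M.A z) = gramOp (M.P z) +
      elementSize z ^ (2 * k) • (adjMap _ _ (refDeriv M.distCoeff z) ∘L refDeriv M.distCoeff z) := by
  ext1 v
  refine ext_inner_right ℝ fun w => ?_
  simp only [gramOp, add_apply, smul_apply, ContinuousLinearMap.comp_apply, inner_add_left,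
    inner_smul_left, inner_adjMap_left, conj_trivial]
  rw [hz.inner_P, M.inner_normal_A hz.flatPoint_mem ht hr, M.inner_normal_A hz.flatPoint_mem ht hr,
    elementSize]
  simp only [RCLike.inner_apply, conj_trivial]
  ring

theorem contDiff_adjMap_P :
    ContDiff ℝ ∞ fun z => adjMap (EuclideanSpace ℝ (Fin m)) (Amb m) (M.P z) :=
  (adjMap (EuclideanSpace ℝ (Fin m)) (Amb m)).contDiff.comp M.contDiff_P

/-- The rank one operator by which the Gram operators of `A` and `P` differ, up to scaling. -/
def gramDefect (z : ElementParam m × ℝ) : EuclideanSpace ℝ (Fin m) →L[ℝ] EuclideanSpace ℝ (Fin m) :=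
  adjMap _ _ (refDeriv M.distCoeff z) ∘L refDeriv M.distCoeff z

theorem contDiff_gramDefect : ContDiff ℝ ∞ M.gramDefect :=
  ((adjMap (EuclideanSpace ℝ (Fin m)) ℝ).contDiff.comp
    (contDiff_refDeriv M.contDiff_distCoeff)).clm_comp (contDiff_refDeriv M.contDiff_distCoeff)

section Congruences

variable {K : Set (ElementParam m × ℝ)}
variable {M}

theorem congPow_dist (hK : ∀ z ∈ K, M.Good z ∧ z.2 ∈ Set.Icc 0 S.T) :
    CongPow elementSize K (k + 1) M.dist fun _ => 0 :=
  ⟨M.distCoeff, M.contDiff_distCoeff.smoothAtPts, fun z hz _ => by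
    rw [M.dist_eq (hK z hz).1.flatPoint_mem (hK z hz).2, zero_add, smul_eq_mul, elementSize]⟩

theorem congPow_inner_normal (hK : ∀ z ∈ K, M.Good z ∧ z.2 ∈ Set.Icc 0 S.T)
    (w : EuclideanSpace ℝ (Fin m)) :
    CongPow elementSize K k (fun z => ⟪M.normal z, M.A z w⟫) fun _ => 0 :=
  ⟨fun z => refDeriv M.distCoeff z w,
    ((contDiff_refDeriv M.contDiff_distCoeff).clm_apply contDiff_const).smoothAtPts,
    fun z hz hr => by
      beta_reduce
      rw [M.inner_normal_A (hK z hz).1.flatPoint_mem (hK z hz).2 hr, zero_add, smul_eq_mul,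
        elementSize]⟩

theorem congPow_dist_smul {G : Type*} [NormedAddCommGroup G] [NormedSpace ℝ G]
    {f : ElementParam m × ℝ → G} (hf : SmoothAtPts K f)
    (hK : ∀ z ∈ K, M.Good z ∧ z.2 ∈ Set.Icc 0 S.T) :
    CongPow elementSize K (k + 1) (fun z => M.dist z • f z) fun _ => 0 := by
  obtain ⟨q, hq, e⟩ := congPow_dist hK
  exact ⟨fun z => q z • f z, fun z hz => (hq z hz).smul (hf z hz), fun z hz hr => by
    simp only [e z hz hr, zero_add, smul_smul, smul_eq_mul]⟩

theorem congPow_projA (hK : ∀ z ∈ K, M.Good z ∧ z.2 ∈ Set.Icc 0 S.T) :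
    CongPow elementSize K (k + 1) M.projA M.P := by
  have h := (CongPow.of_eqOn (ρ := elementSize) (K := K) (n := k + 1) (f := M.P) (g := M.P)
    fun _ _ _ => rfl).sub
    (congPow_dist_smul (M.contDiff_weing.clm_comp M.contDiff_A).smoothAtPts hK)
  simp only [sub_zero] at h
  exact h

/-- The Gram determinants agree to one order more than the tangent vectors do with their tangential
parts, because the normal components enter quadratically: `2 k ≥ k + 1`. -/
theorem congPow_gramDet (hk : 1 ≤ k) (hK : ∀ z ∈ K, M.Good z ∧ z.2 ∈ Set.Icc 0 S.T) :
    CongPow elementSize K (k + 1) (fun z => gramDet (M.projA z)) fun z => gramDet (M.A z) := by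
  have hρ : SmoothAtPts K (elementSize (m := m)) := contDiff_elementSize.smoothAtPts
  refine (CongPow.gramDet hρ M.contDiff_P.smoothAtPts fun i j => ?_).trans
    (CongPow.gramDet hρ M.contDiff_A.smoothAtPts fun i j => ?_)
  · have hc : ∀ w : EuclideanSpace ℝ (Fin m),
        CongPow elementSize K (k + 1) (fun z => M.projA z w) fun z => M.P z w := fun w =>
      (congPow_projA hK).bilin hρ (ContinuousLinearMap.id ℝ _) M.contDiff_P.smoothAtPts
        contDiff_const.smoothAtPts (CongPow.of_eqOn (f := fun _ => w) fun _ _ _ => rfl)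
    have hs : ∀ w : EuclideanSpace ℝ (Fin m), SmoothAtPts K fun z => M.P z w := fun w =>
      (M.contDiff_P.clm_apply contDiff_const).smoothAtPts
    exact (hc _).bilin hρ (innerSL ℝ) (hs _) (hs _) (hc _)
  · have h := ((congPow_inner_normal hK (EuclideanSpace.single i 1)).mul_zero_zero
      (congPow_inner_normal hK (EuclideanSpace.single j 1))).mono (n := k + 1) hρ (by omega)
    have h2 := (CongPow.of_eqOn (ρ := elementSize) (K := K) (n := k + 1)
      (f := fun z => ⟪M.A z (EuclideanSpace.single i 1), M.A z (EuclideanSpace.single j 1)⟫)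
      fun _ _ _ => rfl).sub h
    simp only [sub_zero] at h2
    exact (CongPow.of_eqOn fun z hz _ => (hK z hz).1.inner_P _ _).trans h2

theorem smoothAtPts_gramDet {L : ElementParam m × ℝ → EuclideanSpace ℝ (Fin m) →L[ℝ] Amb m}
    (hL : ContDiff ℝ ∞ L) : SmoothAtPts K fun z => gramDet (L z) :=
  (contDiff_gramDet.comp hL).smoothAtPts

theorem congPow_area (hk : 1 ≤ k) (hK : ∀ z ∈ K, M.Good z ∧ z.2 ∈ Set.Icc 0 S.T) :
    CongPow elementSize K (k + 1) M.area fun _ => 1 :=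
  (congPow_gramDet hk hK).sqrt_div (smoothAtPts_gramDet M.contDiff_projA)
    (smoothAtPts_gramDet M.contDiff_A) (fun z hz => (hK z hz).1.projA_pos)
    fun z hz => (hK z hz).1.A_pos

theorem congPow_one_div_area (hk : 1 ≤ k) (hK : ∀ z ∈ K, M.Good z ∧ z.2 ∈ Set.Icc 0 S.T) :
    CongPow elementSize K (k + 1) (fun z => 1 / M.area z) fun _ => 1 := by
  simp only [area, one_div_div]
  exact (congPow_gramDet hk hK).symm.sqrt_div (smoothAtPts_gramDet M.contDiff_A)
    (smoothAtPts_gramDet M.contDiff_projA) (fun z hz => (hK z hz).1.A_pos)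
    fun z hz => (hK z hz).1.projA_pos

theorem smoothAtPts_area (hK : ∀ z ∈ K, M.Good z ∧ z.2 ∈ Set.Icc 0 S.T) :
    SmoothAtPts K M.area := fun z hz =>
  ((smoothAtPts_gramDet M.contDiff_projA z hz).sqrt (hK z hz).1.projA_pos.ne').div
    ((smoothAtPts_gramDet M.contDiff_A z hz).sqrt (hK z hz).1.A_pos.ne')
    (Real.sqrt_pos.2 (hK z hz).1.A_pos).ne'

theorem area_pos {z : ElementParam m × ℝ} (hz : M.Good z) : 0 < M.area z :=
  div_pos (Real.sqrt_pos.2 hz.projA_pos) (Real.sqrt_pos.2 hz.A_pos)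

theorem smoothAtPts_gramOp {L : ElementParam m × ℝ → EuclideanSpace ℝ (Fin m) →L[ℝ] Amb m}
    (hL : ContDiff ℝ ∞ L) : SmoothAtPts K fun z => gramOp (L z) :=
  (((adjMap _ _).contDiff.comp hL).clm_comp hL).smoothAtPts

theorem smoothAtPts_inverse_gramOp
    {L : ElementParam m × ℝ → EuclideanSpace ℝ (Fin m) →L[ℝ] Amb m} (hL : ContDiff ℝ ∞ L)
    (hpos : ∀ z ∈ K, 0 < gramDet (L z)) : SmoothAtPts K fun z => Ring.inverse (gramOp (L z)) :=
  (smoothAtPts_gramOp hL).ringInverse fun z hz => isUnit_gramOp (gramDet_pos_iff.1 (hpos z hz))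

/-- In this form `Pr Pr_h Pr` differs from `Pr` only in the inverse Gram operator. -/
theorem tangTang_eq (z : ElementParam m × ℝ) :
    M.tangTang z = M.P z ∘L Ring.inverse (gramOp (M.A z)) ∘L adjMap _ _ (M.P z) := by
  have h : adjMap _ _ (M.P z) = adjMap _ _ (M.A z) ∘L M.tang z :=
    adjMap_comp (M.tang z) (fun v w => M.inner_tang_left z v w) (M.A z)
  rw [h]
  rfl

theorem smoothAtPts_tangTang (hK : ∀ z ∈ K, M.Good z ∧ z.2 ∈ Set.Icc 0 S.T) :
    SmoothAtPts K M.tangTang := fun z hz => by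
  have h : M.tangTang = fun z =>
      M.P z ∘L Ring.inverse (gramOp (M.A z)) ∘L adjMap _ _ (M.P z) := funext tangTang_eq
  rw [h]
  exact M.contDiff_P.contDiffAt.clm_comp
    ((smoothAtPts_inverse_gramOp M.contDiff_A (fun z hz => (hK z hz).1.A_pos) z hz).clm_comp
      M.contDiff_adjMap_P.contDiffAt)

theorem congPow_inverse_gramOp (hk : 1 ≤ k) (hK : ∀ z ∈ K, M.Good z ∧ z.2 ∈ Set.Icc 0 S.T) :
    CongPow elementSize K (k + 1) (fun z => Ring.inverse (gramOp (M.A z)))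
      fun z => Ring.inverse (gramOp (M.P z)) := by
  have hρ : SmoothAtPts K (elementSize (m := m)) := contDiff_elementSize.smoothAtPts
  have h1 : CongPow elementSize K (2 * k) (fun z => gramOp (M.A z)) fun z => gramOp (M.P z) :=
    ⟨M.gramDefect, M.contDiff_gramDefect.smoothAtPts,
      fun z hz hr => (hK z hz).1.gramOp_A (hK z hz).2 hr⟩
  exact (h1.mono (n := k + 1) hρ (by omega)).ringInverse
    (smoothAtPts_gramOp M.contDiff_A) (smoothAtPts_gramOp M.contDiff_P)
    (fun z hz => isUnit_gramOp (gramDet_pos_iff.1 (hK z hz).1.A_pos))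
    (fun z hz => isUnit_gramOp (gramDet_pos_iff.1 (hK z hz).1.P_pos))

theorem congPow_tangTang (hk : 1 ≤ k) (hK : ∀ z ∈ K, M.Good z ∧ z.2 ∈ Set.Icc 0 S.T) :
    CongPow elementSize K (k + 1) M.tangTang M.tang := by
  have hρ : SmoothAtPts K (elementSize (m := m)) := contDiff_elementSize.smoothAtPts
  have hsinv : SmoothAtPts K fun z => Ring.inverse (gramOp (M.P z)) :=
    smoothAtPts_inverse_gramOp M.contDiff_P fun z hz => (hK z hz).1.P_pos
  have hP : SmoothAtPts K M.P := M.contDiff_P.smoothAtPts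
  have hPa := M.contDiff_adjMap_P.smoothAtPts (K := K)
  have h2 : CongPow elementSize K (k + 1)
      (fun z => Ring.inverse (gramOp (M.A z)) ∘L adjMap _ _ (M.P z))
      fun z => Ring.inverse (gramOp (M.P z)) ∘L adjMap _ _ (M.P z) :=
    (congPow_inverse_gramOp hk hK).comp hρ hsinv hPa (CongPow.of_eqOn fun _ _ _ => rfl)
  have h2s : SmoothAtPts K fun z => Ring.inverse (gramOp (M.P z)) ∘L adjMap _ _ (M.P z) :=
    fun z hz => (hsinv z hz).clm_comp (hPa z hz)
  have h3 : CongPow elementSize K (k + 1)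
      (fun z => M.P z ∘L Ring.inverse (gramOp (M.A z)) ∘L adjMap _ _ (M.P z))
      fun z => M.P z ∘L Ring.inverse (gramOp (M.P z)) ∘L adjMap _ _ (M.P z) :=
    CongPow.comp hρ hP h2s (CongPow.of_eqOn fun _ _ _ => rfl) h2
  exact ((CongPow.of_eqOn fun z _ _ => tangTang_eq z).trans h3).trans
    (CongPow.of_eqOn fun z hz _ => (hK z hz).1.tang_eq_rangeProj.symm)

theorem congPow_idSubDH (hK : ∀ z ∈ K, M.Good z ∧ z.2 ∈ Set.Icc 0 S.T) :
    CongPow elementSize K (k + 1) M.idSubDH fun _ => ContinuousLinearMap.id ℝ (Amb m) := by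
  have h := (CongPow.of_eqOn (ρ := elementSize) (K := K) (n := k + 1)
    (f := fun _ => ContinuousLinearMap.id ℝ (Amb m)) fun _ _ _ => rfl).sub
    (congPow_dist_smul M.contDiff_weing.smoothAtPts hK)
  simp only [sub_zero] at h
  exact h

theorem congPow_core (hk : 1 ≤ k) (hK : ∀ z ∈ K, M.Good z ∧ z.2 ∈ Set.Icc 0 S.T) :
    CongPow elementSize K (k + 1) (fun z => M.idSubDH z ∘L M.tangTang z ∘L M.idSubDH z)
      M.tang := by
  have hρ : SmoothAtPts K (elementSize (m := m)) := contDiff_elementSize.smoothAtPts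
  have hid : SmoothAtPts K fun _ : ElementParam m × ℝ => ContinuousLinearMap.id ℝ (Amb m) :=
    contDiff_const.smoothAtPts
  have h := (congPow_idSubDH hK).comp hρ hid (M.contDiff_tang.clm_comp contDiff_const).smoothAtPts
    ((congPow_tangTang hk hK).comp hρ M.contDiff_tang.smoothAtPts hid (congPow_idSubDH hK))
  simpa only [ContinuousLinearMap.id_comp, ContinuousLinearMap.comp_id] using h

theorem congPow_Q (hk : 1 ≤ k) (hK : ∀ z ∈ K, M.Good z ∧ z.2 ∈ Set.Icc 0 S.T) :
    CongPow elementSize K (k + 1) M.Q M.tang := by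
  have h := (congPow_one_div_area hk hK).bilin contDiff_elementSize.smoothAtPts
    (ContinuousLinearMap.lsmul ℝ ℝ) contDiff_const.smoothAtPts M.contDiff_tang.smoothAtPts
    (congPow_core hk hK)
  simp only [ContinuousLinearMap.lsmul_apply, one_smul] at h
  exact h

theorem congPow_area_smul_Q (hk : 1 ≤ k) (hK : ∀ z ∈ K, M.Good z ∧ z.2 ∈ Set.Icc 0 S.T) :
    CongPow elementSize K (k + 1) (fun z => M.area z • M.Q z) M.tang := by
  refine (CongPow.of_eqOn fun z hz _ => ?_).trans (congPow_core hk hK)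
  rw [Q, smul_smul, mul_one_div_cancel (area_pos (hK z hz).1).ne', one_smul]

theorem smoothAtPts_idSubDH : SmoothAtPts K M.idSubDH :=
  (contDiff_const.sub (M.contDiff_dist.smul M.contDiff_weing)).smoothAtPts

theorem smoothAtPts_Q (hK : ∀ z ∈ K, M.Good z ∧ z.2 ∈ Set.Icc 0 S.T) :
    SmoothAtPts K M.Q := fun z hz =>
  (contDiffAt_const.div (smoothAtPts_area hK z hz) (area_pos (hK z hz).1).ne').smul
    ((smoothAtPts_idSubDH z hz).clm_comp
      ((smoothAtPts_tangTang hK z hz).clm_comp (smoothAtPts_idSubDH z hz)))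

end Congruences

/-- The coefficient of `r ^ k` in the tangential part of the discrete normal. -/
def normalCoeff (z : ElementParam m × ℝ) : Amb m :=
  M.P z (Ring.inverse (gramOp (M.P z)) (adjMap _ _ (refDeriv M.distCoeff z) 1))

theorem smoothAtPts_normalCoeff {K : Set (ElementParam m × ℝ)}
    (hK : ∀ z ∈ K, M.Good z ∧ z.2 ∈ Set.Icc 0 S.T) : SmoothAtPts K M.normalCoeff := fun z hz =>
  M.contDiff_P.contDiffAt.clm_apply
    ((smoothAtPts_inverse_gramOp M.contDiff_P (fun z hz => (hK z hz).1.P_pos) z hz).clm_apply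
      (((adjMap _ _).contDiff.comp (contDiff_refDeriv M.contDiff_distCoeff)).contDiffAt.clm_apply
        contDiffAt_const))

variable {M} in
/-- A unit normal of the curved element on the side of `ν` is close to `ν`: its tangential part is
determined by the normal components of the tangent vectors of the element. -/
theorem Good.norm_normal_sub_le {z : ElementParam m × ℝ} (hz : M.Good z)
    (ht : z.2 ∈ Set.Icc 0 S.T) (hr : 0 < elementSize z) {n : Amb m} (hn : ‖n‖ = 1)
    (hnA : ∀ v, ⟪n, M.A z v⟫ = 0) (hpos : 0 ≤ ⟪n, M.normal z⟫) :
    ‖M.normal z - n‖ ≤ 2 * (elementSize z ^ k * ‖M.normalCoeff z‖) := by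
  set c : ℝ := ⟪n, M.normal z⟫ with hc
  have hc1 : c ≤ 1 := by
    have := real_inner_le_norm n (M.normal z)
    rwa [hn, hz.norm_normal, one_mul] at this
  have hadj : adjMap _ _ (M.P z) n =
      -(c * elementSize z ^ k) • adjMap _ _ (refDeriv M.distCoeff z) (1 : ℝ) := by
    refine ext_inner_right ℝ fun v => ?_
    rw [inner_adjMap_left, inner_smul_left, inner_adjMap_left, P, ContinuousLinearMap.comp_apply,
      tang_apply, inner_sub_right, hnA, inner_smul_right,
      M.inner_normal_A hz.flatPoint_mem ht hr, elementSize]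
    simp only [RCLike.inner_apply, conj_trivial, mul_one]
    ring
  have htang : M.tang z n = -(c * elementSize z ^ k) • M.normalCoeff z := by
    rw [hz.tang_eq_rangeProj, rangeProj, ContinuousLinearMap.comp_apply,
      ContinuousLinearMap.comp_apply, hadj, map_smul, map_smul, normalCoeff]
  have hle : ‖M.tang z n‖ ≤ elementSize z ^ k * ‖M.normalCoeff z‖ := by
    rw [htang, norm_smul, norm_neg, norm_mul, Real.norm_of_nonneg hpos,
      Real.norm_of_nonneg (pow_nonneg hr.le k)]
    have : 0 ≤ elementSize z ^ k * ‖M.normalCoeff z‖ := by positivity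
    nlinarith
  have hsq := hz.norm_tang_apply_sq n
  rw [hn, real_inner_comm, ← hc] at hsq
  have hdiff : ‖M.normal z - n‖ ^ 2 = 2 - 2 * c := by
    rw [norm_sub_sq_real, hz.norm_normal, hn, real_inner_comm, ← hc]
    ring
  have h2 : ‖M.normal z - n‖ ≤ 2 * ‖M.tang z n‖ := by
    refine le_of_sq_le_sq ?_ (by positivity)
    rw [hdiff, mul_pow, hsq]
    nlinarith
  linarith

end ElementModel

end

/-! ### Degeneration of the element to a point -/

namespace ElementModel

variable {m : ℕ} {S : EvolvingSurface m} {𝒟 : SmoothDistance S} {k : ℕ} (M : ElementModel 𝒟 k)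

variable {M} in
theorem Good.eventually {z : ElementParam m × ℝ} (hz : M.Good z) :
    ∀ᶠ z' in nhds z, M.Good z' := by
  have hflat : Continuous fun z : ElementParam m × ℝ => (flatPoint z, (0 : ℝ)) :=
    contDiff_flatPoint.continuous.prodMk continuous_const
  have hlat : ∀ α : Fin (m + 1) → ℕ, Continuous fun z : ElementParam m × ℝ =>
      (z.1.1 + z.1.2.1 (z.1.2.2.1 • latticePoint m k α), (0 : ℝ)) := fun α => by fun_prop
  have h1 := M.contDiff_F_prod.continuous.continuousAt.eventually_mem
    (𝒟.isOpen.mem_nhds hz.F_mem)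
  have h2 := hflat.continuousAt.eventually_mem (𝒟.isOpen.mem_nhds hz.flatPoint_mem)
  have h3 : ∀ᶠ z' : ElementParam m × ℝ in nhds z, ∀ α ∈ Finset.piAntidiag Finset.univ k,
      (z'.1.1 + z'.1.2.1 (z'.1.2.2.1 • latticePoint m k α), (0 : ℝ)) ∈ 𝒟.U :=
    (Filter.eventually_all_finset _).2 fun α hα =>
      (hlat α).continuousAt.eventually_mem (𝒟.isOpen.mem_nhds (hz.lattice_mem α hα))
  have h4 := (contDiff_gramDet.comp M.contDiff_A).continuous.continuousAt.eventually_const_lt hz.A_pos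
  have h5 := (contDiff_gramDet.comp M.contDiff_P).continuous.continuousAt.eventually_const_lt hz.P_pos
  have h6 :=
    (contDiff_gramDet.comp M.contDiff_projA).continuous.continuousAt.eventually_const_lt hz.projA_pos
  filter_upwards [h1, h2, h3, h4, h5, h6] with z' e1 e2 e3 e4 e5 e6
  exact ⟨e1, e2, e3, e4, e5, e6⟩

/-- The differential of the extended flow takes its values in the tangent spaces of `Γ(t)`, because
the flow maps a neighbourhood of `Γ(0)` into `Γ(t)`. -/
theorem inner_N_fderiv_flow {a : Amb m} (ha : S.φ (a, 0) = 0) {t : ℝ} (ht : t ∈ Set.Icc 0 S.T)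
    (w : Amb m) : ⟪𝒟.N (𝒟.flow (a, t), t), fderiv ℝ 𝒟.flow (a, t) (w, 0)⟫ = 0 := by
  have h1 := hasFDerivAt_slice (𝒟.contDiff_flow.differentiable (by simp) (a, t))
  have h2 := (hasFDerivAt_slice (𝒟.smooth.differentiable (by simp) (𝒟.flow (a, t), t))).comp a h1
  have haU : (a, (0 : ℝ)) ∈ 𝒟.U := 𝒟.subset ⟨⟨le_rfl, S.T_pos.le⟩, ha⟩
  have hc : Continuous fun y : Amb m => (y, (0 : ℝ)) := by fun_prop
  have h3 : HasFDerivAt (fun y => 𝒟.D (𝒟.flow (y, t), t)) (0 : Amb m →L[ℝ] ℝ) a := by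
    refine (hasFDerivAt_const (0 : ℝ) a).congr_of_eventuallyEq ?_
    filter_upwards [hc.continuousAt.eventually_mem (𝒟.isOpen.mem_nhds haU)] with y hy
    exact 𝒟.D_eq_zero (𝒟.flow_mem hy ht)
  have h4 := DFunLike.congr_fun (h2.unique h3) w
  rw [𝒟.inner_N]
  simpa using h4

/-- For an element of size zero the curved element is a point of the surface, and its scaled
differential is the image of the edge map under the differential of the flow. -/
theorem good_of_size_zero (hk : 1 ≤ k) {a : Amb m} (ha : S.φ (a, 0) = 0)
    {W : EuclideanSpace ℝ (Fin m) →L[ℝ] Amb m} (hW : Function.Injective W)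
    (hWN : ∀ w, ⟪𝒟.N (a, 0), W w⟫ = 0) {t : ℝ} (ht : t ∈ Set.Icc 0 S.T)
    (ξ : EuclideanSpace ℝ (Fin m)) : M.Good ((a, W, 0, ξ), t) := by
  have haU : (a, (0 : ℝ)) ∈ 𝒟.U := 𝒟.subset ⟨⟨le_rfl, S.T_pos.le⟩, ha⟩
  have hflat : flatPoint ((a, W, (0 : ℝ), ξ), t) = a := by simp [flatPoint]
  have hF : M.F ((a, W, 0, ξ), t) = 𝒟.flow (a, t) := by
    rw [F, base, hflat]
    simp
  have hmem : (𝒟.flow (a, t), t) ∈ S.spaceTime := 𝒟.flow_mem haU ht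
  have hA : ∀ w, M.A ((a, W, 0, ξ), t) w = fderiv ℝ 𝒟.flow (a, t) (W w, 0) := fun w => by
    have hk0 : k ≠ 0 := by omega
    simp [A, hflat, zero_pow hk0]
  have hAinj : Function.Injective (M.A ((a, W, 0, ξ), t)) := by
    rw [injective_iff_map_eq_zero]
    intro w hw
    rw [hA] at hw
    have := 𝒟.eq_zero_of_fderiv_flow_eq_zero ha ht (hWN w) hw
    exact hW (by rw [this, map_zero])
  have hP : M.P ((a, W, 0, ξ), t) = M.A ((a, W, 0, ξ), t) := by
    ext1 w
    rw [P, ContinuousLinearMap.comp_apply, tang_apply, normal, hF, hA,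
      inner_N_fderiv_flow ha ht, zero_smul, sub_zero]
  have hprojA : M.projA ((a, W, 0, ξ), t) = M.A ((a, W, 0, ξ), t) := by
    ext1 w
    rw [projA, sub_apply, smul_apply, dist, hF, 𝒟.D_eq_zero hmem, zero_smul, sub_zero, hP]
  have hpos := gramDet_pos_iff.2 hAinj
  refine ⟨?_, ?_, fun α _ => ?_, hpos, hP ▸ hpos, hprojA ▸ hpos⟩
  · rw [hF]
    exact 𝒟.subset hmem
  · rw [hflat]
    exact haU
  · simpa using haU

/-- A compact set that contains the parameters of all points of shape regular simplices of size at
most `1` with vertices on `Γ(0)`. The second condition follows from shape regularity. The last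
condition says that the other vertices lie on the zero level set of the distance function as well,
in a form that survives the passage to size zero. -/
def paramSet (σ : ℝ) : Set (ElementParam m) :=
  {b | (S.φ (b.1, 0) = 0 ∧ b.2.1 ∈ Metric.closedBall 0 (m : ℝ) ∧ b.2.2.1 ∈ Set.Icc (0 : ℝ) 1 ∧
      b.2.2.2 ∈ refSimplex m) ∧
    (∀ v i, 2 / σ * |v i| ≤ ‖b.2.1 v‖) ∧
    ∀ i, M.AD ((b.1, 0), b.2.2.1 • b.2.1 (EuclideanSpace.single i 1))
      (b.2.1 (EuclideanSpace.single i 1)) = 0}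

theorem isCompact_paramSet (σ : ℝ) : IsCompact (M.paramSet σ) := by
  have : ProperSpace (EuclideanSpace ℝ (Fin m) →L[ℝ] Amb m) := FiniteDimensional.proper ℝ _
  have h1 : IsCompact {b : ElementParam m | S.φ (b.1, 0) = 0 ∧
      b.2.1 ∈ Metric.closedBall 0 (m : ℝ) ∧ b.2.2.1 ∈ Set.Icc (0 : ℝ) 1 ∧
      b.2.2.2 ∈ refSimplex m} :=
    (S.compact 0 ⟨le_rfl, S.T_pos.le⟩).prod ((isCompact_closedBall _ _).prod
      (isCompact_Icc.prod (isCompact_refSimplex m)))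
  have h2 : IsClosed {b : ElementParam m | ∀ v i, 2 / σ * |v i| ≤ ‖b.2.1 v‖} := by
    simp only [Set.ofPred_forall]
    exact isClosed_iInter fun v => isClosed_iInter fun i =>
      isClosed_le continuous_const (by fun_prop)
  have h3 : IsClosed {b : ElementParam m | ∀ i,
      M.AD ((b.1, 0), b.2.2.1 • b.2.1 (EuclideanSpace.single i 1))
        (b.2.1 (EuclideanSpace.single i 1)) = 0} := by
    simp only [Set.ofPred_forall]
    refine isClosed_iInter fun i => isClosed_eq ?_ continuous_const
    exact (M.AD_smooth.continuous.comp (by fun_prop)).clm_apply (by fun_prop)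
  exact h1.inter_right (h2.inter h3)

theorem good_of_mem_paramSet (hk : 1 ≤ k) {σ : ℝ} (hσ : 0 < σ) {b : ElementParam m}
    (hb : b ∈ M.paramSet σ) (hr : b.2.2.1 = 0) {t : ℝ} (ht : t ∈ Set.Icc 0 S.T) :
    M.Good (b, t) := by
  obtain ⟨a, W, r, ξ⟩ := b
  obtain ⟨⟨ha, -, -, -⟩, hW, hAD⟩ := hb
  simp only at ha hW hAD hr
  subst hr
  refine M.good_of_size_zero hk ha ?_ (fun w => ?_) ht ξ
  · rw [injective_iff_map_eq_zero]
    intro v hv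
    ext i
    have h1 := hW v i
    rw [hv, norm_zero] at h1
    have h2 : 0 < 2 / σ := by positivity
    have h3 : |v i| ≤ 0 := by
      by_contra! h
      exact absurd h1 (not_le.2 (mul_pos h2 h))
    simpa using abs_nonpos_iff.1 h3
  · -- At size zero the last condition in `paramSet` says that `W` maps into the tangent space.
    simp only [zero_smul, M.AD_zero] at hAD
    rw [map_eq_sum_single, inner_sum]
    exact Finset.sum_eq_zero fun i _ => by rw [inner_smul_right, hAD, mul_zero]

/-- All sufficiently small shape regular elements are described by the model. -/
theorem exists_forall_good (hk : 1 ≤ k) {σ : ℝ} (hσ : 0 < σ) :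
    ∃ r₁ : ℝ, 0 < r₁ ∧ r₁ ≤ 1 ∧ ∀ b ∈ M.paramSet σ, b.2.2.1 ≤ r₁ → ∀ t ∈ Set.Icc 0 S.T,
      M.Good (b, t) := by
  -- On the compact set of parameters outside the interior of the good set, the size is positive and
  -- therefore bounded below.
  have hc : IsCompact ((M.paramSet σ ×ˢ Set.Icc 0 S.T) \ interior {z | M.Good z}) :=
    ((M.isCompact_paramSet σ).prod isCompact_Icc).diff isOpen_interior
  obtain ⟨ρ, hρ, h⟩ := hc.exists_forall_le' (f := fun z : ElementParam m × ℝ => z.1.2.2.1) (a := 0)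
    (Continuous.continuousOn (by fun_prop)) fun z hz => by
      refine lt_of_le_of_ne hz.1.1.1.2.2.1.1 fun h0 => hz.2 ?_
      exact mem_interior_iff_mem_nhds.2 (M.good_of_mem_paramSet hk hσ hz.1.1 h0.symm hz.1.2).eventually
  refine ⟨min (ρ / 2) 1, by positivity, min_le_right _ _, fun b hb hr t ht => ?_⟩
  by_contra hg
  have h1 := h (b, t) ⟨⟨hb, ht⟩, fun hi => hg (interior_subset hi)⟩
  have h2 := hr.trans (min_le_left _ _)
  simp only at h1
  linarith

end ElementModel

/-! ### The elements of a triangulation as values of the model -/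

namespace InitialTriangulation

variable {m : ℕ} {S : EvolvingSurface m} (𝒯 : InitialTriangulation S)

/-- The model parameters of a point of an element; the size is the diameter of the flat simplex. -/
noncomputable def elementParam (e : Fin 𝒯.N) (ξ : EuclideanSpace ℝ (Fin m)) : ElementParam m :=
  (𝒯.vert e 0, edgeMap (𝒯.vert e) (𝒯.flatDiam e), 𝒯.flatDiam e, ξ)

variable {𝒯} {𝒟 : SmoothDistance S} {k : ℕ} {M : ElementModel 𝒟 k} {e : Fin 𝒯.N}
  {ξ : EuclideanSpace ℝ (Fin m)} {t : ℝ}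

theorem elementParam_mem_paramSet (hm : 1 ≤ m) {σ : ℝ} (hσ : 0 < σ) (hreg : 𝒯.ShapeRegular σ)
    (hr : 𝒯.flatDiam e ≤ 1) (hξ : ξ ∈ refSimplex m) :
    𝒯.elementParam e ξ ∈ M.paramSet σ := by
  have hpos := 𝒯.flatDiam_pos hm e
  have h0 : ∀ i, 𝒟.D (𝒯.vert e i, 0) = 0 := fun i =>
    𝒟.D_eq_zero ⟨⟨le_rfl, S.T_pos.le⟩, 𝒯.vert_mem e i⟩
  obtain ⟨x₀, hx₀, hball⟩ := hreg e
  refine ⟨⟨𝒯.vert_mem e 0, ?_, ⟨hpos.le, hr⟩, hξ⟩, fun v i => ?_, fun i => ?_⟩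
  · exact mem_closedBall_zero_iff.2 (norm_edgeMap_le hpos (𝒯.dist_vert_le_flatDiam e))
  · exact le_norm_edgeMap (𝒯.indep e) hpos hσ hx₀ hball v i
  · have hy : 𝒯.flatDiam e • edgeMap (𝒯.vert e) (𝒯.flatDiam e) (EuclideanSpace.single i 1) =
        𝒯.vert e i.succ - 𝒯.vert e 0 := by
      rw [edgeMap_single, smul_inv_smul₀ hpos.ne']
    have h1 := M.AD_spec (𝒯.vert e 0) 0
      (𝒯.flatDiam e • edgeMap (𝒯.vert e) (𝒯.flatDiam e) (EuclideanSpace.single i 1))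
    rw [map_smul, hy, add_sub_cancel, h0, h0, zero_add, smul_eq_mul, ← hy] at h1
    exact (mul_eq_zero.1 h1.symm).resolve_left hpos.ne'

theorem node_eq (hm : 1 ≤ m) (hk : 1 ≤ k) (hz : M.Good (𝒯.elementParam e ξ, t))
    {α : Fin (m + 1) → ℕ} (hα : α ∈ Finset.piAntidiag Finset.univ k) (s : ℝ) :
    𝒯.node k e α s = 𝒟.flow (𝒯.vert e 0 + edgeMap (𝒯.vert e) (𝒯.flatDiam e)
      (𝒯.flatDiam e • latticePoint m k α), s) := by
  have hk0 : (k : ℝ) ≠ 0 := by positivity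
  have hsum : ∑ i, ((α i : ℝ) / k) = 1 := by
    rw [← Finset.sum_div, ← Nat.cast_sum, (Finset.mem_piAntidiag.1 hα).1, div_self hk0]
  have h1 : ∑ i, ((α i : ℝ) / k) • 𝒯.vert e i = 𝒯.vert e 0 +
      edgeMap (𝒯.vert e) (𝒯.flatDiam e) (𝒯.flatDiam e • latticePoint m k α) :=
    sum_smul_eq_edgeMap (𝒯.vert e) (𝒯.flatDiam_pos hm e).ne' _ hsum
  have h2 := hz.lattice_mem α hα
  simp only [elementParam] at h2
  rw [node, h1, 𝒟.proj_eq h2 ⟨le_rfl, S.T_pos.le⟩]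
  rfl

theorem param_eq (hm : 1 ≤ m) (hk : 1 ≤ k) (hz : M.Good (𝒯.elementParam e ξ, t))
    (η : EuclideanSpace ℝ (Fin m)) (s : ℝ) :
    𝒯.param k e η s = M.F (𝒯.elementParam e η, s) := by
  rw [elementParam, M.F_eq_sum, param]
  exact Finset.sum_congr rfl fun α hα => by rw [node_eq hm hk hz hα]

theorem hasFDerivAt_param (hm : 1 ≤ m) (hk : 1 ≤ k) (hz : M.Good (𝒯.elementParam e ξ, t)) :
    HasFDerivAt (fun η => 𝒯.param k e η t)
      (𝒯.flatDiam e • M.A (𝒯.elementParam e ξ, t)) ξ := by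
  simp only [param_eq hm hk hz]
  exact M.hasFDerivAt_F _ _ _ _ _

theorem hasFDerivAt_proj_param (hm : 1 ≤ m) (hk : 1 ≤ k) (hz : M.Good (𝒯.elementParam e ξ, t))
    (ht : t ∈ Set.Icc 0 S.T) :
    HasFDerivAt (fun η => S.proj (𝒯.param k e η t) t)
      (𝒯.flatDiam e • M.projA (𝒯.elementParam e ξ, t)) ξ := by
  have h1 : HasFDerivAt (fun y => S.proj y t) (M.tang (𝒯.elementParam e ξ, t) -
      M.dist (𝒯.elementParam e ξ, t) • M.weing (𝒯.elementParam e ξ, t)) (𝒯.param k e ξ t) := by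
    rw [param_eq hm hk hz]
    exact (𝒟.hasFDerivAt_foot _ t).congr_of_eventuallyEq (𝒟.eventually_eq_proj hz.F_mem ht)
  refine (h1.comp ξ (hasFDerivAt_param hm hk hz)).congr_fderiv ?_
  ext1 w
  simp [ElementModel.projA, ElementModel.P, smul_sub]

theorem dparam_eq (hm : 1 ≤ m) (hk : 1 ≤ k) (hz : M.Good (𝒯.elementParam e ξ, t)) :
    𝒯.dparam k e ξ t = 𝒯.flatDiam e • M.A (𝒯.elementParam e ξ, t) :=
  (hasFDerivAt_param hm hk hz).fderiv

theorem tangentSpace_eq (hm : 1 ≤ m) (hk : 1 ≤ k) (hz : M.Good (𝒯.elementParam e ξ, t)) :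
    𝒯.tangentSpace k e ξ t = LinearMap.range (M.A (𝒯.elementParam e ξ, t)).toLinearMap := by
  rw [tangentSpace, dparam_eq hm hk hz]
  exact LinearMap.range_smul _ _ (𝒯.flatDiam_pos hm e).ne'

theorem Prh_eq (hm : 1 ≤ m) (hk : 1 ≤ k) (hz : M.Good (𝒯.elementParam e ξ, t)) :
    𝒯.Prh k e ξ t = rangeProj (M.A (𝒯.elementParam e ξ, t)) :=
  (rangeProj_eq_starProjection (gramDet_pos_iff.1 hz.A_pos) (tangentSpace_eq hm hk hz)).symm

theorem ν_param_eq (hm : 1 ≤ m) (hk : 1 ≤ k) (hz : M.Good (𝒯.elementParam e ξ, t))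
    (ht : t ∈ Set.Icc 0 S.T) :
    S.ν (𝒯.param k e ξ t) t = M.normal (𝒯.elementParam e ξ, t) := by
  rw [param_eq hm hk hz, 𝒟.ν_eq hz.F_mem ht]
  rfl

theorem distOn_eq (hm : 1 ≤ m) (hk : 1 ≤ k) (hz : M.Good (𝒯.elementParam e ξ, t))
    (ht : t ∈ Set.Icc 0 S.T) : 𝒯.distOn k e ξ t = M.dist (𝒯.elementParam e ξ, t) := by
  rw [distOn, param_eq hm hk hz, 𝒟.eq_d _ _ hz.F_mem ht]
  rfl

theorem Pr_eq (hm : 1 ≤ m) (hk : 1 ≤ k) (hz : M.Good (𝒯.elementParam e ξ, t))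
    (ht : t ∈ Set.Icc 0 S.T) : 𝒯.Pr k e ξ t = M.tang (𝒯.elementParam e ξ, t) := by
  rw [Pr, param_eq hm hk hz, 𝒟.Pr_eq hz.F_mem ht]
  rfl

theorem idSubDH_eq (hm : 1 ≤ m) (hk : 1 ≤ k) (hz : M.Good (𝒯.elementParam e ξ, t))
    (ht : t ∈ Set.Icc 0 S.T) : 𝒯.idSubDH k e ξ t = M.idSubDH (𝒯.elementParam e ξ, t) := by
  rw [idSubDH, distOn_eq hm hk hz ht, param_eq hm hk hz, 𝒟.weingarten_eq hz.F_mem ht]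
  rfl

theorem δ_eq (hm : 1 ≤ m) (hk : 1 ≤ k) (hz : M.Good (𝒯.elementParam e ξ, t))
    (ht : t ∈ Set.Icc 0 S.T) : 𝒯.δ k e ξ t = M.area (𝒯.elementParam e ξ, t) := by
  rw [δ, (hasFDerivAt_proj_param hm hk hz ht).fderiv, dparam_eq hm hk hz,
    areaElement_smul_div (𝒯.flatDiam_pos hm e)]
  rfl

theorem Q_eq (hm : 1 ≤ m) (hk : 1 ≤ k) (hz : M.Good (𝒯.elementParam e ξ, t))
    (ht : t ∈ Set.Icc 0 S.T) : 𝒯.Q k e ξ t = M.Q (𝒯.elementParam e ξ, t) := by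
  rw [Q, δ_eq hm hk hz ht, idSubDH_eq hm hk hz ht, Pr_eq hm hk hz ht, Prh_eq hm hk hz]
  rfl

end InitialTriangulation

/-! ### Uniform bounds -/

/-- If two functions agree modulo the `n`-th power of a parameter that does not depend on time, all
time derivatives of their difference are of the order of this power, uniformly on compact sets. -/
theorem CongPow.exists_bound_iteratedDerivWithin {B G : Type*} [NormedAddCommGroup B]
    [NormedSpace ℝ B] [NormedAddCommGroup G] [NormedSpace ℝ G] {ρ : B → ℝ} {T : ℝ} (hT : 0 < T)
    {K₀ : Set B} (hK₀ : IsCompact K₀) {n : ℕ} {f g : B × ℝ → G}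
    (h : CongPow (fun z : B × ℝ => ρ z.1) (K₀ ×ˢ Set.Icc 0 T) n f g) (ℓ : ℕ) :
    ∃ C : ℝ, 0 ≤ C ∧ ∀ b ∈ K₀, 0 < ρ b → ∀ t ∈ Set.Icc 0 T,
      ‖iteratedDerivWithin ℓ (fun s => f (b, s) - g (b, s)) (Set.Icc 0 T) t‖ ≤ C * ρ b ^ n := by
  obtain ⟨q, hq, e⟩ := h
  obtain ⟨C, hC⟩ := exists_bound_iteratedDerivWithin_slice hT hK₀ hq ℓ
  refine ⟨max C 0, le_max_right _ _, fun b hb hr t ht => ?_⟩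
  have hu := uniqueDiffOn_Icc hT
  have h1 : Set.EqOn (fun s => f (b, s) - g (b, s)) (fun s => ρ b ^ n • q (b, s))
      (Set.Icc 0 T) := fun s hs => by
    have := e (b, s) ⟨hb, hs⟩ hr
    simp only at this ⊢
    rw [this, add_sub_cancel_left]
  have hs : ContDiffWithinAt ℝ ℓ (fun s => q (b, s)) (Set.Icc 0 T) t :=
    ((hq (b, t) ⟨hb, ht⟩).contDiffWithinAt_slice).of_le (by exact_mod_cast le_top)
  rw [iteratedDerivWithin_congr h1 ht, iteratedDerivWithin_fun_const_smul ht hu _ hs, norm_smul,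
    Real.norm_of_nonneg (pow_nonneg hr.le n), mul_comm]
  have := pow_nonneg hr.le n
  gcongr
  exact (hC b hb t ht).trans (le_max_left _ _)

namespace ElementModel

variable {m : ℕ} {S : EvolvingSurface m} {𝒟 : SmoothDistance S} {k : ℕ} {M : ElementModel 𝒟 k}

/-- The uniform estimates on a compact set of parameters. -/
theorem exists_uniform_bounds (hk : 1 ≤ k) {K₀ : Set (ElementParam m)} (hK₀ : IsCompact K₀)
    (hgood : ∀ b ∈ K₀, ∀ t ∈ Set.Icc 0 S.T, M.Good (b, t)) :
    ∃ c : ℕ → ℝ, (∀ ℓ, 0 < c ℓ) ∧ ∀ b ∈ K₀, 0 < b.2.2.1 → ∀ t ∈ Set.Icc 0 S.T,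
      (∀ ℓ, ‖iteratedDerivWithin ℓ (fun s => M.dist (b, s)) (Set.Icc 0 S.T) t‖
        ≤ c ℓ * b.2.2.1 ^ (k + 1)) ∧
      (∀ ℓ, ‖iteratedDerivWithin ℓ (fun s => M.area (b, s) - 1) (Set.Icc 0 S.T) t‖
        ≤ c ℓ * b.2.2.1 ^ (k + 1)) ∧
      (∀ ℓ, ‖iteratedDerivWithin ℓ (fun s => M.Q (b, s) - M.tang (b, s)) (Set.Icc 0 S.T) t‖
        ≤ c ℓ * b.2.2.1 ^ (k + 1)) ∧
      ‖M.area (b, t) • M.Q (b, t) - M.tang (b, t)‖ ≤ c 0 * b.2.2.1 ^ (k + 1) ∧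
      2 * (b.2.2.1 ^ k * ‖M.normalCoeff (b, t)‖) ≤ c 0 * b.2.2.1 ^ k := by
  have hK : ∀ z ∈ K₀ ×ˢ Set.Icc 0 S.T, M.Good z ∧ z.2 ∈ Set.Icc 0 S.T := fun z hz =>
    ⟨hgood z.1 hz.1 z.2 hz.2, hz.2⟩
  choose c₁ hc₁ h₁ using (CongPow.exists_bound_iteratedDerivWithin (ρ := fun b => b.2.2.1) S.T_pos
    hK₀ (congPow_dist hK))
  choose c₂ hc₂ h₂ using (CongPow.exists_bound_iteratedDerivWithin (ρ := fun b => b.2.2.1) S.T_pos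
    hK₀ (congPow_area hk hK))
  choose c₃ hc₃ h₃ using (CongPow.exists_bound_iteratedDerivWithin (ρ := fun b => b.2.2.1) S.T_pos
    hK₀ (congPow_Q hk hK))
  obtain ⟨c₄, hc₄, h₄⟩ := CongPow.exists_bound_iteratedDerivWithin (ρ := fun b => b.2.2.1) S.T_pos
    hK₀ (congPow_area_smul_Q hk hK) 0
  obtain ⟨c₅, h₅⟩ := (hK₀.prod isCompact_Icc).exists_bound_of_continuousOn
    fun z hz => (M.smoothAtPts_normalCoeff hK z hz).continuousAt.continuousWithinAt
  refine ⟨fun ℓ => c₁ ℓ + c₂ ℓ + c₃ ℓ + c₄ + 2 * max c₅ 0 + 1, fun ℓ => ?_,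
    fun b hb hr t ht => ?_⟩
  · have := hc₁ ℓ
    have := hc₂ ℓ
    have := hc₃ ℓ
    positivity
  have hp : ∀ n, 0 ≤ b.2.2.1 ^ n := fun n => pow_nonneg hr.le n
  have hm₅ : 0 ≤ max c₅ 0 := le_max_right _ _
  have weaken : ∀ {x C C' : ℝ} (n : ℕ), x ≤ C * b.2.2.1 ^ n → C ≤ C' → x ≤ C' * b.2.2.1 ^ n :=
    fun n hx hC => hx.trans (mul_le_mul_of_nonneg_right hC (hp n))
  refine ⟨fun ℓ => weaken _ ?_ (?_ : c₁ ℓ ≤ _), fun ℓ => weaken _ (h₂ ℓ b hb hr t ht) ?_,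
    fun ℓ => weaken _ (h₃ ℓ b hb hr t ht) ?_, weaken _ ?_ (?_ : c₄ ≤ _),
    weaken _ ?_ (?_ : 2 * max c₅ 0 ≤ _)⟩
  · simpa using h₁ ℓ b hb hr t ht
  · linarith [hc₁ ℓ, hc₂ ℓ, hc₃ ℓ]
  · linarith [hc₁ ℓ, hc₂ ℓ, hc₃ ℓ]
  · linarith [hc₁ ℓ, hc₂ ℓ, hc₃ ℓ]
  · simpa using h₄ b hb hr t ht
  · linarith [hc₁ 0, hc₂ 0, hc₃ 0]
  · have := (h₅ (b, t) ⟨hb, ht⟩).trans (le_max_left _ 0)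
    rw [mul_assoc, mul_comm (max c₅ 0)]
    have := hp k
    gcongr
  · linarith [hc₁ 0, hc₂ 0, hc₃ 0]

theorem Good.norm_tang_comp_le {z : ElementParam m × ℝ} (hz : M.Good z) (L : Amb m →L[ℝ] Amb m) :
    ‖M.tang z ∘L L ∘L M.tang z‖ ≤ ‖L‖ := by
  have h1 := (M.tang z).opNorm_comp_le (L ∘L M.tang z)
  have h2 := L.opNorm_comp_le (M.tang z)
  have h3 := hz.norm_tang_le
  have h4 := norm_nonneg L
  have h5 := norm_nonneg (L ∘L M.tang z)
  nlinarith

/-- The tangential part of the time derivative of a family of projections vanishes. -/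
theorem tang_derivWithin_tang {b : ElementParam m}
    (hgood : ∀ t ∈ Set.Icc 0 S.T, M.Good (b, t)) {t : ℝ} (ht : t ∈ Set.Icc 0 S.T) :
    M.tang (b, t) ∘L derivWithin (fun s => M.tang (b, s)) (Set.Icc 0 S.T) t ∘L M.tang (b, t) =
      0 := by
  have hd : HasDerivWithinAt (fun s => M.tang (b, s))
      (derivWithin (fun s => M.tang (b, s)) (Set.Icc 0 S.T) t) (Set.Icc 0 S.T) t :=
    ((M.contDiff_tang.contDiffAt.contDiffWithinAt_slice (s := Set.Icc 0 S.T)).differentiableWithinAt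
      (by simp)).hasDerivWithinAt
  have h1 : HasDerivWithinAt (fun s => M.tang (b, s)) _ (Set.Icc 0 S.T) t :=
    (hd.clm_comp hd).congr (fun s hs => (hgood s hs).tang_tang.symm) (hgood t ht).tang_tang.symm
  have h2 := (uniqueDiffOn_Icc S.T_pos t ht).eq_deriv _ hd h1
  have hi : ∀ w, M.tang (b, t) (M.tang (b, t) w) = M.tang (b, t) w := fun w =>
    DFunLike.congr_fun (hgood t ht).tang_tang w
  ext1 w
  -- Differentiating `Pr Pr = Pr` and multiplying by `Pr` from both sides gives `2 X = X` for
  -- `X = Pr (∂ Pr) Pr`.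
  have h3 := congrArg (M.tang (b, t)) (DFunLike.congr_fun h2 (M.tang (b, t) w))
  simp only [add_apply, ContinuousLinearMap.comp_apply, map_add, hi] at h3
  simpa using h3

end ElementModel

theorem mainTheorem7 {m : ℕ} (hm : 1 ≤ m) (hm2 : m ≤ 2) (S : EvolvingSurface m)
    (k : ℕ) (hk : 1 ≤ k) (σ : ℝ) (hσ : 0 < σ) :
    ∃ h₀ : ℝ, 0 < h₀ ∧ ∃ c : ℕ → ℝ, (∀ ℓ, 0 < c ℓ) ∧
      ∀ (𝒯 : InitialTriangulation S), 𝒯.ShapeRegular σ →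
      ∀ h : ℝ, h ≤ h₀ → 𝒯.MeshSizeLE k h →
      ∀ e : Fin 𝒯.N, ∀ ξ ∈ refSimplex m,
        (ContDiffOn ℝ ∞ (𝒯.distOn k e ξ) (Set.Icc 0 S.T) ∧
          ContDiffOn ℝ ∞ (𝒯.δ k e ξ) (Set.Icc 0 S.T) ∧
          ContDiffOn ℝ ∞ (𝒯.Pr k e ξ) (Set.Icc 0 S.T) ∧
          ContDiffOn ℝ ∞ (𝒯.Q k e ξ) (Set.Icc 0 S.T)) ∧
        ∀ t ∈ Set.Icc 0 S.T,
          |𝒯.distOn k e ξ t| ≤ c 0 * h ^ (k + 1) ∧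
          |1 - 𝒯.δ k e ξ t| ≤ c 0 * h ^ (k + 1) ∧
          (∀ n, 𝒯.IsDiscreteNormal k e ξ t n →
            ‖S.ν (𝒯.param k e ξ t) t - n‖ ≤ c 0 * h ^ k) ∧
          ‖𝒯.Pr k e ξ t ∘L
            (ContinuousLinearMap.id ℝ (Amb m) - 𝒯.δ k e ξ t • 𝒯.Q k e ξ t) ∘L
              𝒯.Pr k e ξ t‖ ≤ c 0 * h ^ (k + 1) ∧
          (∀ ℓ : ℕ, 1 ≤ ℓ → |matDeriv S ℓ (𝒯.distOn k e) ξ t| ≤ c ℓ * h ^ (k + 1)) ∧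
          (∀ ℓ : ℕ, 1 ≤ ℓ → |matDeriv S ℓ (𝒯.δ k e) ξ t| ≤ c ℓ * h ^ (k + 1)) ∧
          ‖𝒯.Pr k e ξ t ∘L matDeriv S 1 (𝒯.Q k e) ξ t ∘L 𝒯.Pr k e ξ t‖
            ≤ c 1 * h ^ (k + 1) ∧
          (∀ ℓ : ℕ, 1 ≤ ℓ →
            ‖𝒯.Pr k e ξ t ∘L
              matDeriv S ℓ (fun η s => 𝒯.Q k e η s - 𝒯.Pr k e η s) ξ t ∘L
                𝒯.Pr k e ξ t‖ ≤ c ℓ * h ^ (k + 1)) := by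
  obtain ⟨𝒟⟩ := S.nonempty_smoothDistance
  obtain ⟨M⟩ := 𝒟.nonempty_elementModel hk
  obtain ⟨r₁, hr₁, hr₁', hgood⟩ := M.exists_forall_good hk hσ
  have hK₀ : IsCompact (M.paramSet σ ∩ {b | b.2.2.1 ≤ r₁}) :=
    (M.isCompact_paramSet σ).inter_right (isClosed_le (by fun_prop) continuous_const)
  have hgood' : ∀ b ∈ M.paramSet σ ∩ {b | b.2.2.1 ≤ r₁}, ∀ t ∈ Set.Icc 0 S.T, M.Good (b, t) :=
    fun b hb => hgood b hb.1 hb.2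
  obtain ⟨c, hc, hbound⟩ := ElementModel.exists_uniform_bounds hk hK₀ hgood'
  refine ⟨r₁, hr₁, c, hc, fun 𝒯 hreg h hh hmesh e ξ hξ => ?_⟩
  have hr : 0 < 𝒯.flatDiam e := 𝒯.flatDiam_pos hm e
  have hrh : 𝒯.flatDiam e ≤ h := 𝒯.flatDiam_le hk hmesh e
  have hb : 𝒯.elementParam e ξ ∈ M.paramSet σ ∩ {b | b.2.2.1 ≤ r₁} :=
    ⟨InitialTriangulation.elementParam_mem_paramSet hm hσ hreg ((hrh.trans hh).trans hr₁') hξ,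
      hrh.trans hh⟩
  have hG : ∀ t ∈ Set.Icc 0 S.T, M.Good (𝒯.elementParam e ξ, t) := hgood' _ hb
  have hK : ∀ z ∈ ({𝒯.elementParam e ξ} : Set (ElementParam m)) ×ˢ Set.Icc 0 S.T,
      M.Good z ∧ z.2 ∈ Set.Icc 0 S.T := by
    rintro ⟨b, t⟩ ⟨rfl, ht⟩
    exact ⟨hG t ht, ht⟩
  have hd : Set.EqOn (𝒯.distOn k e ξ) (fun s => M.dist (𝒯.elementParam e ξ, s))
      (Set.Icc 0 S.T) := fun s hs => InitialTriangulation.distOn_eq hm hk (hG s hs) hs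
  have hδ : Set.EqOn (𝒯.δ k e ξ) (fun s => M.area (𝒯.elementParam e ξ, s))
      (Set.Icc 0 S.T) := fun s hs => InitialTriangulation.δ_eq hm hk (hG s hs) hs
  have hPr : Set.EqOn (𝒯.Pr k e ξ) (fun s => M.tang (𝒯.elementParam e ξ, s))
      (Set.Icc 0 S.T) := fun s hs => InitialTriangulation.Pr_eq hm hk (hG s hs) hs
  have hQ : Set.EqOn (𝒯.Q k e ξ) (fun s => M.Q (𝒯.elementParam e ξ, s))
      (Set.Icc 0 S.T) := fun s hs => InitialTriangulation.Q_eq hm hk (hG s hs) hs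
  have hQs : ContDiffOn ℝ ∞ (fun s => M.Q (𝒯.elementParam e ξ, s)) (Set.Icc 0 S.T) :=
    fun s hs => (ElementModel.smoothAtPts_Q hK _ (Set.mk_mem_prod (Set.mem_singleton _) hs)).contDiffWithinAt_slice
  have hPs : ContDiffOn ℝ ∞ (fun s => M.tang (𝒯.elementParam e ξ, s)) (Set.Icc 0 S.T) :=
    fun s _ => M.contDiff_tang.contDiffAt.contDiffWithinAt_slice
  refine ⟨⟨?_, ?_, hPs.congr hPr, hQs.congr hQ⟩, fun t ht => ?_⟩
  · exact ContDiffOn.congr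
      (fun s _ => M.contDiff_dist.contDiffAt.contDiffWithinAt_slice) hd
  · exact ContDiffOn.congr
      (fun s hs => (ElementModel.smoothAtPts_area hK _ (Set.mk_mem_prod (Set.mem_singleton _) hs)).contDiffWithinAt_slice) hδ
  obtain ⟨b₁, b₂, b₃, b₄, b₅⟩ := hbound _ hb hr t ht
  have weaken : ∀ {x : ℝ} {ℓ : ℕ} (n : ℕ),
      x ≤ c ℓ * (𝒯.elementParam e ξ).2.2.1 ^ n → x ≤ c ℓ * h ^ n := fun {x ℓ} n hx =>
    hx.trans (mul_le_mul_of_nonneg_left (pow_le_pow_left₀ hr.le hrh n) (hc ℓ).le)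
  have hz := hG t ht
  have hdiff : ∀ ℓ, ‖𝒯.Pr k e ξ t ∘L
      matDeriv S ℓ (fun η s => 𝒯.Q k e η s - 𝒯.Pr k e η s) ξ t ∘L 𝒯.Pr k e ξ t‖
        ≤ c ℓ * h ^ (k + 1) := fun ℓ => by
    have heq : Set.EqOn (fun s => 𝒯.Q k e ξ s - 𝒯.Pr k e ξ s)
        (fun s => M.Q (𝒯.elementParam e ξ, s) - M.tang (𝒯.elementParam e ξ, s))
        (Set.Icc 0 S.T) := fun s hs => by
      beta_reduce
      rw [hQ hs, hPr hs]
    rw [hPr ht, matDeriv, iteratedDerivWithin_congr heq ht]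
    exact (hz.norm_tang_comp_le _).trans (weaken _ (b₃ ℓ))
  refine ⟨?_, ?_, fun n hn => ?_, ?_, fun ℓ _ => ?_, fun ℓ hℓ => ?_, ?_, fun ℓ _ => hdiff ℓ⟩
  · rw [hd ht, ← Real.norm_eq_abs]
    exact weaken _ (by simpa using b₁ 0)
  · rw [hδ ht, abs_sub_comm, ← Real.norm_eq_abs]
    exact weaken _ (by simpa using b₂ 0)
  · obtain ⟨hn1, hnT, hpos⟩ := hn
    rw [InitialTriangulation.ν_param_eq hm hk hz ht] at hpos ⊢
    rw [InitialTriangulation.tangentSpace_eq hm hk hz] at hnT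
    refine (hz.norm_normal_sub_le ht hr hn1 (fun v => ?_) hpos).trans (weaken _ b₅)
    exact (Submodule.mem_orthogonal' _ _).1 hnT _ ⟨v, rfl⟩
  · have heq : M.tang (𝒯.elementParam e ξ, t) ∘L (ContinuousLinearMap.id ℝ (Amb m) -
        M.area (𝒯.elementParam e ξ, t) • M.Q (𝒯.elementParam e ξ, t)) ∘L
          M.tang (𝒯.elementParam e ξ, t) =
        M.tang (𝒯.elementParam e ξ, t) ∘L (M.tang (𝒯.elementParam e ξ, t) -
          M.area (𝒯.elementParam e ξ, t) • M.Q (𝒯.elementParam e ξ, t)) ∘L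
            M.tang (𝒯.elementParam e ξ, t) := by
      simp only [ContinuousLinearMap.sub_comp, ContinuousLinearMap.id_comp, hz.tang_tang]
    rw [hPr ht, hδ ht, hQ ht, heq]
    refine (hz.norm_tang_comp_le _).trans (weaken _ ?_)
    rw [norm_sub_rev]
    exact b₄
  · rw [matDeriv, iteratedDerivWithin_congr hd ht, ← Real.norm_eq_abs]
    exact weaken _ (b₁ ℓ)
  · have heq : Set.EqOn (𝒯.δ k e ξ) (fun s => 1 + (M.area (𝒯.elementParam e ξ, s) - 1))
        (Set.Icc 0 S.T) := fun s hs => by rw [hδ hs]; ring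
    rw [matDeriv, iteratedDerivWithin_congr heq ht, iteratedDerivWithin_const_add hℓ,
      ← Real.norm_eq_abs]
    exact weaken _ (b₂ ℓ)
  · -- `Pr (∂ Pr) Pr = 0`, so that `Q` may be replaced by `Q - Pr`.
    have h1 := hdiff 1
    have hQd := (hQs.congr hQ).differentiableOn (by simp) t ht
    have hPd := (hPs.congr hPr).differentiableOn (by simp) t ht
    have h0 := ElementModel.tang_derivWithin_tang hG ht
    rw [← derivWithin_congr hPr (hPr ht)] at h0
    rw [matDeriv, iteratedDerivWithin_one, derivWithin_fun_sub hQd hPd, hPr ht,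
      ContinuousLinearMap.sub_comp, ContinuousLinearMap.comp_sub, h0, sub_zero] at h1
    rw [matDeriv, iteratedDerivWithin_one, hPr ht]
    exact h1
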